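/- **Notation.** Let $n\ge 1$, $\underline k=(k_1,\dots,k_n)$ with all $k_i\ge 1$, $\mathbb R^{\underline k}=\prod_i\mathbb R^{k_i}$, and $e(y)=e^{2\pi i y}$. For $\lambda\in\mathbb R_{\ge0}^n$ write $|\lambda|=\sum_i\lambda_i$. Let $S^{k_i}_{\lambda_i}\subset\mathbb R^{k_i}$ be the sphere of radius $\sqrt{\lambda_i}$ with its surface measure (for $\lambda_i=0$ the point $\{0\}$ with the Dirac measure), let $S^{\underline k}_{\lambda}=\prod_i S^{k_i}_{\lambda_i}$, let $\delta_{S^{\underline k}_\lambda}$ be the product of the surface measures, and $\operatorname{vol}(S^{\underline k}_\lambda)$ its total mass. All square roots are principal. Write $-1/\underline\tau=(-1/\tau_1,\dots,-1/\tau_n)$ and $\sqrt{-i\underline\tau}^{\,\underline k}=\prod_i\sqrt{-i\tau_i}^{\,k_i}$ for $\underline\tau\in\mathbb H^n$, and $g(\underline x,\underline\tau)=\prod_i e(|x_i|^2\tau_i/2)$. The Fourier transform is $\hat\varphi(y)=\int\varphi(x)e(-x^{\top}y)\,dx$ on Schwartz functions and $\langle\hat\mu,\varphi\rangle=\langle\mu,\hat\varphi\rangle$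 on tempered distributions. A sequence $(\lambda_m)_{m\ge0}$ in $\mathbb R_{\ge0}^n$ is *locally finite* if $\{m:|\lambda_m|\le R\}$ is finite for every $R$. Given such a sequence, weights $a_m\in\mathbb C$ *grow at most polynomially* if there are $C,N$ with $\sum_{|\lambda_m|\le R}|a_m|\le C(1+R)^N$ for all $R\ge0$. $\operatorname{Meas}_{\underline k}$ is the space of tempered distributions $\mu$ on $\mathbb R^{\underline k}$ such that both $\mu$ and $\hat\mu$ are of the form $\sum_m c_m\,\delta_{S^{\underline k}_{\lambda_m}}$ (convergence against every Schwartz function), with $(\lambda_m)$ locally finite and the masses $c_m\operatorname{vol}(S^{\underline k}_{\lambda_m})$ growing at most polynomially. $\operatorname{FS}_{\underline k}$ is the space of holomorphic $f:\mathbb H^n\to\mathbb C$ such that both $f$ and $\tilde f(\underline\tau)=\sqrt{-i\underline\tau}^{\,-\underline k}f(-1/\underline\tau)$ are of the form $\sum_m c_m\,e(\lambda_m\underline\tau/2)$, where $\lambda_m\underline\tau=\sum_i\lambda_{m,i}\tau_i$, with $(\lambda_m)$ locally finite and $(c_m)$ growing at most polynomially. $\operatorname{Mp}_2(\mathbb R)$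 is the group of pairs $(M,\phi)$ with $M=\left(\begin{smallmatrix}a&b\\c&d\end{smallmatrix}\right)\in\operatorname{SL}_2(\mathbb R)$ and $\phi:\mathbb H\to\mathbb C$ holomorphic, $\phi(\tau)^2=c\tau+d$, with $(M_1,\phi_1)(M_2,\phi_2)=(M_1M_2,\phi_1(M_2\,\cdot)\phi_2)$. Let $\omega$ be the Schrödinger model of the Weil representation of $\operatorname{Mp}_2(\mathbb R)^n$ on $\mathcal S(\mathbb R^{\underline k})$, so that, for $b\in\mathbb R^n$ and $a\in\mathbb R_{>0}^n$, $$\omega(t(b))\varphi(x)=e\Bigl(-\tfrac12\sum_i b_i|x_i|^2\Bigr)\varphi(x),\quad \omega(\operatorname{rot}(a))\varphi(x)=\prod_i\sqrt{a_i}^{\,-k_i}\,\varphi(x_1/a_1,\dots,x_n/a_n),\quad \omega(S)\varphi(x)=\prod_i\sqrt i^{\,k_i}\,\hat\varphi(-x),$$ where componentwise $t(b)=(\left(\begin{smallmatrix}1&b\\0&1\end{smallmatrix}\right),1)$, $\operatorname{rot}(a)=(\left(\begin{smallmatrix}a&0\\0&a^{-1}\end{smallmatrix}\right),a^{-1/2})$,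 $S=(\left(\begin{smallmatrix}0&-1\\1&0\end{smallmatrix}\right),\sqrt\tau)$, and $\omega(MN)=\omega(N)\,\omega(M)$. Put $\langle\mu|M,\varphi\rangle=\langle\mu,\omega(M^{-1})\varphi\rangle$ for tempered distributions and $(f|_{\underline k/2}(M,\phi))(\underline\tau)=\prod_i\phi_i(\tau_i)^{-k_i}f(M_1\tau_1,\dots,M_n\tau_n)$ for functions on $\mathbb H^n$. **Theorem.** The operators $\omega(M)$, $M\in\operatorname{Mp}_2(\mathbb R)^n$, with the stated values and product rule exist. With $\theta_\mu(\underline\tau)=\langle\mu,g(\cdot,\underline\tau)\rangle$, one has $\theta_{\mu|M}=\theta_\mu|_{\underline k/2}M$ for every tempered distribution $\mu$ on $\mathbb R^{\underline k}$ and every $M\in\operatorname{Mp}_2(\mathbb R)^n$, and $$\theta:\operatorname{Meas}_{\underline k}\to\operatorname{FS}_{\underline k},\qquad \mu\mapsto\theta_\mu,$$ is an isomorphism of complex vector spaces. Its inverse is $$f(\underline\tau)=\sum_m c_m\,e(\lambda_m\underline\tau/2)\ \longmapsto\ \mu_f=\sum_m\frac{c_m}{\operatorname{vol}(S^{\underline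 k}_{\lambda_m})}\,\delta_{S^{\underline k}_{\lambda_m}},$$ for every expansion of $f$ with $(\lambda_m)$ locally finite and $(c_m)$ growing at most polynomially. Finally, a measure $\mu\in\operatorname{Meas}_{\underline k}$ satisfies $\hat\mu=\mu$ if and only if $f=\theta_\mu$ satisfies $f(-1/\underline\tau)=\sqrt{-i\underline\tau}^{\,\underline k}f(\underline\tau)$. -/

import Mathlib

open scoped NNReal UpperHalfPlane SchwartzMap FourierTransform Manifold MatrixGroups ContDiff
open MeasureTheory

noncomputable section

namespace SphericalMeasures

/-! ### The metaplectic group -/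

/-- The metaplectic group `Mp₂(ℝ)`: pairs `(M, φ)` with `M ∈ SL₂(ℝ)` and `φ : ℍ → ℂ` holomorphic
with `φ(τ)² = cτ + d`. -/
@[ext]
structure Mp2 where
  mat : SL(2, ℝ)
  phi : ℍ → ℂ
  holo : MDifferentiable 𝓘(ℂ) 𝓘(ℂ) phi
  phi_sq : ∀ τ : ℍ, phi τ ^ 2 = ((mat 1 0 : ℝ) : ℂ) * τ + ((mat 1 1 : ℝ) : ℂ)

namespace Mp2

lemma mdifferentiable_moebius (M : SL(2, ℝ)) :
    MDifferentiable 𝓘(ℂ) 𝓘(ℂ) (fun τ : ℍ => M • τ) := by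
  have h := UpperHalfPlane.mdifferentiable_smul
    (g := Matrix.SpecialLinearGroup.mapGL ℝ M) (by simp)
  exact h

lemma cocycle (M N : SL(2, ℝ)) (τ : ℍ) :
    (((M * N) 1 0 : ℝ) : ℂ) * τ + (((M * N) 1 1 : ℝ) : ℂ) =
      (((M 1 0 : ℝ) : ℂ) * ((N • τ : ℍ) : ℂ) + ((M 1 1 : ℝ) : ℂ)) *
        (((N 1 0 : ℝ) : ℂ) * τ + ((N 1 1 : ℝ) : ℂ)) := by
  have h := UpperHalfPlane.denom_ne_zero (N : GL (Fin 2) ℝ) τ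
  have h' : ((N 1 0 : ℝ) : ℂ) * τ + ((N 1 1 : ℝ) : ℂ) ≠ 0 := by
    simpa [UpperHalfPlane.denom] using h
  rw [UpperHalfPlane.coe_specialLinearGroup_apply]
  simp only [Matrix.SpecialLinearGroup.coe_mul, Matrix.mul_apply, Fin.sum_univ_two,
    Algebra.algebraMap_self, RingHom.id_apply]
  rw [add_mul, mul_assoc, div_mul_cancel₀ _ h']
  push_cast
  ring

lemma phi_ne_zero (M : Mp2) (τ : ℍ) : M.phi τ ≠ 0 := by
  intro h0
  have h := UpperHalfPlane.denom_ne_zero (M.mat : GL (Fin 2) ℝ) τ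
  have h' : ((M.mat 1 0 : ℝ) : ℂ) * τ + ((M.mat 1 1 : ℝ) : ℂ) ≠ 0 := by
    simpa [UpperHalfPlane.denom] using h
  apply h'
  rw [← M.phi_sq, h0]
  simp

instance : One Mp2 where
  one :=
    { mat := 1
      phi := fun _ => 1
      holo := mdifferentiable_const
      phi_sq := by intro τ; simp }

/-- `(M₁, φ₁) (M₂, φ₂) = (M₁ M₂, φ₁(M₂ ·) φ₂)`. -/
instance : Mul Mp2 where
  mul M N :=
    { mat := M.mat * N.mat
      phi := fun τ => M.phi (N.mat • τ) * N.phi τ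
      holo := (M.holo.comp (mdifferentiable_moebius N.mat)).mul N.holo
      phi_sq := by
        intro τ
        rw [mul_pow, M.phi_sq, N.phi_sq, cocycle] }

lemma holo_inv (M : Mp2) :
    MDifferentiable 𝓘(ℂ) 𝓘(ℂ) (fun τ : ℍ => (M.phi (M.mat⁻¹ • τ))⁻¹) := by
  have h1 := M.holo.comp (mdifferentiable_moebius M.mat⁻¹)
  rw [UpperHalfPlane.mdifferentiable_iff] at h1 ⊢
  exact h1.inv (fun z _ => M.phi_ne_zero _)

/-- `(M, φ)⁻¹ = (M⁻¹, 1 / φ(M⁻¹ ·))`. -/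
instance : Inv Mp2 where
  inv M :=
    { mat := M.mat⁻¹
      phi := fun τ => (M.phi (M.mat⁻¹ • τ))⁻¹
      holo := M.holo_inv
      phi_sq := by
        intro τ
        have h := cocycle M.mat M.mat⁻¹ τ
        rw [mul_inv_cancel] at h
        have h2 : (1 : ℂ) = M.phi (M.mat⁻¹ • τ) ^ 2 *
            (((M.mat⁻¹ 1 0 : ℝ) : ℂ) * τ + ((M.mat⁻¹ 1 1 : ℝ) : ℂ)) := by
          rw [M.phi_sq]
          simpa using h
        rw [inv_pow]
        exact inv_eq_of_mul_eq_one_right h2.symm }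

@[simp] lemma one_mat : (1 : Mp2).mat = 1 := rfl
@[simp] lemma one_phi (τ : ℍ) : (1 : Mp2).phi τ = 1 := rfl
@[simp] lemma mul_mat (M N : Mp2) : (M * N).mat = M.mat * N.mat := rfl
@[simp] lemma mul_phi (M N : Mp2) (τ : ℍ) :
    (M * N).phi τ = M.phi (N.mat • τ) * N.phi τ := rfl
@[simp] lemma inv_mat (M : Mp2) : (M⁻¹).mat = M.mat⁻¹ := rfl
@[simp] lemma inv_phi (M : Mp2) (τ : ℍ) : (M⁻¹).phi τ = (M.phi (M.mat⁻¹ • τ))⁻¹ := rfl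

instance : Group Mp2 :=
  Group.ofLeftAxioms
    (by
      intro A B C
      refine Mp2.ext (by simp [mul_assoc]) ?_
      funext τ
      simp [mul_smul, mul_assoc])
    (by
      intro A
      refine Mp2.ext (by simp) ?_
      funext τ
      simp)
    (by
      intro A
      refine Mp2.ext (by simp) ?_
      funext τ
      simp [A.phi_ne_zero])

/-- `t(b) = ((1, b; 0, 1), 1)`. -/
def t (b : ℝ) : Mp2 where
  mat := ⟨!![1, b; 0, 1], by simp [Matrix.det_fin_two]⟩
  phi := fun _ => 1
  holo := mdifferentiable_const
  phi_sq := by intro τ; simp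

/-- `rot(a) = ((a, 0; 0, a⁻¹), a^{-1/2})` for `a > 0`. -/
def rot (a : ℝ) (ha : 0 < a) : Mp2 where
  mat := ⟨!![a, 0; 0, a⁻¹], by simp [Matrix.det_fin_two, ha.ne']⟩
  phi := fun _ => (((Real.sqrt a)⁻¹ : ℝ) : ℂ)
  holo := mdifferentiable_const
  phi_sq := by
    intro τ
    have h : ((Real.sqrt a)⁻¹) ^ 2 = a⁻¹ := by rw [inv_pow, Real.sq_sqrt ha.le]
    simp only [Matrix.of_apply, Matrix.cons_val', Matrix.cons_val_zero, Matrix.cons_val_one,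
      Matrix.cons_val_fin_one, Complex.ofReal_zero, zero_mul, zero_add]
    exact_mod_cast h

/-- `S = ((0, -1; 1, 0), √τ)` with the principal branch of the square root. -/
def S : Mp2 where
  mat := ⟨!![0, -1; 1, 0], by simp [Matrix.det_fin_two]⟩
  phi := fun τ => (τ : ℂ) ^ (1 / 2 : ℂ)
  holo := by
    rw [UpperHalfPlane.mdifferentiable_iff]
    have h : DifferentiableOn ℂ (fun z : ℂ => z ^ (1 / 2 : ℂ)) {z | 0 < z.im} := by
      intro z hz
      refine (DifferentiableAt.cpow_const differentiableAt_id ?_).differentiableWithinAt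
      exact Or.inr (ne_of_gt hz)
    refine h.congr ?_
    intro z hz
    simp only [Function.comp_apply]
    rw [UpperHalfPlane.ofComplex_apply_of_im_pos hz]
  phi_sq := by
    intro τ
    rw [← Complex.cpow_nat_mul]
    simp

end Mp2

/-! ### Euclidean space `ℝ^{k₁} × ⋯ × ℝ^{kₙ}`, Gaussians -/

variable {n : ℕ}

/-- `ℝ^{k₁} × ⋯ × ℝ^{kₙ}` with its Euclidean norm. -/
abbrev Space (k : Fin n → ℕ) : Type := PiLp 2 (fun i => EuclideanSpace ℝ (Fin (k i)))

/-- The function `x ↦ πi ∑ zᵢ |xᵢ|²`. -/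
def quad (k : Fin n → ℕ) (z : Fin n → ℂ) (x : Space k) : ℂ :=
  Real.pi * Complex.I * ∑ i, z i * ((‖x i‖ ^ 2 : ℝ) : ℂ)

lemma quad_hasTemperateGrowth (k : Fin n → ℕ) (z : Fin n → ℂ) :
    (quad k z).HasTemperateGrowth := by
  have h1 : ∀ i, (fun x : Space k => ((‖x i‖ ^ 2 : ℝ) : ℂ)).HasTemperateGrowth := by
    intro i
    have hp : (fun x : Space k => x i).HasTemperateGrowth :=
      (PiLp.proj (𝕜 := ℝ) 2 (fun i => EuclideanSpace ℝ (Fin (k i))) i).hasTemperateGrowth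
    exact Function.HasTemperateGrowth.comp Function.Complex.hasTemperateGrowth_ofReal
      ((Function.hasTemperateGrowth_norm_sq (EuclideanSpace ℝ (Fin (k i)))).comp hp)
  have h2 : (fun x : Space k => ∑ i, z i * ((‖x i‖ ^ 2 : ℝ) : ℂ)).HasTemperateGrowth :=
    Function.HasTemperateGrowth.sum
      (fun i _ => (Function.HasTemperateGrowth.const (z i)).mul (h1 i))
  exact (Function.HasTemperateGrowth.const ((Real.pi : ℂ) * Complex.I)).mul h2

lemma quad_re (k : Fin n → ℕ) (z : Fin n → ℂ) (x : Space k) :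
    (quad k z x).re = -(Real.pi * ∑ i, (z i).im * ‖x i‖ ^ 2) := by
  have h : quad k z x = Complex.I * ((Real.pi : ℂ) *
      ∑ i, z i * ((‖x i‖ ^ 2 : ℝ) : ℂ)) := by
    unfold quad; ring
  rw [h, Complex.I_mul_re, Complex.im_ofReal_mul, Complex.im_sum]
  simp only [Complex.im_mul_ofReal]

lemma norm_iteratedFDeriv_cexp_le (m : ℕ) (z : ℂ) :
    ‖iteratedFDeriv ℝ m Complex.exp z‖ ≤ Real.exp z.re := by
  induction m with
  | zero => simp [Complex.norm_exp]
  | succ m ih =>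
    rw [← norm_iteratedFDeriv_fderiv]
    have h : fderiv ℝ Complex.exp = (ContinuousLinearMap.mul ℝ ℂ) ∘ Complex.exp := by
      funext w
      rw [((Complex.hasDerivAt_exp w).hasFDerivAt.restrictScalars ℝ).fderiv]
      ext v
      all_goals simp [mul_comm]
    rw [h]
    have hc : ContDiffAt ℝ m Complex.exp z := Complex.contDiff_exp.contDiffAt
    refine ((ContinuousLinearMap.mul ℝ ℂ).norm_iteratedFDeriv_comp_left hc le_rfl).trans ?_
    calc _ ≤ 1 * ‖iteratedFDeriv ℝ m Complex.exp z‖ := by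
          gcongr
          exact ContinuousLinearMap.opNorm_mul_le ℝ ℂ
      _ ≤ _ := by simpa using ih

/-- All derivatives of `exp ∘ Q`, for `Q` of temperate growth, are bounded by a polynomial times
`exp (Re Q)`. -/
lemma norm_iteratedFDeriv_cexp_comp_le {E : Type*} [NormedAddCommGroup E] [NormedSpace ℝ E]
    {Q : E → ℂ} (hQ : Q.HasTemperateGrowth) (m : ℕ) :
    ∃ (N : ℕ) (C : ℝ), 0 ≤ C ∧ ∀ x, ‖iteratedFDeriv ℝ m (fun y => Complex.exp (Q y)) x‖ ≤
      C * (1 + ‖x‖) ^ N * Real.exp (Q x).re := by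
  obtain ⟨N, C, hC, h⟩ := hQ.norm_iteratedFDeriv_le_uniform m
  refine ⟨N * m, m.factorial * (1 + C) ^ m, by positivity, fun x => ?_⟩
  have hone : 1 ≤ (1 + C) * (1 + ‖x‖) ^ N := by
    have h1 : 1 ≤ (1 + ‖x‖) ^ N := one_le_pow₀ (by linarith [norm_nonneg x])
    nlinarith
  have key := norm_iteratedFDeriv_comp_le (𝕜 := ℝ) (g := Complex.exp) (f := Q) (n := m) (N := ∞)
    Complex.contDiff_exp hQ.1 (by exact_mod_cast le_top) x
    (C := Real.exp (Q x).re) (D := (1 + C) * (1 + ‖x‖) ^ N)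
    (fun i _ => norm_iteratedFDeriv_cexp_le i (Q x))
    (fun i hi him => by
      calc ‖iteratedFDeriv ℝ i Q x‖ ≤ C * (1 + ‖x‖) ^ N := h i him x
        _ ≤ (1 + C) * (1 + ‖x‖) ^ N := by gcongr; linarith
        _ ≤ ((1 + C) * (1 + ‖x‖) ^ N) ^ i := le_self_pow₀ hone (by omega))
  refine key.trans (le_of_eq ?_)
  rw [mul_pow, ← pow_mul]
  ring

lemma contDiff_cexp_quad (k : Fin n → ℕ) (z : Fin n → ℂ) :
    ContDiff ℝ ∞ (fun x : Space k => Complex.exp (quad k z x)) :=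
  Complex.contDiff_exp.comp (quad_hasTemperateGrowth k z).1

/-- For real `b`, the chirp `x ↦ e(∑ bᵢ |xᵢ|² / 2)`. -/
def chirp (k : Fin n → ℕ) (b : Fin n → ℝ) (x : Space k) : ℂ :=
  Complex.exp (quad k (fun i => (b i : ℂ)) x)

lemma chirp_hasTemperateGrowth (k : Fin n → ℕ) (b : Fin n → ℝ) :
    (chirp k b).HasTemperateGrowth := by
  refine ⟨contDiff_cexp_quad k _, fun m => ?_⟩
  obtain ⟨N, C, _, h⟩ := norm_iteratedFDeriv_cexp_comp_le
    (quad_hasTemperateGrowth k (fun i => (b i : ℂ))) m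
  refine ⟨N, C, fun x => (h x).trans (le_of_eq ?_)⟩
  rw [quad_re]
  simp

lemma exists_gaussian_bound {c : ℝ} (hc : 0 < c) (m : ℕ) :
    ∃ B : ℝ, ∀ r : ℝ, 0 ≤ r → (1 + r) ^ m * Real.exp (-(c * r ^ 2)) ≤ B := by
  have h1 : Filter.Tendsto (fun r : ℝ => (r + 1) ^ m * Real.exp (-(c * r ^ 2)))
      Filter.atTop (nhds 0) := by
    have h2 : Filter.Tendsto (fun r : ℝ => (r + 1) ^ m * Real.exp (-(r + 1)))
        Filter.atTop (nhds 0) :=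
      (Real.tendsto_pow_mul_exp_neg_atTop_nhds_zero m).comp
        (Filter.tendsto_atTop_add_const_right _ 1 Filter.tendsto_id)
    refine squeeze_zero' ?_ ?_ h2
    · filter_upwards [Filter.eventually_ge_atTop 0] with r hr
      positivity
    · filter_upwards [Filter.eventually_ge_atTop 1, Filter.eventually_ge_atTop (2 / c)]
        with r hr hr2
      gcongr
      rw [div_le_iff₀ hc] at hr2
      nlinarith
  obtain ⟨R, hR⟩ := Filter.eventually_atTop.mp
    (h1.eventually (gt_mem_nhds (show (0 : ℝ) < 1 by norm_num)))
  have hcont : Continuous (fun r : ℝ => (r + 1) ^ m * Real.exp (-(c * r ^ 2))) := by fun_prop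
  obtain ⟨B, hB⟩ := (isCompact_Icc (a := (0 : ℝ)) (b := R)).exists_bound_of_continuousOn
    hcont.continuousOn
  refine ⟨max B 1, fun r hr => ?_⟩
  rw [add_comm]
  by_cases h : r ≤ R
  · exact (le_abs_self _).trans ((hB r ⟨hr, h⟩).trans (le_max_left _ _))
  · exact (hR r (le_of_lt (not_le.mp h))).le.trans (le_max_right _ _)

/-- The Gaussian `g(x, τ) = ∏ᵢ e(|xᵢ|² τᵢ / 2)`, as a Schwartz function. -/
def gaussian (k : Fin n → ℕ) (τ : Fin n → ℍ) : 𝓢(Space k, ℂ) where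
  toFun x := Complex.exp (quad k (fun i => (τ i : ℂ)) x)
  smooth' := contDiff_cexp_quad k _
  decay' := by
    intro p m
    obtain ⟨N, C, hC, h⟩ := norm_iteratedFDeriv_cexp_comp_le
      (quad_hasTemperateGrowth k (fun i => (τ i : ℂ))) m
    obtain ⟨v, hv, hvi⟩ : ∃ v : ℝ, 0 < v ∧ ∀ i, v ≤ (τ i).im := by
      rcases isEmpty_or_nonempty (Fin n) with he | he
      · exact ⟨1, one_pos, fun i => he.elim i⟩
      · obtain ⟨j, hj⟩ := Finite.exists_min (fun i => (τ i).im)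
        exact ⟨(τ j).im, (τ j).im_pos, hj⟩
    obtain ⟨B, hB⟩ := exists_gaussian_bound (c := Real.pi * v) (by positivity) (N + p)
    refine ⟨C * B, fun x => ?_⟩
    have hre : (quad k (fun i => (τ i : ℂ)) x).re ≤ -(Real.pi * v * ‖x‖ ^ 2) := by
      rw [quad_re, neg_le_neg_iff, PiLp.norm_sq_eq_of_L2, mul_assoc, Finset.mul_sum]
      gcongr with i
      exact hvi i
    calc ‖x‖ ^ p * ‖iteratedFDeriv ℝ m (fun x => Complex.exp (quad k (fun i => (τ i : ℂ)) x)) x‖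
        ≤ (1 + ‖x‖) ^ p * (C * (1 + ‖x‖) ^ N * Real.exp (-(Real.pi * v * ‖x‖ ^ 2))) := by
          gcongr
          · linarith
          · exact (h x).trans (by gcongr)
      _ = C * ((1 + ‖x‖) ^ (N + p) * Real.exp (-(Real.pi * v * ‖x‖ ^ 2))) := by ring
      _ ≤ C * B := by
          gcongr
          exact hB _ (norm_nonneg _)

/-! ### The Weil representation -/

/-- Multiplication of Schwartz functions by the chirp `x ↦ e(∑ bᵢ |xᵢ|² / 2)`. -/
def mulChirp (k : Fin n → ℕ) (b : Fin n → ℝ) : 𝓢(Space k, ℂ) →L[ℂ] 𝓢(Space k, ℂ) :=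
  SchwartzMap.smulLeftCLM ℂ (chirp k b)

/-- The linear automorphism `(x₁, …, xₙ) ↦ (x₁ / s₁, …, xₙ / sₙ)`. -/
def scaleEquiv (k : Fin n → ℕ) (s : Fin n → ℝˣ) : Space k ≃L[ℝ] Space k :=
  ((PiLp.continuousLinearEquiv 2 ℝ (fun i => EuclideanSpace ℝ (Fin (k i)))).trans
    (ContinuousLinearEquiv.piCongrRight
      (fun i => ContinuousLinearEquiv.smulLeft (s i)⁻¹))).trans
    (PiLp.continuousLinearEquiv 2 ℝ (fun i => EuclideanSpace ℝ (Fin (k i)))).symm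

@[simp] lemma scaleEquiv_apply (k : Fin n → ℕ) (s : Fin n → ℝˣ) (x : Space k) (i : Fin n) :
    scaleEquiv k s x i = ((s i : ℝ))⁻¹ • x i := by
  have h : scaleEquiv k s x i = (s i)⁻¹ • x i := rfl
  rw [h, Units.smul_def, Units.val_inv_eq_inv_val]

/-- The dilation `φ ↦ φ(x₁ / s₁, …, xₙ / sₙ)` of Schwartz functions. -/
def dilate (k : Fin n → ℕ) (s : Fin n → ℝˣ) : 𝓢(Space k, ℂ) →L[ℂ] 𝓢(Space k, ℂ) :=
  SchwartzMap.compCLMOfContinuousLinearEquiv ℂ (scaleEquiv k s)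

namespace Mp2

/-- If `c = 0` this is `a`, otherwise it is `1`. -/
def dil (M : Mp2) : ℝˣ :=
  if h : M.mat 1 0 = 0 then
    Units.mk0 (M.mat 0 0) (by
      intro h0
      have := M.mat.det_coe
      rw [Matrix.det_fin_two, h, h0] at this
      simp at this)
  else 1

/-- If `c = 0` this is `ab`, otherwise it is `(a - 1) / c`. -/
def left (M : Mp2) : ℝ :=
  if M.mat 1 0 = 0 then M.mat 0 0 * M.mat 0 1 else (M.mat 0 0 - 1) / M.mat 1 0

/-- If `c = 0` this is `0`, otherwise it is `(d - 1) / c`. -/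
def right (M : Mp2) : ℝ :=
  if M.mat 1 0 = 0 then 0 else (M.mat 1 1 - 1) / M.mat 1 0

/-- If `c = 0` this is the constant value of `φ`; otherwise it is the sign `φ(τ) / √(cτ + d)`
(with the principal branch), which does not depend on `τ`. -/
def sgn (M : Mp2) : ℂ :=
  if M.mat 1 0 = 0 then M.phi UpperHalfPlane.I
  else M.phi UpperHalfPlane.I /
    (((M.mat 1 0 : ℝ) : ℂ) * Complex.I + ((M.mat 1 1 : ℝ) : ℂ)) ^ (1 / 2 : ℂ)

/-- Every `M ∈ SL₂(ℝ)` factors as `M = t(u) S t(-c) S⁻¹ t(w) diag(s, s⁻¹)` with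
`u = left`, `w = right`, `s = dil`. -/
lemma mat_eq (M : Mp2) :
    (M.mat : Matrix (Fin 2) (Fin 2) ℝ) =
      ((t M.left * S * t (-(M.mat 1 0)) * S⁻¹ * t M.right).mat : Matrix (Fin 2) (Fin 2) ℝ) *
        !![(M.dil : ℝ), 0; 0, (M.dil : ℝ)⁻¹] := by
  have hdet := M.mat.det_coe
  rw [Matrix.det_fin_two] at hdet
  have hS : ((S⁻¹).mat : Matrix (Fin 2) (Fin 2) ℝ) = !![0, 1; -1, 0] := by
    rw [inv_mat, Matrix.SpecialLinearGroup.coe_inv]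
    simp [S, Matrix.adjugate_fin_two]
  rw [Matrix.eta_fin_two (M.mat : Matrix (Fin 2) (Fin 2) ℝ)]
  simp only [mul_mat, Matrix.SpecialLinearGroup.coe_mul, hS]
  by_cases h : M.mat 1 0 = 0
  · have ha : M.mat 0 0 ≠ 0 := by
      intro h0
      rw [h, h0] at hdet
      simp at hdet
    rw [h, mul_zero, sub_zero] at hdet
    have hd : M.mat 1 1 = (M.mat 0 0)⁻¹ := eq_inv_of_mul_eq_one_right hdet
    simp [left, right, dil, h, t, S, hd]
    field_simp
  · simp [left, right, dil, h, t, S]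
    refine ⟨?_, ?_⟩ <;> field_simp <;> linarith

end Mp2

/-- The operator `ω(M)` on `𝓢(ℝ^{k₁} × ⋯ × ℝ^{kₙ})` for `M ∈ Mp₂(ℝ)ⁿ`, in the Schrödinger model
of the Weil representation, with the normalization
`ω(t(b)) φ (x) = e(-∑ bᵢ |xᵢ|² / 2) φ(x)`, `ω(rot(a)) φ (x) = ∏ √aᵢ^{-kᵢ} φ(x₁ / a₁, …)`,
`ω(S) φ (x) = ∏ √i^{kᵢ} φ̂(-x)`; for these formulas `ω(M N) = ω(N) ω(M)`.
Componentwise `M = t(u) (S t(-c) S⁻¹) t(w) (diag(s, s⁻¹), σ)` with `σ` constant, and `ω` is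
evaluated along this factorization; note `ω(S t(-c) S⁻¹) = ω(S)⁻¹ ω(t(-c)) ω(S)`, in which the
constants `√i` cancel and which is the identity in the components with `c = 0`. -/
def weilOp (k : Fin n → ℕ) (M : Fin n → Mp2) : 𝓢(Space k, ℂ) →L[ℂ] 𝓢(Space k, ℂ) :=
  (∏ i, (M i).sgn ^ k i) •
    (dilate k (fun i => (M i).dil)).comp
      ((mulChirp k (fun i => -(M i).right)).comp
        ((FourierTransform.fourierCLM ℂ 𝓢(Space k, ℂ)).comp
          ((mulChirp k (fun i => (M i).mat 1 0)).comp
            ((FourierTransform.fourierInvCLM ℂ 𝓢(Space k, ℂ)).comp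
              (mulChirp k (fun i => -(M i).left))))))

/-- The action of `Mp₂(ℝ)ⁿ` on tempered distributions: `⟨μ | M, φ⟩ = ⟨μ, ω(M⁻¹) φ⟩`. -/
def slashDist (k : Fin n → ℕ) (μ : 𝓢'(Space k, ℂ)) (M : Fin n → Mp2) : 𝓢'(Space k, ℂ) :=
  PointwiseConvergenceCLM.precomp ℂ (weilOp k M⁻¹) μ

@[simp] lemma slashDist_apply (k : Fin n → ℕ) (μ : 𝓢'(Space k, ℂ)) (M : Fin n → Mp2)
    (φ : 𝓢(Space k, ℂ)) : slashDist k μ M φ = μ (weilOp k M⁻¹ φ) := rfl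

/-- The slash operator of weight `k / 2`: `(f | M)(τ) = ∏ φᵢ(τᵢ)^{-kᵢ} f(M₁ τ₁, …, Mₙ τₙ)`. -/
def slashFun (k : Fin n → ℕ) (f : (Fin n → ℍ) → ℂ) (M : Fin n → Mp2) : (Fin n → ℍ) → ℂ :=
  fun τ => (∏ i, (M i).phi (τ i) ^ k i)⁻¹ * f (fun i => (M i).mat • τ i)

/-- The theta function `θ_μ(τ) = ⟨μ, g(·, τ)⟩` of a tempered distribution. -/
def theta (k : Fin n → ℕ) (μ : 𝓢'(Space k, ℂ)) : (Fin n → ℍ) → ℂ :=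
  fun τ => μ (gaussian k τ)

/-! ### Spherical measures and Fourier series -/

/-- The surface measure `δ_{S_l^k}` of the sphere of radius `√l` in `ℝ^k`; for `l = 0` it is the
Dirac measure at the origin. -/
def sphereMeasure (k : ℕ) (l : ℝ≥0) : Measure (EuclideanSpace ℝ (Fin k)) :=
  if l = 0 then Measure.dirac 0
  else ENNReal.ofReal (Real.sqrt l ^ (k - 1)) •
    Measure.map (fun y : Metric.sphere (0 : EuclideanSpace ℝ (Fin k)) 1 => Real.sqrt l • y.1)
      (volume : Measure (EuclideanSpace ℝ (Fin k))).toSphere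

/-- The surface measure of the product of spheres `S_{l₁}^{k₁} × ⋯ × S_{lₙ}^{kₙ}`. -/
def polysphereMeasure (k : Fin n → ℕ) (l : Fin n → ℝ≥0) : Measure (Space k) :=
  (Measure.pi (fun i => sphereMeasure (k i) (l i))).map (WithLp.toLp 2)

/-- The volume of the product of spheres `S_{l₁}^{k₁} × ⋯ × S_{lₙ}^{kₙ}`. -/
def polysphereVol (k : Fin n → ℕ) (l : Fin n → ℝ≥0) : ℝ :=
  (polysphereMeasure k l).real Set.univ

/-- A sequence in `ℝ_{≥0}ⁿ` without finite accumulation points: every bounded set contains only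
finitely many of its terms. -/
def IsLocallyFiniteSeq (l : ℕ → Fin n → ℝ≥0) : Prop :=
  ∀ R : ℝ≥0, {m | ∑ i, l m i ≤ R}.Finite

/-- The weights `a m`, placed at the points `l m`, have at most polynomial growth: the total mass
of the weights in the region `|l| ≤ R` is at most `C (1 + R)^N`. -/
def PolyGrowth (l : ℕ → Fin n → ℝ≥0) (a : ℕ → ℂ) : Prop :=
  ∃ (C : ℝ) (N : ℕ), ∀ (R : ℝ≥0) (s : Finset ℕ), (∀ m ∈ s, ∑ i, l m i ≤ R) →
    ∑ m ∈ s, ‖a m‖ ≤ C * (1 + (R : ℝ)) ^ N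

/-- `μ = ∑ₘ cₘ δ_{S_{l m}}`, with `l` locally finite and at most polynomially growing masses
`|cₘ| vol(S_{l m})`. -/
structure IsSphereExpansion (k : Fin n → ℕ) (l : ℕ → Fin n → ℝ≥0) (c : ℕ → ℂ)
    (μ : 𝓢'(Space k, ℂ)) : Prop where
  locallyFinite : IsLocallyFiniteSeq l
  growth : PolyGrowth l (fun m => c m * (polysphereVol k (l m) : ℂ))
  hasSum : ∀ φ : 𝓢(Space k, ℂ),
    HasSum (fun m => c m * ∫ x, φ x ∂(polysphereMeasure k (l m))) (μ φ)

/-- `e(l τ / 2) = exp(πi ∑ lᵢ τᵢ)`. -/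
def expo (l : Fin n → ℝ≥0) (τ : Fin n → ℍ) : ℂ :=
  Complex.exp (Real.pi * Complex.I * ∑ i, ((l i : ℝ) : ℂ) * (τ i : ℂ))

/-- `f(τ) = ∑ₘ cₘ e(l m τ / 2)`, with `l` locally finite and at most polynomially growing `c`. -/
structure IsFourierExpansion (l : ℕ → Fin n → ℝ≥0) (c : ℕ → ℂ) (f : (Fin n → ℍ) → ℂ) : Prop where
  locallyFinite : IsLocallyFiniteSeq l
  growth : PolyGrowth l c
  hasSum : ∀ τ, HasSum (fun m => c m * expo (l m) τ) (f τ)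

/-- `f` is holomorphic on `ℍⁿ`. -/
def IsHolo (f : (Fin n → ℍ) → ℂ) : Prop :=
  DifferentiableOn ℂ (fun z : Fin n → ℂ => f (fun i => UpperHalfPlane.ofComplex (z i)))
    {z | ∀ i, 0 < (z i).im}

/-- `-1 / τ = (-1 / τ₁, …, -1 / τₙ)`. -/
def negInv (τ : Fin n → ℍ) : Fin n → ℍ :=
  fun i => UpperHalfPlane.mk (-(τ i : ℂ))⁻¹ (τ i).im_inv_neg_coe_pos

/-- `√(-iτ)^k = ∏ √(-iτᵢ)^{kᵢ}` with the principal branch of the square root. -/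
def autFactor (k : Fin n → ℕ) (τ : Fin n → ℍ) : ℂ :=
  ∏ i, ((-Complex.I * (τ i : ℂ)) ^ (1 / 2 : ℂ)) ^ k i

/-- `f̃(τ) = √(-iτ)^{-k} f(-1 / τ)`. -/
def dualFun (k : Fin n → ℕ) (f : (Fin n → ℍ) → ℂ) : (Fin n → ℍ) → ℂ :=
  fun τ => (autFactor k τ)⁻¹ * f (negInv τ)

/-! Sums of two expansions are expansions along the interleaved sequence. -/

/-- The interleaving of two sequences. -/
def interleave {α : Type*} (a b : ℕ → α) : ℕ → α :=
  fun m => Sum.elim a b (Equiv.natSumNatEquivNat.symm m)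

lemma isLocallyFiniteSeq_nat [NeZero n] :
    IsLocallyFiniteSeq (fun (m : ℕ) (_ : Fin n) => (m : ℝ≥0)) := by
  intro R
  refine (Set.finite_Iic ⌈R⌉₊).subset ?_
  intro m hm
  simp only [Set.mem_ofPred_eq, Finset.sum_const, Finset.card_univ, Fintype.card_fin,
    nsmul_eq_mul] at hm
  have h1 : (1 : ℝ≥0) ≤ (n : ℝ≥0) := by
    exact_mod_cast Nat.one_le_iff_ne_zero.mpr (NeZero.ne n)
  have h2 : (m : ℝ≥0) ≤ R := le_trans (le_mul_of_one_le_left zero_le h1) hm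
  exact_mod_cast h2.trans (Nat.le_ceil R)

lemma IsLocallyFiniteSeq.interleave {l l' : ℕ → Fin n → ℝ≥0} (h : IsLocallyFiniteSeq l)
    (h' : IsLocallyFiniteSeq l') : IsLocallyFiniteSeq (interleave l l') := by
  intro R
  refine (((h R).image Sum.inl).union ((h' R).image Sum.inr)).preimage
    (f := Equiv.natSumNatEquivNat.symm) (Equiv.injective _).injOn |>.subset ?_
  intro m hm
  simp only [Set.mem_ofPred_eq, SphericalMeasures.interleave] at hm
  simp only [Set.mem_preimage]
  rcases hx : Equiv.natSumNatEquivNat.symm m with j | j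
  · left
    rw [hx] at hm
    exact ⟨j, by simpa using hm, rfl⟩
  · right
    rw [hx] at hm
    exact ⟨j, by simpa using hm, rfl⟩

lemma PolyGrowth.interleave {l l' : ℕ → Fin n → ℝ≥0} {a a' : ℕ → ℂ} (h : PolyGrowth l a)
    (h' : PolyGrowth l' a') :
    PolyGrowth (interleave l l') (interleave a a') := by
  obtain ⟨C, N, hC⟩ := h
  obtain ⟨C', N', hC'⟩ := h'
  have hC0 : 0 ≤ C := by simpa using hC 0 ∅ (by simp)
  have hC0' : 0 ≤ C' := by simpa using hC' 0 ∅ (by simp)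
  refine ⟨C + C', max N N', fun R s hs => ?_⟩
  have e : ∑ m ∈ s, ‖SphericalMeasures.interleave a a' m‖ =
      ∑ x ∈ s.map Equiv.natSumNatEquivNat.symm.toEmbedding, ‖Sum.elim a a' x‖ := by
    rw [Finset.sum_map]; rfl
  set u := s.map Equiv.natSumNatEquivNat.symm.toEmbedding with hu
  have hmem : ∀ x ∈ u, ∑ i, Sum.elim l l' x i ≤ R := by
    intro x hx
    rw [hu, Finset.mem_map] at hx
    obtain ⟨m, hm, rfl⟩ := hx
    exact hs m hm
  have h1R : (1 : ℝ) ≤ 1 + (R : ℝ) := by linarith [R.coe_nonneg]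
  rw [e, ← u.toLeft_disjSum_toRight, Finset.sum_disjSum]
  have hl := hC R u.toLeft (fun m hm => hmem _ (Finset.mem_toLeft.mp hm))
  have hr := hC' R u.toRight (fun m hm => hmem _ (Finset.mem_toRight.mp hm))
  calc _ ≤ C * (1 + (R : ℝ)) ^ N + C' * (1 + (R : ℝ)) ^ N' := add_le_add hl hr
    _ ≤ C * (1 + (R : ℝ)) ^ (max N N') + C' * (1 + (R : ℝ)) ^ (max N N') := by
        gcongr
        · exact le_max_left _ _
        · exact le_max_right _ _
    _ = _ := by ring

lemma PolyGrowth.const_mul {l : ℕ → Fin n → ℝ≥0} {a : ℕ → ℂ} (h : PolyGrowth l a) (b : ℂ) :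
    PolyGrowth l (fun m => b * a m) := by
  obtain ⟨C, N, hC⟩ := h
  refine ⟨‖b‖ * C, N, fun R s hs => ?_⟩
  simp only [norm_mul, ← Finset.mul_sum]
  rw [mul_assoc]
  exact mul_le_mul_of_nonneg_left (hC R s hs) (norm_nonneg b)

lemma hasSum_interleave {α : Type*} {x x' : ℕ → α} {F : α → ℂ} {A A' : ℂ}
    (h : HasSum (fun m => F (x m)) A) (h' : HasSum (fun m => F (x' m)) A') :
    HasSum (fun m => F (interleave x x' m)) (A + A') := by
  let G : ℕ ⊕ ℕ → ℂ := fun y => F (Sum.elim x x' y)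
  have key : HasSum G (A + A') := HasSum.sum (f := G) h h'
  have e := (Equiv.hasSum_iff (f := G) (a := A + A') Equiv.natSumNatEquivNat.symm).mpr key
  exact e

/-- The space `Meas_k` of `k`-spherical measures. -/
def Meas [NeZero n] (k : Fin n → ℕ) : Submodule ℂ 𝓢'(Space k, ℂ) where
  carrier := {μ | (∃ l c, IsSphereExpansion k l c μ) ∧ ∃ l c, IsSphereExpansion k l c (𝓕 μ)}
  add_mem' := by
    have main : ∀ μ ν : 𝓢'(Space k, ℂ), (∃ l c, IsSphereExpansion k l c μ) →
        (∃ l c, IsSphereExpansion k l c ν) → ∃ l c, IsSphereExpansion k l c (μ + ν) := by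
      rintro μ ν ⟨l, c, h⟩ ⟨l', c', h'⟩
      refine ⟨interleave l l', interleave c c', h.locallyFinite.interleave h'.locallyFinite, ?_,
        fun φ => ?_⟩
      · refine (congrArg (PolyGrowth (interleave l l')) ?_).mpr (h.growth.interleave h'.growth)
        funext m
        unfold interleave
        rcases Equiv.natSumNatEquivNat.symm m with j | j <;> rfl
      · refine (congrArg (fun f => HasSum f ((μ + ν) φ)) ?_).mpr
          (hasSum_interleave (F := id) (h.hasSum φ) (h'.hasSum φ))
        funext m
        unfold interleave
        rcases Equiv.natSumNatEquivNat.symm m with j | j <;> rfl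
    rintro μ ν ⟨h1, h2⟩ ⟨h3, h4⟩
    refine ⟨main μ ν h1 h3, ?_⟩
    rw [FourierTransform.fourier_add]
    exact main _ _ h2 h4
  zero_mem' := by
    have main : ∃ l c, IsSphereExpansion k l c (0 : 𝓢'(Space k, ℂ)) :=
      ⟨_, fun _ => 0, isLocallyFiniteSeq_nat, ⟨0, 0, fun R s _ => by simp⟩,
        fun φ => by simp⟩
    exact ⟨main, by rwa [FourierTransform.fourier_zero]⟩
  smul_mem' := by
    have main : ∀ (a : ℂ) (μ : 𝓢'(Space k, ℂ)), (∃ l c, IsSphereExpansion k l c μ) →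
        ∃ l c, IsSphereExpansion k l c (a • μ) := by
      rintro a μ ⟨l, c, h⟩
      refine ⟨l, fun m => a * c m, h.locallyFinite, ?_, fun φ => ?_⟩
      · simpa only [mul_assoc] using h.growth.const_mul a
      · have e := (h.hasSum φ).mul_left a
        simp only [← mul_assoc] at e
        exact e
    rintro a μ ⟨h1, h2⟩
    refine ⟨main a μ h1, ?_⟩
    rw [FourierTransform.fourier_smul]
    exact main a _ h2

/-- The space `FS_k` of Fourier series. -/
def FS [NeZero n] (k : Fin n → ℕ) : Submodule ℂ ((Fin n → ℍ) → ℂ) where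
  carrier := {f | IsHolo f ∧ (∃ l c, IsFourierExpansion l c f) ∧
    ∃ l c, IsFourierExpansion l c (dualFun k f)}
  add_mem' := by
    have main : ∀ f g : (Fin n → ℍ) → ℂ, (∃ l c, IsFourierExpansion l c f) →
        (∃ l c, IsFourierExpansion l c g) → ∃ l c, IsFourierExpansion l c (f + g) := by
      rintro f g ⟨l, c, h⟩ ⟨l', c', h'⟩
      refine ⟨interleave l l', interleave c c', h.locallyFinite.interleave h'.locallyFinite,
        h.growth.interleave h'.growth, fun τ => ?_⟩
      refine (congrArg (fun u => HasSum u ((f + g) τ)) ?_).mpr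
        (hasSum_interleave (F := id) (h.hasSum τ) (h'.hasSum τ))
      funext m
      unfold interleave
      rcases Equiv.natSumNatEquivNat.symm m with j | j <;> rfl
    rintro f g ⟨h0, h1, h2⟩ ⟨h0', h1', h2'⟩
    refine ⟨DifferentiableOn.add h0 h0', main f g h1 h1', ?_⟩
    have e : dualFun k (f + g) = dualFun k f + dualFun k g := by
      funext τ
      simp [dualFun, mul_add]
    rw [e]
    exact main _ _ h2 h2'
  zero_mem' := by
    have main : ∃ l c, IsFourierExpansion l c (0 : (Fin n → ℍ) → ℂ) :=
      ⟨_, fun _ => 0, isLocallyFiniteSeq_nat, ⟨0, 0, fun R s _ => by simp⟩,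
        fun φ => by simp⟩
    have e : dualFun k (0 : (Fin n → ℍ) → ℂ) = 0 := by
      funext τ
      simp [dualFun]
    exact ⟨differentiableOn_const 0, main, by rwa [e]⟩
  smul_mem' := by
    have main : ∀ (a : ℂ) (f : (Fin n → ℍ) → ℂ), (∃ l c, IsFourierExpansion l c f) →
        ∃ l c, IsFourierExpansion l c (a • f) := by
      rintro a f ⟨l, c, h⟩
      refine ⟨l, fun m => a * c m, h.locallyFinite, h.growth.const_mul a, fun τ => ?_⟩
      have e := (h.hasSum τ).mul_left a
      simp only [← mul_assoc] at e
      exact e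
    rintro a f ⟨h0, h1, h2⟩
    refine ⟨DifferentiableOn.const_smul h0 a, main a f h1, ?_⟩
    have e : dualFun k (a • f) = a • dualFun k f := by
      funext τ
      simp [dualFun, mul_left_comm]
    rw [e]
    exact main a _ h2

end SphericalMeasures

end

noncomputable section

namespace SphericalMeasures

variable {n : ℕ}

/-! ### Gaussians with a linear term -/

/-! Both halves of the theorem, the Weil representation and the correspondence between measures and
Fourier series, rest on explicit formulas for Gaussians.

Since `weilOp` is defined along one chosen factorization of each `M`, its product rule is not
apparent; it comes from rigidity. An operator implements `M` (`Implements`) if it is unitary up to a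
scalar and sends Gaussians with a linear term at the transformed parameters to a Jacobi-type
automorphy factor times the original Gaussian. Implementing operators compose, and they are unique
(`Implements.unique`): two of them agree on Gaussians, so by unitarity their difference at any φ is
orthogonal to all Gaussians with a linear term, and Fourier inversion makes it zero. The linear
terms matter, since pure Gaussians see only the norms of the blocks. It remains to check the
generators and one sign; setting the linear term to zero and pairing with μ gives equivariance.

For the correspondence, a Gaussian takes the constant value e(λτ/2) on S_λ, so θ turns a sum of
normalized sphere measures into the Fourier series with the same coefficients, and θ of the Fourier
transform of μ is the dual function of θ_μ (`theta_fourier`). Polynomially growing coefficients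
always define a tempered distribution (`exists_sphereDist`). All else reduces to
`fourier_eq_of_dualFun_theta_eq`: a sphere expansion μ' with the same theta function as 𝓕 μ equals 𝓕
μ. Injectivity is the case μ' = 0, surjectivity uses the measures built from f and its dual, and the
self-duality criterion is the case μ' = μ.

The difficulty there is that 𝓕 μ is not yet known to be a sum of sphere measures. The distribution T
= 𝓕 μ - μ' kills all pure Gaussians. Let H(v) be its value at exp(-π|x|² + 2πi⟨x,v⟩). This function
is continuous, grows polynomially, and depends only on the norms |vᵢ|, because blockwise isometries
preserve both sums. Its integrals against Gaussians in v are values of T on Gaussians, hence zero.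
An integrable block-radial function whose integrals against all quadratic chirps vanish is zero, by
uniqueness of characteristic functions after pushing forward along v ↦ (|vᵢ|²). So H = 0, T vanishes
on every product with a fixed Gaussian, and T = 0. -/

/-- The linear form `x ↦ 2πi ∑ vᵢⱼ xᵢⱼ`. -/
def linForm (k : Fin n → ℕ) (v : ∀ i, Fin (k i) → ℂ) (x : Space k) : ℂ :=
  2 * Real.pi * Complex.I * ∑ i, ∑ j, v i j * ((x i j : ℝ) : ℂ)

/-- The bilinear square `∑ⱼ vⱼ²`. -/
def sqSum {m : ℕ} (v : Fin m → ℂ) : ℂ := ∑ j, v j ^ 2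

lemma coord_hasTemperateGrowth (k : Fin n → ℕ) (i : Fin n) (j : Fin (k i)) :
    (fun x : Space k => ((x i j : ℝ) : ℂ)).HasTemperateGrowth := by
  have h1 : (fun x : Space k => x i).HasTemperateGrowth :=
    (PiLp.proj (𝕜 := ℝ) 2 (fun i => EuclideanSpace ℝ (Fin (k i))) i).hasTemperateGrowth
  have h2 : (fun x : EuclideanSpace ℝ (Fin (k i)) => x j).HasTemperateGrowth :=
    (PiLp.proj (𝕜 := ℝ) 2 (fun _ : Fin (k i) => ℝ) j).hasTemperateGrowth
  exact Function.HasTemperateGrowth.comp Function.Complex.hasTemperateGrowth_ofReal (h2.comp h1)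

lemma linForm_hasTemperateGrowth (k : Fin n → ℕ) (v : ∀ i, Fin (k i) → ℂ) :
    (linForm k v).HasTemperateGrowth := by
  have h : (fun x : Space k => ∑ i, ∑ j, v i j * ((x i j : ℝ) : ℂ)).HasTemperateGrowth :=
    Function.HasTemperateGrowth.sum fun i _ => Function.HasTemperateGrowth.sum fun j _ =>
      (Function.HasTemperateGrowth.const (v i j)).mul (coord_hasTemperateGrowth k i j)
  exact (Function.HasTemperateGrowth.const (2 * (Real.pi : ℂ) * Complex.I)).mul h

lemma abs_coord_le (k : Fin n → ℕ) (x : Space k) (i : Fin n) (j : Fin (k i)) :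
    |x i j| ≤ ‖x‖ :=
  (PiLp.norm_apply_le (x i) j).trans (PiLp.norm_apply_le x i)

lemma norm_linForm_le (k : Fin n → ℕ) (v : ∀ i, Fin (k i) → ℂ) (x : Space k) :
    ‖linForm k v x‖ ≤ (2 * Real.pi * ∑ i, ∑ j, ‖v i j‖) * ‖x‖ := by
  unfold linForm
  rw [norm_mul]
  have h1 : ‖(2 * Real.pi * Complex.I : ℂ)‖ = 2 * Real.pi := by
    simp [abs_of_pos Real.pi_pos]
  rw [h1, mul_assoc, mul_assoc, mul_assoc]
  refine mul_le_mul_of_nonneg_left (mul_le_mul_of_nonneg_left ?_ Real.pi_pos.le) zero_le_two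
  rw [Finset.sum_mul]
  refine (norm_sum_le _ _).trans (Finset.sum_le_sum fun i _ => ?_)
  rw [Finset.sum_mul]
  refine (norm_sum_le _ _).trans (Finset.sum_le_sum fun j _ => ?_)
  rw [norm_mul, Complex.norm_real]
  exact mul_le_mul_of_nonneg_left (abs_coord_le k x i j) (norm_nonneg _)

lemma exists_im_lower_bound (τ : Fin n → ℍ) : ∃ v : ℝ, 0 < v ∧ ∀ i, v ≤ (τ i).im := by
  rcases isEmpty_or_nonempty (Fin n) with he | he
  · exact ⟨1, one_pos, fun i => he.elim i⟩
  · obtain ⟨j, hj⟩ := Finite.exists_min (fun i => (τ i).im)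
    exact ⟨(τ j).im, (τ j).im_pos, hj⟩

lemma quad_re_le (k : Fin n → ℕ) (τ : Fin n → ℍ) {v : ℝ} (hvi : ∀ i, v ≤ (τ i).im)
    (x : Space k) : (quad k (fun i => (τ i : ℂ)) x).re ≤ -(Real.pi * v * ‖x‖ ^ 2) := by
  rw [quad_re, neg_le_neg_iff, PiLp.norm_sq_eq_of_L2, mul_assoc, Finset.mul_sum]
  gcongr with i
  exact hvi i

/-- The function `x ↦ exp (πi ∑ τᵢ |xᵢ|² + 2πi ∑ vᵢⱼ xᵢⱼ)`, as a Schwartz function. -/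
def gaussLin (k : Fin n → ℕ) (τ : Fin n → ℍ) (v : ∀ i, Fin (k i) → ℂ) : 𝓢(Space k, ℂ) where
  toFun x := Complex.exp (quad k (fun i => (τ i : ℂ)) x + linForm k v x)
  smooth' := Complex.contDiff_exp.comp
    ((quad_hasTemperateGrowth k _).add (linForm_hasTemperateGrowth k v)).1
  decay' := by
    intro p m
    obtain ⟨N, C, hC, h⟩ := norm_iteratedFDeriv_cexp_comp_le
      ((quad_hasTemperateGrowth k (fun i => (τ i : ℂ))).add (linForm_hasTemperateGrowth k v)) m
    obtain ⟨w, hw, hwi⟩ := exists_im_lower_bound τ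
    -- Half of the decay rate is kept; completing the square lets the other half absorb the linear
    -- term, at the cost of the factor exp(L² / (2πw)).
    obtain ⟨B, hB⟩ := exists_gaussian_bound (c := Real.pi * w / 2) (by positivity) (N + p)
    set L := 2 * Real.pi * ∑ i, ∑ j, ‖v i j‖ with hL
    refine ⟨C * B * Real.exp (L ^ 2 / (2 * (Real.pi * w))), fun x => ?_⟩
    have hpw : 0 < Real.pi * w := by positivity
    have hre : (quad k (fun i => (τ i : ℂ)) x + linForm k v x).re ≤
        -(Real.pi * w / 2 * ‖x‖ ^ 2) + L ^ 2 / (2 * (Real.pi * w)) := by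
      have h1 := quad_re_le k τ hwi x
      have h2 := (Complex.re_le_norm _).trans (norm_linForm_le k v x)
      have h3 : L * ‖x‖ ≤ Real.pi * w / 2 * ‖x‖ ^ 2 + L ^ 2 / (2 * (Real.pi * w)) := by
        have h4 : Real.pi * w / 2 * ‖x‖ ^ 2 + L ^ 2 / (2 * (Real.pi * w)) - L * ‖x‖ =
            (Real.pi * w * ‖x‖ - L) ^ 2 / (2 * (Real.pi * w)) := by
          field_simp
          ring
        have h5 : 0 ≤ (Real.pi * w * ‖x‖ - L) ^ 2 / (2 * (Real.pi * w)) := by positivity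
        linarith
      rw [Complex.add_re]
      linarith
    calc ‖x‖ ^ p * ‖iteratedFDeriv ℝ m
          (fun x => Complex.exp (quad k (fun i => (τ i : ℂ)) x + linForm k v x)) x‖
        ≤ (1 + ‖x‖) ^ p * (C * (1 + ‖x‖) ^ N *
            (Real.exp (-(Real.pi * w / 2 * ‖x‖ ^ 2)) *
              Real.exp (L ^ 2 / (2 * (Real.pi * w))))) := by
          gcongr
          · linarith
          · refine (h x).trans ?_
            rw [← Real.exp_add]
            gcongr
            exact hre
      _ = C * ((1 + ‖x‖) ^ (N + p) * Real.exp (-(Real.pi * w / 2 * ‖x‖ ^ 2))) *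
            Real.exp (L ^ 2 / (2 * (Real.pi * w))) := by ring
      _ ≤ C * B * Real.exp (L ^ 2 / (2 * (Real.pi * w))) := by
          gcongr
          exact hB _ (norm_nonneg _)

lemma gaussLin_apply (k : Fin n → ℕ) (τ : Fin n → ℍ) (v : ∀ i, Fin (k i) → ℂ) (x : Space k) :
    gaussLin k τ v x = Complex.exp (quad k (fun i => (τ i : ℂ)) x + linForm k v x) := rfl

lemma gaussian_apply (k : Fin n → ℕ) (τ : Fin n → ℍ) (x : Space k) :
    gaussian k τ x = Complex.exp (quad k (fun i => (τ i : ℂ)) x) := rfl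

lemma gaussLin_zero (k : Fin n → ℕ) (τ : Fin n → ℍ) : gaussLin k τ 0 = gaussian k τ := by
  ext x
  simp [gaussLin_apply, gaussian_apply, linForm]

/-! ### Gaussian integrals -/

/-- The coordinates of `ℝ^{k₁} × ⋯ × ℝ^{kₙ}`. -/
def coordBasis (k : Fin n → ℕ) : OrthonormalBasis ((i : Fin n) × Fin (k i)) ℝ (Space k) :=
  Pi.orthonormalBasis (fun i => EuclideanSpace.basisFun (Fin (k i)) ℝ)

lemma integral_space_eq (k : Fin n → ℕ) (F : ((i : Fin n) × Fin (k i) → ℝ) → ℂ) :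
    ∫ x : Space k, F (fun j => x j.1 j.2) = ∫ y, F y := by
  have h1 := (coordBasis k).measurePreserving_repr.integral_comp
    (coordBasis k).repr.toHomeomorph.measurableEmbedding (fun y => F (fun j => y j))
  have h2 := (PiLp.volume_preserving_ofLp ((i : Fin n) × Fin (k i))).integral_comp
    (MeasurableEquiv.toLp 2 _).symm.measurableEmbedding F
  exact h1.trans h2

lemma quad_eq_sum (k : Fin n → ℕ) (z : Fin n → ℂ) (x : Space k) :
    quad k z x = ∑ j : (i : Fin n) × Fin (k i),
      Real.pi * Complex.I * z j.1 * ((x j.1 j.2 : ℝ) : ℂ) ^ 2 := by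
  rw [Fintype.sum_sigma, quad, Finset.mul_sum]
  refine Finset.sum_congr rfl fun i _ => ?_
  rw [EuclideanSpace.real_norm_sq_eq]
  push_cast
  simp_rw [Finset.mul_sum]
  refine Finset.sum_congr rfl fun j _ => ?_
  ring

lemma linForm_eq_sum (k : Fin n → ℕ) (v : ∀ i, Fin (k i) → ℂ) (x : Space k) :
    linForm k v x = ∑ j : (i : Fin n) × Fin (k i),
      2 * Real.pi * Complex.I * v j.1 j.2 * ((x j.1 j.2 : ℝ) : ℂ) := by
  rw [Fintype.sum_sigma, linForm, Finset.mul_sum]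
  refine Finset.sum_congr rfl fun i _ => ?_
  simp_rw [Finset.mul_sum]
  refine Finset.sum_congr rfl fun j _ => ?_
  ring

lemma neg_I_mul_re (τ : ℍ) : (-Complex.I * (τ : ℂ)).re = τ.im := by simp

/-- The integral is a product of one-dimensional Gaussian integrals with parameters -iτᵢ in the
right half-plane. Roots are taken factor by factor, so the principal branch causes no ambiguity. -/
lemma integral_gaussLin (k : Fin n → ℕ) (τ : Fin n → ℍ) (v : ∀ i, Fin (k i) → ℂ) :
    ∫ x, gaussLin k τ v x =
      (autFactor k τ)⁻¹ * Complex.exp (-(Real.pi * Complex.I * ∑ i, sqSum (v i) / τ i)) := by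
  have h1 := integral_space_eq k (fun y => Complex.exp
    (-∑ j : (i : Fin n) × Fin (k i), (Real.pi * (-Complex.I * (τ j.1 : ℂ))) * (y j : ℂ) ^ 2 +
      ∑ j : (i : Fin n) × Fin (k i), (2 * Real.pi * Complex.I * v j.1 j.2) * (y j : ℂ)))
  have h2 : ∀ x, gaussLin k τ v x = Complex.exp
    (-∑ j : (i : Fin n) × Fin (k i), (Real.pi * (-Complex.I * (τ j.1 : ℂ))) *
        ((x j.1 j.2 : ℝ) : ℂ) ^ 2 +
      ∑ j : (i : Fin n) × Fin (k i), (2 * Real.pi * Complex.I * v j.1 j.2) *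
        ((x j.1 j.2 : ℝ) : ℂ)) := by
    intro x
    rw [gaussLin_apply, quad_eq_sum, linForm_eq_sum, ← Finset.sum_neg_distrib]
    congr 2
    refine Finset.sum_congr rfl fun j _ => ?_
    ring
  simp_rw [h2]
  rw [h1, GaussianFourier.integral_cexp_neg_sum_mul_add]
  · rw [Finset.prod_mul_distrib, ← Complex.exp_sum, Fintype.sum_sigma, Fintype.prod_sigma]
    congr 1
    · rw [autFactor, ← Finset.prod_inv_distrib]
      refine Finset.prod_congr rfl fun i _ => ?_
      change ∏ _y : Fin (k i), ((Real.pi : ℂ) / (Real.pi * (-Complex.I * (τ i : ℂ)))) ^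
        (1 / 2 : ℂ) = _
      rw [Finset.prod_const, Finset.card_univ, Fintype.card_fin, ← inv_pow]
      congr 1
      have hpi : (Real.pi : ℂ) ≠ 0 := by exact_mod_cast Real.pi_ne_zero
      have e : (Real.pi : ℂ) / (Real.pi * (-Complex.I * (τ i : ℂ))) =
          (-Complex.I * (τ i : ℂ))⁻¹ := by
        rw [div_mul_eq_div_div, div_self hpi, one_div]
      rw [e, Complex.inv_cpow]
      intro harg
      have := (Complex.arg_eq_pi_iff.mp harg).1
      rw [neg_I_mul_re] at this
      exact absurd (τ i).im_pos (not_lt.mpr this.le)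
    · congr 1
      rw [Finset.mul_sum, ← Finset.sum_neg_distrib]
      refine Finset.sum_congr rfl fun i _ => ?_
      rw [sqSum, Finset.sum_div, Finset.mul_sum, ← Finset.sum_neg_distrib]
      refine Finset.sum_congr rfl fun j _ => ?_
      have hτ : (τ i : ℂ) ≠ 0 := (τ i).ne_zero
      have hpi : (Real.pi : ℂ) ≠ 0 := by exact_mod_cast Real.pi_ne_zero
      have hI := Complex.I_ne_zero
      field_simp
      ring
  · intro j
    rw [Complex.re_ofReal_mul, neg_I_mul_re]
    exact mul_pos Real.pi_pos (τ j.1).im_pos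

lemma linForm_sub (k : Fin n → ℕ) (v w : ∀ i, Fin (k i) → ℂ) (x : Space k) :
    linForm k (fun i j => v i j - w i j) x = linForm k v x - linForm k w x := by
  simp only [linForm, sub_mul, Finset.sum_sub_distrib, mul_sub]

/-- The complexification of a vector. -/
def toC (k : Fin n → ℕ) (y : Space k) : ∀ i, Fin (k i) → ℂ := fun i j => ((y i j : ℝ) : ℂ)

lemma linForm_toC (k : Fin n → ℕ) (x y : Space k) :
    linForm k (toC k y) x = 2 * Real.pi * Complex.I * ((inner ℝ x y : ℝ) : ℂ) := by
  simp only [linForm, toC, PiLp.inner_apply, RCLike.inner_apply, conj_trivial]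
  push_cast
  rfl

/-- The Fourier kernel is itself a linear term: it shifts v by -y, and `integral_gaussLin` applies.
-/
lemma fourier_gaussLin_apply (k : Fin n → ℕ) (τ : Fin n → ℍ) (v : ∀ i, Fin (k i) → ℂ)
    (y : Space k) :
    𝓕 (gaussLin k τ v) y = (autFactor k τ)⁻¹ *
      Complex.exp (-(Real.pi * Complex.I * ∑ i, sqSum (fun j => v i j - y i j) / τ i)) := by
  rw [SchwartzMap.fourier_coe, Real.fourier_eq', ← integral_gaussLin k τ]
  congr 1
  funext x
  rw [gaussLin_apply, gaussLin_apply, smul_eq_mul, ← Complex.exp_add]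
  congr 1
  have h := linForm_sub k v (toC k y) x
  rw [linForm_toC] at h
  simp only [toC] at h
  rw [h]
  push_cast
  ring

/-! ### Square roots -/

/-- Principal roots multiply only under this condition on arguments. The sign of the Weil operators
is fixed by the two instances below. -/
lemma sqrt_mul {a b : ℂ} (ha : a ≠ 0) (hb : b ≠ 0)
    (h : a.arg + b.arg ∈ Set.Ioc (-Real.pi) Real.pi) :
    (a * b) ^ (1 / 2 : ℂ) = a ^ (1 / 2 : ℂ) * b ^ (1 / 2 : ℂ) := by
  rw [Complex.cpow_def_of_ne_zero (mul_ne_zero ha hb), Complex.cpow_def_of_ne_zero ha,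
    Complex.cpow_def_of_ne_zero hb, ← Complex.exp_add, Complex.log_mul ha hb h, add_mul]

lemma arg_pos_of_im_pos {a : ℂ} (h : 0 < a.im) : 0 < a.arg := by
  rcases (Complex.arg_nonneg_iff.mpr h.le).lt_or_eq with h1 | h1
  · exact h1
  · have := (Complex.arg_eq_zero_iff.mp h1.symm).2
    exact absurd this h.ne'

lemma arg_lt_pi_of_im_pos {a : ℂ} (h : 0 < a.im) : a.arg < Real.pi :=
  Complex.arg_lt_pi_iff.mpr (Or.inr h.ne')

lemma sqrt_eq_sqrt_I_mul (τ : ℍ) :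
    (τ : ℂ) ^ (1 / 2 : ℂ) = Complex.I ^ (1 / 2 : ℂ) * (-Complex.I * (τ : ℂ)) ^ (1 / 2 : ℂ) := by
  have hre : 0 < (-Complex.I * (τ : ℂ)).re := by
    rw [neg_I_mul_re]
    exact τ.im_pos
  have hne : -Complex.I * (τ : ℂ) ≠ 0 := fun h0 => by simp [h0] at hre
  have harg := abs_lt.mp (Complex.abs_arg_lt_pi_div_two_iff.mpr (Or.inl hre))
  rw [← sqrt_mul Complex.I_ne_zero hne]
  -- The product i·(-iτ) is τ; arg i = π/2 and |arg(-iτ)| < π/2, so the arguments add up within the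
  -- allowed range.
  · congr 1
    rw [← mul_assoc, mul_neg, Complex.I_mul_I]
    simp
  · rw [Complex.arg_I]
    constructor <;> linarith [Real.pi_pos]

lemma sqrt_div_of_im_pos {a b : ℂ} (ha : 0 < a.im) (hb : 0 < b.im) :
    (a / b) ^ (1 / 2 : ℂ) = a ^ (1 / 2 : ℂ) / b ^ (1 / 2 : ℂ) := by
  have ha0 : a ≠ 0 := fun h0 => by simp [h0] at ha
  have hb0 : b ≠ 0 := fun h0 => by simp [h0] at hb
  have hbpi := (arg_lt_pi_of_im_pos hb).ne
  rw [div_eq_mul_inv, sqrt_mul ha0 (inv_ne_zero hb0), Complex.inv_cpow _ _ hbpi]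
  · rfl
  rw [Complex.arg_inv, if_neg hbpi]
  have h1 := arg_pos_of_im_pos ha
  have h2 := arg_lt_pi_of_im_pos ha
  have h3 := arg_pos_of_im_pos hb
  have h4 := arg_lt_pi_of_im_pos hb
  constructor <;> linarith

/-! ### Automorphy factors -/

namespace Mp2

lemma continuous_phi (M : Mp2) : Continuous M.phi := M.holo.continuous

/-- If `c = 0`, then `φ` is constant. -/
lemma phi_eq_of_lower_zero {M : Mp2} (h : M.mat 1 0 = 0) (z w : ℍ) : M.phi z = M.phi w := by
  -- Here φ² is the constant d, and a continuous function on the connected ℍ cannot switch between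
  -- two nonzero square roots.
  have := isPreconnected_univ.eq_of_sq_eq (S := (Set.univ : Set ℍ)) (f := M.phi)
    (g := fun _ => M.phi w)
    M.continuous_phi.continuousOn continuousOn_const
    (fun τ _ => by simp [M.phi_sq, h]) (fun {τ} _ => M.phi_ne_zero w)
    (Set.mem_univ w) rfl
  exact this (Set.mem_univ z)

lemma coe_smul (M : Mp2) (τ : ℍ) : ((M.mat • τ : ℍ) : ℂ) =
    (((M.mat 0 0 : ℝ) : ℂ) * τ + ((M.mat 0 1 : ℝ) : ℂ)) / M.phi τ ^ 2 := by
  rw [UpperHalfPlane.coe_specialLinearGroup_apply, M.phi_sq]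
  rfl

lemma det_eq (M : Mp2) : ((M.mat 0 0 : ℝ) : ℂ) * ((M.mat 1 1 : ℝ) : ℂ) -
    ((M.mat 0 1 : ℝ) : ℂ) * ((M.mat 1 0 : ℝ) : ℂ) = 1 := by
  have h := M.mat.det_coe
  rw [Matrix.det_fin_two] at h
  exact_mod_cast h

/-- The cocycle identity for `c / (cτ + d)`. -/
lemma lower_div_mul (M N : Mp2) (τ : ℍ) :
    (((M * N).mat 1 0 : ℝ) : ℂ) / (M * N).phi τ ^ 2 =
      ((M.mat 1 0 : ℝ) : ℂ) / M.phi (N.mat • τ) ^ 2 / (N.phi τ ^ 2) ^ 2 +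
        ((N.mat 1 0 : ℝ) : ℂ) / N.phi τ ^ 2 := by
  have hM := M.phi_ne_zero (N.mat • τ)
  have hN := N.phi_ne_zero τ
  have e : (((M * N).mat 1 0 : ℝ) : ℂ) =
      ((M.mat 1 0 : ℝ) : ℂ) / N.phi τ ^ 2 +
        ((N.mat 1 0 : ℝ) : ℂ) * M.phi (N.mat • τ) ^ 2 := by
    rw [M.phi_sq, coe_smul]
    have hsq := N.phi_sq τ
    have hdet := N.det_eq
    simp only [mul_mat, Matrix.SpecialLinearGroup.coe_mul, Matrix.mul_apply, Fin.sum_univ_two]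
    push_cast
    field_simp
    rw [hsq]
    linear_combination ((M.mat 1 0 : ℝ) : ℂ) * hdet
  rw [e, mul_phi]
  field_simp

end Mp2

/-! ### Operators implementing an element of the metaplectic group -/

/-- The action of `Mp₂(ℝ)ⁿ` on the linear terms of Gaussians. -/
def actLin (k : Fin n → ℕ) (M : Fin n → Mp2) (τ : Fin n → ℍ) (v : ∀ i, Fin (k i) → ℂ) :
    ∀ i, Fin (k i) → ℂ :=
  fun i j => v i j / (M i).phi (τ i) ^ 2

/-- The automorphy factor of Gaussians with a linear term. -/
def jacobiFactor (k : Fin n → ℕ) (M : Fin n → Mp2) (τ : Fin n → ℍ)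
    (v : ∀ i, Fin (k i) → ℂ) : ℂ :=
  (∏ i, (M i).phi (τ i) ^ k i) * Complex.exp (Real.pi * Complex.I *
    ∑ i, (((M i).mat 1 0 : ℝ) : ℂ) / (M i).phi (τ i) ^ 2 * sqSum (v i))

lemma jacobiFactor_ne_zero (k : Fin n → ℕ) (M : Fin n → Mp2) (τ : Fin n → ℍ)
    (v : ∀ i, Fin (k i) → ℂ) : jacobiFactor k M τ v ≠ 0 :=
  mul_ne_zero (Finset.prod_ne_zero_iff.mpr fun i _ => pow_ne_zero _ ((M i).phi_ne_zero _))
    (Complex.exp_ne_zero _)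

lemma jacobiFactor_zero (k : Fin n → ℕ) (M : Fin n → Mp2) (τ : Fin n → ℍ) :
    jacobiFactor k M τ 0 = ∏ i, (M i).phi (τ i) ^ k i := by
  simp [jacobiFactor, sqSum]

lemma sqSum_div {m : ℕ} (v : Fin m → ℂ) (a : ℂ) :
    sqSum (fun j => v j / a) = sqSum v / a ^ 2 := by
  simp only [sqSum, div_pow, Finset.sum_div]

/-- The powers of φ multiply by the group law of `Mp2`; the exponents add by the cocycle identity
for c / φ². -/
lemma jacobiFactor_mul (k : Fin n → ℕ) (M N : Fin n → Mp2) (τ : Fin n → ℍ)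
    (v : ∀ i, Fin (k i) → ℂ) : jacobiFactor k (M * N) τ v =
      jacobiFactor k M (fun i => (N i).mat • τ i) (actLin k N τ v) * jacobiFactor k N τ v := by
  simp only [jacobiFactor]
  rw [mul_mul_mul_comm, ← Finset.prod_mul_distrib, ← Complex.exp_add, ← mul_add,
    ← Finset.sum_add_distrib]
  congr 1
  · refine Finset.prod_congr rfl fun i _ => ?_
    rw [Pi.mul_apply, Mp2.mul_phi, mul_pow]
  · congr 2
    refine Finset.sum_congr rfl fun i _ => ?_
    have h := Mp2.lower_div_mul (M i) (N i) (τ i)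
    rw [Pi.mul_apply, h]
    have e : sqSum (actLin k N τ v i) = sqSum (v i) / ((N i).phi (τ i) ^ 2) ^ 2 := sqSum_div _ _
    rw [e]
    ring

/-- `A` is, up to a constant, unitary and acts on Gaussians with a linear term as the Weil
representation of `M` does. -/
structure Implements (k : Fin n → ℕ) (M : Fin n → Mp2) (A : 𝓢(Space k, ℂ) →L[ℂ] 𝓢(Space k, ℂ)) :
    Prop where
  inner : ∃ C : ℂ, C ≠ 0 ∧ ∀ φ ψ : 𝓢(Space k, ℂ), ∫ x, starRingEnd ℂ (A φ x) * A ψ x =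
    C * ∫ x, starRingEnd ℂ (φ x) * ψ x
  gauss : ∀ (τ : Fin n → ℍ) (v : ∀ i, Fin (k i) → ℂ),
    A (gaussLin k (fun i => (M i).mat • τ i) (actLin k M τ v)) =
      jacobiFactor k M τ v • gaussLin k τ v

lemma actLin_mul (k : Fin n → ℕ) (M N : Fin n → Mp2) (τ : Fin n → ℍ)
    (v : ∀ i, Fin (k i) → ℂ) : actLin k (M * N) τ v =
      actLin k M (fun i => (N i).mat • τ i) (actLin k N τ v) := by
  funext i j
  simp only [actLin, Pi.mul_apply, Mp2.mul_phi]
  rw [mul_pow, mul_comm, div_mul_eq_div_div]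

/-- The order is reversed because the operators pull Gaussians back; hence ω(MN) = ω(N) ω(M). -/
lemma Implements.mul {k : Fin n → ℕ} {M N : Fin n → Mp2}
    {A B : 𝓢(Space k, ℂ) →L[ℂ] 𝓢(Space k, ℂ)} (hA : Implements k M A) (hB : Implements k N B) :
    Implements k (M * N) (B.comp A) where
  inner := by
    obtain ⟨C, hC, h⟩ := hA.inner
    obtain ⟨C', hC', h'⟩ := hB.inner
    refine ⟨C' * C, mul_ne_zero hC' hC, fun φ ψ => ?_⟩
    rw [ContinuousLinearMap.comp_apply, ContinuousLinearMap.comp_apply, h', h, mul_assoc]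
  gauss τ v := by
    have e : (fun i => ((M * N) i).mat • τ i) = fun i => (M i).mat • (N i).mat • τ i := by
      funext i
      rw [Pi.mul_apply, Mp2.mul_mat, mul_smul]
    rw [ContinuousLinearMap.comp_apply, e, actLin_mul, hA.gauss, map_smul, hB.gauss, smul_smul,
      jacobiFactor_mul]

/-- Every Gaussian with a linear term is a transformed one, so `Implements.gauss` determines the
operator on all of them. -/
lemma exists_act_eq (k : Fin n → ℕ) (M : Fin n → Mp2) (τ : Fin n → ℍ)
    (v : ∀ i, Fin (k i) → ℂ) : ∃ (τ' : Fin n → ℍ) (v' : ∀ i, Fin (k i) → ℂ),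
      (fun i => (M i).mat • τ' i) = τ ∧ actLin k M τ' v' = v := by
  refine ⟨fun i => (M i).mat⁻¹ • τ i,
    fun i j => v i j * (M i).phi ((M i).mat⁻¹ • τ i) ^ 2, ?_, ?_⟩
  · funext i
    simp
  · funext i j
    simp [actLin, (M i).phi_ne_zero]

lemma actLin_one (k : Fin n → ℕ) (τ : Fin n → ℍ) (v : ∀ i, Fin (k i) → ℂ) :
    actLin k 1 τ v = v := by
  funext i j
  simp [actLin]

lemma jacobiFactor_one (k : Fin n → ℕ) (τ : Fin n → ℍ) (v : ∀ i, Fin (k i) → ℂ) :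
    jacobiFactor k 1 τ v = 1 := by
  simp [jacobiFactor]

lemma Implements.inv {k : Fin n → ℕ} {M : Fin n → Mp2}
    {A B : 𝓢(Space k, ℂ) →L[ℂ] 𝓢(Space k, ℂ)} (hA : Implements k M A)
    (hAB : ∀ φ, A (B φ) = φ) (hBA : ∀ φ, B (A φ) = φ) : Implements k M⁻¹ B where
  inner := by
    obtain ⟨C, hC, h⟩ := hA.inner
    refine ⟨C⁻¹, inv_ne_zero hC, fun φ ψ => ?_⟩
    have := h (B φ) (B ψ)
    rw [hAB, hAB] at this
    rw [this, inv_mul_cancel_left₀ hC]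
  gauss τ v := by
    have h := hA.gauss (fun i => (M⁻¹ i).mat • τ i) (actLin k M⁻¹ τ v)
    rw [← actLin_mul, mul_inv_cancel, actLin_one] at h
    have e : (fun i => (M i).mat • (fun i => (M⁻¹ i).mat • τ i) i) = τ := by
      funext i
      simp
    rw [e] at h
    have h2 := congrArg B h
    rw [hBA] at h2
    rw [h2, map_smul, smul_smul, mul_comm, ← jacobiFactor_mul, mul_inv_cancel, jacobiFactor_one,
      one_smul]

/-! ### Separation of Schwartz functions by Gaussians, and uniqueness of implementing operators. -/

/-- The point `(i, …, i)`. -/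
def ptI (n : ℕ) : Fin n → ℍ := fun _ => UpperHalfPlane.I

lemma star_quad_ptI (k : Fin n → ℕ) (x : Space k) :
    starRingEnd ℂ (quad k (fun i => (ptI n i : ℂ)) x) = quad k (fun i => (ptI n i : ℂ)) x := by
  simp only [quad, ptI, UpperHalfPlane.coe_I, ← Finset.mul_sum, map_mul, Complex.conj_ofReal,
    Complex.conj_I, map_sum]
  ring

lemma star_gaussLin_ptI (k : Fin n → ℕ) (y x : Space k) :
    starRingEnd ℂ (gaussLin k (ptI n) (toC k y) x) = gaussLin k (ptI n) (toC k (-y)) x := by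
  rw [gaussLin_apply, gaussLin_apply, ← Complex.exp_conj, map_add, star_quad_ptI]
  congr 2
  rw [linForm_toC, linForm_toC, inner_neg_right]
  simp only [map_mul, Complex.conj_ofReal, Complex.conj_I, Complex.ofReal_neg]
  rw [Complex.conj_ofNat]
  ring

lemma gaussLin_toC_apply (k : Fin n → ℕ) (τ : Fin n → ℍ) (y x : Space k) :
    gaussLin k τ (toC k y) x = gaussian k τ x *
      Complex.exp (2 * Real.pi * Complex.I * ((inner ℝ x y : ℝ) : ℂ)) := by
  rw [gaussLin_apply, gaussian_apply, ← linForm_toC, Complex.exp_add]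

lemma gaussian_ne_zero (k : Fin n → ℕ) (τ : Fin n → ℍ) (x : Space k) : gaussian k τ x ≠ 0 :=
  Complex.exp_ne_zero _

/-- Multiplication of Schwartz functions by a Gaussian. -/
def mulGaussian (k : Fin n → ℕ) (τ : Fin n → ℍ) : 𝓢(Space k, ℂ) →L[ℂ] 𝓢(Space k, ℂ) :=
  SchwartzMap.smulLeftCLM ℂ (gaussian k τ)

lemma mulGaussian_apply (k : Fin n → ℕ) (τ : Fin n → ℍ) (φ : 𝓢(Space k, ℂ)) (x : Space k) :
    mulGaussian k τ φ x = gaussian k τ x * φ x := by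
  rw [mulGaussian, SchwartzMap.smulLeftCLM_apply_apply (gaussian k τ).hasTemperateGrowth,
    smul_eq_mul]

lemma fourier_mulGaussian (k : Fin n → ℕ) (τ : Fin n → ℍ) (φ : 𝓢(Space k, ℂ)) (y : Space k) :
    𝓕 (mulGaussian k τ φ) y = ∫ x, gaussLin k τ (toC k (-y)) x * φ x := by
  rw [SchwartzMap.fourier_coe, Real.fourier_eq']
  congr 1
  funext x
  rw [gaussLin_toC_apply, mulGaussian_apply, smul_eq_mul, inner_neg_right]
  push_cast
  rw [← mul_assoc, mul_comm (gaussian k τ x)]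
  congr 3
  ring

/-- These integrals are the values of the Fourier transform of D times a fixed Gaussian, and that
Gaussian has no zeros. -/
lemma eq_zero_of_integral_gaussLin_mul {k : Fin n → ℕ} {D : 𝓢(Space k, ℂ)}
    (h : ∀ y, ∫ x, gaussLin k (ptI n) (toC k y) x * D x = 0) : D = 0 := by
  have h1 : 𝓕 (mulGaussian k (ptI n) D) = 0 := by
    ext y
    rw [fourier_mulGaussian, h]
    rfl
  have h2 : mulGaussian k (ptI n) D = 0 := by
    have h3 : (𝓕⁻ (𝓕 (mulGaussian k (ptI n) D) : 𝓢(Space k, ℂ)) : 𝓢(Space k, ℂ)) =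
        mulGaussian k (ptI n) D := FourierTransform.fourierInv_fourier_eq _
    rw [← h3, h1, FourierTransform.fourierInv_zero]
  ext x
  have h3 := congrArg (fun f : 𝓢(Space k, ℂ) => f x) h2
  simp only [mulGaussian_apply] at h3
  exact (mul_eq_zero.mp h3).resolve_left (gaussian_ne_zero _ _ _)

lemma autFactor_ne_zero (k : Fin n → ℕ) (τ : Fin n → ℍ) : autFactor k τ ≠ 0 := by
  refine Finset.prod_ne_zero_iff.mpr fun i _ => pow_ne_zero _ ?_
  rw [Complex.cpow_def_of_ne_zero (mul_ne_zero (neg_ne_zero.mpr Complex.I_ne_zero) (τ i).ne_zero)]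
  exact Complex.exp_ne_zero _

/-- The squared modulus of the Gaussian at i is the Gaussian at 2i, whose integral is explicit. -/
lemma integral_star_gaussian_mul_ne_zero (k : Fin n → ℕ) :
    ∫ x, starRingEnd ℂ (gaussLin k (ptI n) 0 x) * gaussLin k (ptI n) 0 x ≠ 0 := by
  have e : ∀ x, starRingEnd ℂ (gaussLin k (ptI n) 0 x) * gaussLin k (ptI n) 0 x =
      gaussLin k (fun _ => ⟨2 * Complex.I, by simp⟩) 0 x := by
    intro x
    have h0 : (0 : ∀ i, Fin (k i) → ℂ) = toC k 0 := by
      funext i j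
      simp [toC]
    rw [h0, star_gaussLin_ptI, neg_zero, ← h0, gaussLin_zero, gaussLin_zero, gaussian_apply,
      gaussian_apply, ← Complex.exp_add]
    congr 1
    simp only [quad, ptI, UpperHalfPlane.coe_I, ← Finset.mul_sum]
    ring
  simp_rw [e]
  rw [integral_gaussLin]
  exact mul_ne_zero (inv_ne_zero (autFactor_ne_zero _ _)) (Complex.exp_ne_zero _)

/-- Unitarity transfers agreement on Gaussians to agreement on every φ through inner products, so
density of Gaussians in the Schwartz topology is not needed. -/
lemma Implements.unique {k : Fin n → ℕ} {M : Fin n → Mp2}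
    {A B : 𝓢(Space k, ℂ) →L[ℂ] 𝓢(Space k, ℂ)} (hA : Implements k M A) (hB : Implements k M B)
    (φ : 𝓢(Space k, ℂ)) : A φ = B φ := by
  have hG : ∀ τ v, A (gaussLin k τ v) = B (gaussLin k τ v) := by
    intro τ v
    obtain ⟨τ', v', rfl, rfl⟩ := exists_act_eq k M τ v
    rw [hA.gauss, hB.gauss]
  obtain ⟨C, hC, h⟩ := hA.inner
  obtain ⟨C', hC', h'⟩ := hB.inner
  -- The two unitarity constants must first be identified; one Gaussian of nonzero norm suffices.
  have hCC : C = C' := by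
    have h1 := h (gaussLin k (ptI n) 0) (gaussLin k (ptI n) 0)
    have h2 := h' (gaussLin k (ptI n) 0) (gaussLin k (ptI n) 0)
    rw [hG, h2] at h1
    exact (mul_right_cancel₀ (integral_star_gaussian_mul_ne_zero k) h1).symm
  have hint : ∀ f g : 𝓢(Space k, ℂ), Integrable (fun x => starRingEnd ℂ (f x) * g x) := by
    intro f g
    obtain ⟨b, hb⟩ : ∃ b, ∀ x, ‖starRingEnd ℂ (f x)‖ ≤ b :=
      ⟨_, fun x => by rw [RCLike.norm_conj]; exact f.norm_le_seminorm ℂ x⟩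
    exact g.integrable.bdd_mul
      (Complex.continuous_conj.comp f.continuous).aestronglyMeasurable
      (Filter.Eventually.of_forall hb)
  suffices A φ - B φ = 0 from sub_eq_zero.mp this
  refine eq_zero_of_integral_gaussLin_mul fun y => ?_
  have hk : ∀ τ v, ∫ x, starRingEnd ℂ (gaussLin k τ v x) * (A φ - B φ) x = 0 := by
    intro τ v
    have e1 := h (gaussLin k (fun i => (M i).mat • τ i) (actLin k M τ v)) φ
    have e2 := h' (gaussLin k (fun i => (M i).mat • τ i) (actLin k M τ v)) φ
    rw [hA.gauss] at e1
    rw [hB.gauss] at e2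
    have e3 : ∀ x, starRingEnd ℂ (gaussLin k τ v x) * (A φ - B φ) x =
        (starRingEnd ℂ (jacobiFactor k M τ v))⁻¹ *
          (starRingEnd ℂ ((jacobiFactor k M τ v • gaussLin k τ v) x) * A φ x -
          starRingEnd ℂ ((jacobiFactor k M τ v • gaussLin k τ v) x) * B φ x) := by
      intro x
      have hne : starRingEnd ℂ (jacobiFactor k M τ v) ≠ 0 := by
        rw [ne_eq, map_eq_zero]
        exact jacobiFactor_ne_zero k M τ v
      rw [← mul_sub, smul_apply, smul_eq_mul, map_mul, mul_assoc,
        inv_mul_cancel_left₀ hne, sub_apply]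
    simp_rw [e3]
    rw [integral_const_mul, integral_sub (hint _ _) (hint _ _), e1, e2, hCC, sub_self, mul_zero]
  -- At τ = i, complex conjugation only changes the sign of a real linear term.
  rw [← hk (ptI n) (toC k (-y))]
  congr 1
  funext x
  rw [star_gaussLin_ptI, neg_neg]

/-! ### The generators of the metaplectic group -/

lemma mulChirp_apply (k : Fin n → ℕ) (b : Fin n → ℝ) (φ : 𝓢(Space k, ℂ)) (x : Space k) :
    mulChirp k b φ x = chirp k b x * φ x := by
  rw [mulChirp, SchwartzMap.smulLeftCLM_apply_apply (chirp_hasTemperateGrowth k b), smul_eq_mul]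

lemma star_chirp_mul (k : Fin n → ℕ) (b : Fin n → ℝ) (x : Space k) :
    starRingEnd ℂ (chirp k b x) * chirp k b x = 1 := by
  rw [← Complex.normSq_eq_conj_mul_self, Complex.normSq_eq_norm_sq, chirp, Complex.norm_exp,
    quad_re]
  simp

lemma quad_add (k : Fin n → ℕ) (z w : Fin n → ℂ) (x : Space k) :
    quad k z x + quad k w x = quad k (fun i => z i + w i) x := by
  simp only [quad, add_mul, Finset.sum_add_distrib, mul_add]

lemma implements_t (k : Fin n → ℕ) (b : Fin n → ℝ) :
    Implements k (fun i => Mp2.t (b i)) (mulChirp k (fun i => -b i)) where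
  inner := by
    refine ⟨1, one_ne_zero, fun φ ψ => ?_⟩
    rw [one_mul]
    congr 1
    funext x
    rw [mulChirp_apply, mulChirp_apply, map_mul, mul_mul_mul_comm, star_chirp_mul, one_mul]
  gauss τ v := by
    ext x
    have h1 : actLin k (fun i => Mp2.t (b i)) τ v = v := by
      funext i j
      simp [actLin, Mp2.t]
    have h2 : jacobiFactor k (fun i => Mp2.t (b i)) τ v = 1 := by
      simp [jacobiFactor, Mp2.t]
    rw [h1, h2, one_smul, mulChirp_apply, gaussLin_apply, gaussLin_apply, chirp,
      ← Complex.exp_add, ← add_assoc, quad_add]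
    congr 3
    funext i
    have h3 : (((Mp2.t (b i)).mat • τ i : ℍ) : ℂ) = τ i + b i := by
      rw [Mp2.coe_smul]
      simp [Mp2.t]
    rw [h3]
    push_cast
    ring

lemma fourierInv_apply_neg (k : Fin n → ℕ) (φ : 𝓢(Space k, ℂ)) (x : Space k) :
    (𝓕⁻ φ) x = (𝓕 φ) (-x) := rfl

/-- The constant `∏ √i^{kᵢ}`. -/
def sqrtIFactor (k : Fin n → ℕ) : ℂ := ∏ i, (Complex.I ^ (1 / 2 : ℂ)) ^ k i

lemma sqrtIFactor_ne_zero (k : Fin n → ℕ) : sqrtIFactor k ≠ 0 := by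
  refine Finset.prod_ne_zero_iff.mpr fun i _ => pow_ne_zero _ ?_
  rw [Complex.cpow_def_of_ne_zero Complex.I_ne_zero]
  exact Complex.exp_ne_zero _

lemma Mp2.coe_S_smul (τ : ℍ) : ((Mp2.S.mat • τ : ℍ) : ℂ) = -(τ : ℂ)⁻¹ := by
  rw [UpperHalfPlane.coe_specialLinearGroup_apply]
  simp [Mp2.S, div_eq_mul_inv]

lemma coe_negInv (τ : Fin n → ℍ) (i : Fin n) : ((negInv τ i : ℍ) : ℂ) = -(τ i : ℂ)⁻¹ := by
  rw [negInv, UpperHalfPlane.coe_mk, inv_neg]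

lemma S_smul_eq_negInv (τ : Fin n → ℍ) : (fun i => Mp2.S.mat • τ i) = negInv τ := by
  funext i
  ext
  rw [Mp2.coe_S_smul, coe_negInv]

lemma autFactor_negInv (k : Fin n → ℕ) (τ : Fin n → ℍ) :
    (autFactor k (negInv τ))⁻¹ = autFactor k τ := by
  rw [autFactor, autFactor, ← Finset.prod_inv_distrib]
  refine Finset.prod_congr rfl fun i _ => ?_
  rw [← inv_pow]
  congr 1
  have hre : 0 < (-Complex.I * (τ i : ℂ)).re := by
    rw [neg_I_mul_re]
    exact (τ i).im_pos
  have e : -Complex.I * ((negInv τ i : ℍ) : ℂ) = (-Complex.I * (τ i : ℂ))⁻¹ := by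
    rw [coe_negInv, mul_inv, inv_neg, Complex.inv_I]
    ring
  rw [e, Complex.inv_cpow, inv_inv]
  intro harg
  exact absurd hre (not_lt.mpr (Complex.arg_eq_pi_iff.mp harg).1.le)

lemma prod_S_phi (k : Fin n → ℕ) (τ : Fin n → ℍ) :
    ∏ i, Mp2.S.phi (τ i) ^ k i = sqrtIFactor k * autFactor k τ := by
  rw [sqrtIFactor, autFactor, ← Finset.prod_mul_distrib]
  refine Finset.prod_congr rfl fun i _ => ?_
  rw [← mul_pow]
  congr 1
  exact sqrt_eq_sqrt_I_mul (τ i)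

lemma sum_sq_coord (k : Fin n → ℕ) (x : Space k) (i : Fin n) :
    ((‖x i‖ ^ 2 : ℝ) : ℂ) = ∑ j, ((x i j : ℝ) : ℂ) ^ 2 := by
  rw [EuclideanSpace.real_norm_sq_eq]
  push_cast
  rfl

/-- The Fourier transform of the Gaussian at -1/τ supplies √(-iτ)^k; the constant ∏ √i^{kᵢ} turns
this into the powers of φ_S = √τ. Unitarity up to a scalar is Plancherel. -/
lemma implements_S (k : Fin n → ℕ) :
    Implements k (fun _ => Mp2.S)
      (sqrtIFactor k • FourierTransform.fourierInvCLM ℂ 𝓢(Space k, ℂ)) where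
  inner := by
    refine ⟨starRingEnd ℂ (sqrtIFactor k) * sqrtIFactor k, mul_ne_zero
      ((map_ne_zero _).mpr (sqrtIFactor_ne_zero k)) (sqrtIFactor_ne_zero k), fun φ ψ => ?_⟩
    have h := SchwartzMap.integral_inner_fourier_fourier (𝓕⁻ φ) (𝓕⁻ ψ)
    rw [FourierTransform.fourier_fourierInv_eq, FourierTransform.fourier_fourierInv_eq] at h
    simp only [RCLike.inner_apply] at h
    have e : ∀ f g : ℂ, starRingEnd ℂ f * g = g * starRingEnd ℂ f := fun f g => mul_comm _ _
    simp_rw [e]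
    rw [h, ← integral_const_mul]
    congr 1
    funext x
    change sqrtIFactor k * (𝓕⁻ ψ) x * starRingEnd ℂ (sqrtIFactor k * (𝓕⁻ φ) x) = _
    rw [map_mul]
    ring
  gauss τ v := by
    ext x
    rw [S_smul_eq_negInv]
    change sqrtIFactor k * (𝓕⁻ (gaussLin k (negInv τ) (actLin k (fun _ => Mp2.S) τ v))) x =
      jacobiFactor k (fun _ => Mp2.S) τ v * gaussLin k τ v x
    rw [fourierInv_apply_neg, fourier_gaussLin_apply, autFactor_negInv, jacobiFactor, prod_S_phi,
      gaussLin_apply, mul_assoc, mul_assoc, mul_assoc, ← Complex.exp_add]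
    congr 3
    simp only [quad, linForm]
    rw [mul_assoc 2, mul_assoc 2, mul_left_comm 2 _ (∑ i, _), ← mul_add, ← mul_neg, ← mul_add]
    simp only [Finset.mul_sum, ← Finset.sum_add_distrib, ← Finset.sum_neg_distrib]
    refine Finset.sum_congr rfl fun i _ => ?_
    have hτ := (τ i).ne_zero
    rw [sum_sq_coord]
    simp only [sqSum, actLin, Mp2.S.phi_sq, coe_negInv, Finset.sum_div, Finset.mul_sum,
      ← Finset.sum_add_distrib, ← Finset.sum_neg_distrib]
    refine Finset.sum_congr rfl fun j _ => ?_
    simp only [Mp2.S, Matrix.of_apply, Matrix.cons_val', Matrix.cons_val_zero,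
      Matrix.cons_val_one, Matrix.cons_val_fin_one, PiLp.neg_apply]
    generalize (τ i : ℂ) = t at hτ ⊢
    push_cast
    simp only [div_eq_mul_inv, inv_neg, inv_inv]
    linear_combination Real.pi * Complex.I *
      (2 * v i j * ((x i j : ℝ) : ℂ) + v i j ^ 2 * t⁻¹) * mul_inv_cancel₀ hτ

lemma implements_S_inv (k : Fin n → ℕ) :
    Implements k (fun _ => Mp2.S⁻¹)
      ((sqrtIFactor k)⁻¹ • FourierTransform.fourierCLM ℂ 𝓢(Space k, ℂ)) := by
  have hne := sqrtIFactor_ne_zero k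
  refine (implements_S k).inv (fun φ => ?_) (fun φ => ?_)
  · change sqrtIFactor k • 𝓕⁻ ((sqrtIFactor k)⁻¹ • 𝓕 φ) = φ
    rw [FourierTransform.fourierInv_smul, smul_smul, mul_inv_cancel₀ hne, one_smul,
      FourierTransform.fourierInv_fourier_eq]
  · change (sqrtIFactor k)⁻¹ • 𝓕 (sqrtIFactor k • 𝓕⁻ φ) = φ
    rw [FourierTransform.fourier_smul, smul_smul, inv_mul_cancel₀ hne, one_smul,
      FourierTransform.fourier_fourierInv_eq]

lemma dilate_apply (k : Fin n → ℕ) (s : Fin n → ℝˣ) (φ : 𝓢(Space k, ℂ)) (x : Space k) :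
    dilate k s φ x = φ (scaleEquiv k s x) := rfl

/-- Only the nonvanishing of the Jacobian constant matters, since `Implements.inner` allows an
arbitrary nonzero scalar. -/
lemma exists_integral_comp_equiv {E : Type*} [NormedAddCommGroup E] [InnerProductSpace ℝ E]
    [FiniteDimensional ℝ E] [MeasurableSpace E] [BorelSpace E] (L : E ≃L[ℝ] E) :
    ∃ C : ℂ, C ≠ 0 ∧ ∀ f : E → ℂ, ∫ x, f (L x) = C * ∫ x, f x := by
  have hdet : LinearMap.det (L : E →ₗ[ℝ] E) ≠ 0 := (LinearEquiv.isUnit_det' L.toLinearEquiv).ne_zero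
  refine ⟨((|(LinearMap.det (L : E →ₗ[ℝ] E))⁻¹| : ℝ) : ℂ), ?_, fun f => ?_⟩
  · exact_mod_cast abs_ne_zero.mpr (inv_ne_zero hdet)
  · have h1 := L.toHomeomorph.measurableEmbedding.integral_map (μ := volume) f
    have h2 := Measure.map_linearMap_addHaar_eq_smul_addHaar (volume : Measure E) hdet
    change Measure.map L volume = _ at h2
    change ∫ y, f y ∂(Measure.map L volume) = ∫ x, f (L x) at h1
    rw [← h1, h2, integral_smul_measure, ENNReal.toReal_ofReal (abs_nonneg _)]
    simp

/-- The sᵢ may be negative, so the lifts of -1 are included. As c = 0, φ is constant and its value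
at i serves for every τ. -/
lemma implements_diag (k : Fin n → ℕ) (D : Fin n → Mp2) (s : Fin n → ℝˣ)
    (hD : ∀ i, ((D i).mat : Matrix (Fin 2) (Fin 2) ℝ) = !![(s i : ℝ), 0; 0, (s i : ℝ)⁻¹]) :
    Implements k D ((∏ i, (D i).phi UpperHalfPlane.I ^ k i) • dilate k s) := by
  set c := ∏ i, (D i).phi UpperHalfPlane.I ^ k i with hc
  have hc0 : c ≠ 0 := Finset.prod_ne_zero_iff.mpr fun i _ => pow_ne_zero _ ((D i).phi_ne_zero _)
  have h00 : ∀ i, (D i).mat 0 0 = s i := fun i => by simp [hD]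
  have h01 : ∀ i, (D i).mat 0 1 = 0 := fun i => by simp [hD]
  have h10 : ∀ i, (D i).mat 1 0 = 0 := fun i => by simp [hD]
  have h11 : ∀ i, (D i).mat 1 1 = (s i : ℝ)⁻¹ := fun i => by simp [hD]
  refine ⟨?_, fun τ v => ?_⟩
  · obtain ⟨C, hC, h⟩ := exists_integral_comp_equiv (scaleEquiv k s)
    refine ⟨starRingEnd ℂ c * c * C, mul_ne_zero (mul_ne_zero ((map_ne_zero _).mpr hc0) hc0) hC,
      fun φ ψ => ?_⟩
    rw [mul_assoc, ← h (fun x => starRingEnd ℂ (φ x) * ψ x), ← integral_const_mul]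
    congr 1
    funext x
    change starRingEnd ℂ (c * dilate k s φ x) * (c * dilate k s ψ x) = _
    rw [map_mul, dilate_apply, dilate_apply]
    ring
  · ext x
    change c * dilate k s _ x = jacobiFactor k D τ v * gaussLin k τ v x
    have hj : jacobiFactor k D τ v = c := by
      simp only [jacobiFactor, h10, Complex.ofReal_zero, zero_div, zero_mul,
        Finset.sum_const_zero, mul_zero, Complex.exp_zero, mul_one, hc]
      exact Finset.prod_congr rfl fun i _ => by
        rw [Mp2.phi_eq_of_lower_zero (h10 i) (τ i) UpperHalfPlane.I]
    have hs : ∀ i, ((s i : ℝ) : ℂ) ≠ 0 := fun i => by exact_mod_cast (s i).ne_zero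
    have hphi : ∀ i, (D i).phi (τ i) ^ 2 = ((s i : ℝ) : ℂ)⁻¹ := fun i => by
      rw [Mp2.phi_sq, h10, h11]
      simp
    rw [hj, dilate_apply, gaussLin_apply, gaussLin_apply]
    congr 3
    · simp only [quad]
      congr 1
      refine Finset.sum_congr rfl fun i _ => ?_
      rw [Mp2.coe_smul, hphi, h00, h01, scaleEquiv_apply, norm_smul, mul_pow, Real.norm_eq_abs,
        sq_abs]
      have := hs i
      push_cast
      field_simp
      ring
    · simp only [linForm]
      congr 1
      refine Finset.sum_congr rfl fun i _ => Finset.sum_congr rfl fun j _ => ?_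
      rw [actLin, hphi, scaleEquiv_apply, PiLp.smul_apply, smul_eq_mul]
      have := hs i
      push_cast
      field_simp

/-! ### The Weil representation -/

/-- The product `t(u) S t(-c) S⁻¹ t(w)` in the factorization of `M`. -/
def Mp2.unipotentPart (M : Mp2) : Mp2 :=
  Mp2.t M.left * Mp2.S * Mp2.t (-(M.mat 1 0)) * Mp2.S⁻¹ * Mp2.t M.right

/-- The diagonal part in the factorization of `M`. -/
def Mp2.diagPart (M : Mp2) : Mp2 := M.unipotentPart⁻¹ * M

lemma Mp2.unipotentPart_mul_diagPart (M : Mp2) : M.unipotentPart * M.diagPart = M :=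
  mul_inv_cancel_left _ _

lemma Mp2.diagPart_mat (M : Mp2) : (M.diagPart.mat : Matrix (Fin 2) (Fin 2) ℝ) =
    !![(M.dil : ℝ), 0; 0, (M.dil : ℝ)⁻¹] := by
  rw [Mp2.diagPart, Mp2.mul_mat, Matrix.SpecialLinearGroup.coe_mul]
  conv_lhs => rw [M.mat_eq]
  rw [← Mp2.unipotentPart, ← Matrix.mul_assoc, ← Matrix.SpecialLinearGroup.coe_mul, ← Mp2.mul_mat,
    inv_mul_cancel, Mp2.one_mat, Matrix.SpecialLinearGroup.coe_one, Matrix.one_mul]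

lemma Mp2.coe_t_smul (b : ℝ) (τ : ℍ) : (((Mp2.t b).mat • τ : ℍ) : ℂ) = τ + b := by
  rw [Mp2.coe_smul]
  simp [Mp2.t]

lemma Mp2.t_phi (b : ℝ) (τ : ℍ) : (Mp2.t b).phi τ = 1 := rfl

/-- The factors of S and S⁻¹ combine to √(y - c) / √y, where y = -1/z and z = τ + w with w =
`right`. Both y - c and y lie in ℍ, so the principal root of the quotient (y - c)/y = 1 + cz appears
without a sign. -/
lemma Mp2.unipotentPart_phi (M : Mp2) (τ : ℍ) : M.unipotentPart.phi τ =
    (1 + ((M.mat 1 0 : ℝ) : ℂ) * (τ + M.right)) ^ (1 / 2 : ℂ) := by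
  simp only [Mp2.unipotentPart, Mp2.mul_phi, Mp2.t_phi, Mp2.inv_phi, mul_one, one_mul]
  set z : ℍ := (Mp2.t M.right).mat • τ with hz
  have hzc : (z : ℂ) = τ + M.right := Mp2.coe_t_smul _ _
  set y : ℍ := Mp2.S⁻¹.mat • z with hy
  have hyc : (y : ℂ) = -(z : ℂ)⁻¹ := by
    have h := Mp2.coe_S_smul y
    rw [hy, Mp2.inv_mat, smul_inv_smul] at h
    rw [h, inv_neg, neg_neg, inv_inv, hy, Mp2.inv_mat]
  have hS : Mp2.S.mat⁻¹ • z = y := rfl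
  rw [hS]
  change (((Mp2.t (-(M.mat 1 0))).mat • y : ℍ) : ℂ) ^ (1 / 2 : ℂ) * ((y : ℂ) ^ (1 / 2 : ℂ))⁻¹ = _
  rw [← div_eq_mul_inv, ← sqrt_div_of_im_pos (UpperHalfPlane.im_pos _) (UpperHalfPlane.im_pos _),
    Mp2.coe_t_smul, ← hzc, hyc]
  congr 1
  have := z.ne_zero
  push_cast
  field_simp
  ring

/-- If c ≠ 0, the diagonal matrix is the identity and 1 + c(τ + w) = cτ + d, so what is left of φ is
its ratio to the principal root. If c = 0, the unipotent part has factor 1. -/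
lemma Mp2.diagPart_phi (M : Mp2) : M.diagPart.phi UpperHalfPlane.I = M.sgn := by
  have h1 : M.phi UpperHalfPlane.I =
      M.unipotentPart.phi (M.diagPart.mat • UpperHalfPlane.I) *
        M.diagPart.phi UpperHalfPlane.I := by
    rw [← Mp2.mul_phi, Mp2.unipotentPart_mul_diagPart]
  rw [Mp2.unipotentPart_phi] at h1
  unfold Mp2.sgn
  split_ifs with h
  · rw [h1, h]
    simp
  · have hd : M.diagPart.mat = 1 := by
      apply Subtype.ext
      rw [Mp2.diagPart_mat]
      simp [Mp2.dil, h, Matrix.one_fin_two]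
    have hr : (1 + ((M.mat 1 0 : ℝ) : ℂ) * (Complex.I + M.right)) =
        ((M.mat 1 0 : ℝ) : ℂ) * Complex.I + ((M.mat 1 1 : ℝ) : ℂ) := by
      have hc : ((M.mat 1 0 : ℝ) : ℂ) ≠ 0 := by exact_mod_cast h
      rw [Mp2.right, if_neg h]
      push_cast
      field_simp
      ring
    rw [hd, one_smul, UpperHalfPlane.coe_I, hr] at h1
    rw [h1, mul_div_cancel_left₀]
    intro h0
    rw [h0, zero_mul] at h1
    exact M.phi_ne_zero _ h1

lemma implements_weilOp (k : Fin n → ℕ) (M : Fin n → Mp2) : Implements k M (weilOp k M) := by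
  have h := (((((implements_t k (fun i => (M i).left)).mul (implements_S k)).mul
    (implements_t k (fun i => -(M i).mat 1 0))).mul (implements_S_inv k)).mul
    (implements_t k (fun i => (M i).right))).mul
    (implements_diag k (fun i => (M i).diagPart) (fun i => (M i).dil)
      (fun i => (M i).diagPart_mat))
  have e : (((((fun i => Mp2.t (M i).left) * fun _ => Mp2.S) * fun i => Mp2.t (-(M i).mat 1 0)) *
      fun _ => Mp2.S⁻¹) * fun i => Mp2.t (M i).right) * (fun i => (M i).diagPart) = M := by
    funext i
    exact (M i).unipotentPart_mul_diagPart
  rw [e] at h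
  simp only [Mp2.diagPart_phi] at h
  refine (congrArg (Implements k M) ?_).mp h
  have hne := sqrtIFactor_ne_zero k
  ext φ : 1
  simp only [neg_neg, weilOp, ContinuousLinearMap.comp_apply, smul_apply,
    map_smul, smul_smul]
  congr 1
  -- The constants √i of S and S⁻¹ cancel.
  rw [mul_inv_cancel₀ hne, one_mul]

/-- Both sides implement M N, so uniqueness replaces any computation with signs. -/
lemma weilOp_mul (k : Fin n → ℕ) (M N : Fin n → Mp2) (φ : 𝓢(Space k, ℂ)) :
    weilOp k (M * N) φ = weilOp k N (weilOp k M φ) :=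
  (implements_weilOp k (M * N)).unique ((implements_weilOp k M).mul (implements_weilOp k N)) φ

/-! ### Values of the Weil representation on generators and on Gaussians, and equivariance of θ. -/

lemma weilOp_t (k : Fin n → ℕ) (b : Fin n → ℝ) (φ : 𝓢(Space k, ℂ)) (x : Space k) :
    weilOp k (fun i => Mp2.t (b i)) φ x =
      Complex.exp (-(Real.pi * Complex.I * ∑ i, (b i : ℂ) * ((‖x i‖ ^ 2 : ℝ) : ℂ))) * φ x := by
  rw [(implements_weilOp k _).unique (implements_t k b), mulChirp_apply, chirp, quad]
  congr 2
  rw [← mul_neg, ← Finset.sum_neg_distrib]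
  congr 1
  refine Finset.sum_congr rfl fun i _ => ?_
  push_cast
  ring

lemma weilOp_rot (k : Fin n → ℕ) (a : Fin n → ℝ) (ha : ∀ i, 0 < a i) (φ : 𝓢(Space k, ℂ))
    (x : Space k) : weilOp k (fun i => Mp2.rot (a i) (ha i)) φ x =
      ((∏ i, (Real.sqrt (a i))⁻¹ ^ k i : ℝ) : ℂ) *
        φ (WithLp.toLp 2 (fun i => (a i)⁻¹ • x i)) := by
  rw [(implements_weilOp k _).unique (implements_diag k _
    (fun i => Units.mk0 (a i) (ha i).ne') (fun i => rfl))]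
  have e : scaleEquiv k (fun i => Units.mk0 (a i) (ha i).ne') x =
      WithLp.toLp 2 (fun i => (a i)⁻¹ • x i) := by
    ext i : 1
    rw [scaleEquiv_apply]
    rfl
  rw [← e, Complex.ofReal_prod]
  simp only [Complex.ofReal_pow]
  rfl

lemma weilOp_S (k : Fin n → ℕ) (φ : 𝓢(Space k, ℂ)) (x : Space k) :
    weilOp k (fun _ => Mp2.S) φ x =
      (∏ i, (Complex.I ^ (1 / 2 : ℂ)) ^ k i) * (𝓕 φ) (-x) := by
  rw [(implements_weilOp k _).unique (implements_S k)]
  rfl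

lemma weilOp_gaussian (k : Fin n → ℕ) (M : Fin n → Mp2) (τ : Fin n → ℍ) :
    weilOp k M (gaussian k (fun i => (M i).mat • τ i)) =
      (∏ i, (M i).phi (τ i) ^ k i) • gaussian k τ := by
  have h := (implements_weilOp k M).gauss τ 0
  have e : actLin k M τ 0 = 0 := by
    funext i j
    simp [actLin]
  rwa [e, gaussLin_zero, gaussLin_zero, jacobiFactor_zero] at h

lemma theta_slashDist (k : Fin n → ℕ) (μ : 𝓢'(Space k, ℂ)) (M : Fin n → Mp2) :
    theta k (slashDist k μ M) = slashFun k (theta k μ) M := by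
  funext τ
  -- The action on distributions involves M⁻¹; evaluating at Mτ brings the Gaussian at τ to the left
  -- side.
  have h := weilOp_gaussian k M⁻¹ (fun i => (M i).mat • τ i)
  have e : (fun i => (M⁻¹ i).mat • (M i).mat • τ i) = τ := by
    funext i
    simp
  rw [e] at h
  rw [theta, slashDist_apply, h, map_smul, smul_eq_mul, slashFun, theta,
    ← Finset.prod_inv_distrib]
  congr 1
  refine Finset.prod_congr rfl fun i _ => ?_
  rw [Pi.inv_apply, Mp2.inv_phi, inv_smul_smul, inv_pow]

lemma fourier_gaussian (k : Fin n → ℕ) (τ : Fin n → ℍ) :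
    𝓕 (gaussian k τ) = (autFactor k τ)⁻¹ • gaussian k (negInv τ) := by
  ext y
  rw [← gaussLin_zero, fourier_gaussLin_apply]
  change _ = (autFactor k τ)⁻¹ * gaussian k (negInv τ) y
  rw [gaussian_apply, quad, ← mul_neg, ← Finset.sum_neg_distrib]
  congr 3
  refine Finset.sum_congr rfl fun i _ => ?_
  rw [coe_negInv, sum_sq_coord, sqSum]
  simp [div_eq_mul_inv, mul_comm]

/-- By duality only the Fourier transform of a single Gaussian is needed. This matches the second
conditions in `Meas` and `FS`. -/
lemma theta_fourier (k : Fin n → ℕ) (μ : 𝓢'(Space k, ℂ)) :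
    theta k (𝓕 μ) = dualFun k (theta k μ) := by
  funext τ
  rw [theta, TemperedDistribution.fourier_apply, fourier_gaussian, map_smul, smul_eq_mul]
  rfl

/-! ### Surface measures of spheres -/

/-- The restriction of a linear isometry to the unit sphere. -/
def sphereMap {E : Type*} [NormedAddCommGroup E] [InnerProductSpace ℝ E] (U : E ≃ₗᵢ[ℝ] E)
    (y : Metric.sphere (0 : E) 1) : Metric.sphere (0 : E) 1 :=
  ⟨U y.1, by simp⟩

lemma continuous_sphereMap {E : Type*} [NormedAddCommGroup E] [InnerProductSpace ℝ E]
    (U : E ≃ₗᵢ[ℝ] E) : Continuous (sphereMap U) :=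
  (U.continuous.comp continuous_subtype_val).subtype_mk _

-- The measure `toSphere` is, up to a constant, the volume of the cone (0,1)·s; a linear isometry
-- commutes with forming cones and preserves volume.
open scoped Pointwise in
lemma toSphere_map_isometry {E : Type*} [NormedAddCommGroup E] [InnerProductSpace ℝ E]
    [FiniteDimensional ℝ E] [MeasurableSpace E] [BorelSpace E] (U : E ≃ₗᵢ[ℝ] E) :
    (volume : Measure E).toSphere.map (sphereMap U) = (volume : Measure E).toSphere := by
  ext s hs
  have hm := (continuous_sphereMap U).measurable
  rw [Measure.map_apply hm hs, Measure.toSphere_apply' _ (hm hs), Measure.toSphere_apply' _ hs]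
  congr 1
  have e : Set.Ioo (0 : ℝ) 1 • ((↑) '' (sphereMap U ⁻¹' s) : Set E) =
      U ⁻¹' (Set.Ioo (0 : ℝ) 1 • ((↑) '' s : Set E)) := by
    ext x
    simp only [Set.mem_smul, Set.mem_image, Set.mem_preimage]
    constructor
    · rintro ⟨r, hr, _, ⟨y, hy, rfl⟩, rfl⟩
      exact ⟨r, hr, U y.1, ⟨_, hy, rfl⟩, by simp⟩
    · rintro ⟨r, hr, _, ⟨y, hy, rfl⟩, h⟩
      refine ⟨r, hr, U.symm y.1, ⟨⟨U.symm y.1, by simp⟩, ?_, rfl⟩, ?_⟩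
      · have : sphereMap U ⟨U.symm y.1, by simp⟩ = y := Subtype.ext (by simp [sphereMap])
        rwa [this]
      · rw [← map_smul, h, LinearIsometryEquiv.symm_apply_apply]
  rw [e]
  exact U.measurePreserving.measure_preimage_equiv (f := U.toHomeomorph.toMeasurableEquiv) _

lemma continuous_sphere_smul (m : ℕ) (r : ℝ) : Continuous
    (fun y : Metric.sphere (0 : EuclideanSpace ℝ (Fin m)) 1 => r • y.1) :=
  continuous_subtype_val.const_smul r

instance isFiniteMeasure_sphereMeasure (m : ℕ) (l : ℝ≥0) :
    IsFiniteMeasure (sphereMeasure m l) := by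
  unfold sphereMeasure
  split_ifs
  · infer_instance
  · exact Measure.smul_finite _ ENNReal.ofReal_ne_top

lemma sphereMeasure_map_isometry (m : ℕ) (l : ℝ≥0)
    (U : EuclideanSpace ℝ (Fin m) ≃ₗᵢ[ℝ] EuclideanSpace ℝ (Fin m)) :
    (sphereMeasure m l).map U = sphereMeasure m l := by
  unfold sphereMeasure
  split_ifs
  · rw [Measure.map_dirac' U.continuous.measurable, map_zero]
  · have hm := (continuous_sphere_smul m (Real.sqrt l)).measurable
    rw [Measure.map_smul, Measure.map_map U.continuous.measurable hm]
    conv_rhs => rw [← toSphere_map_isometry U]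
    rw [Measure.map_map hm (continuous_sphereMap U).measurable]
    congr 2
    funext y
    simp [sphereMap]

lemma ae_sphereMeasure (m : ℕ) (l : ℝ≥0) : ∀ᵐ x ∂(sphereMeasure m l), ‖x‖ ^ 2 = (l : ℝ) := by
  have hmeas : MeasurableSet {x : EuclideanSpace ℝ (Fin m) | ‖x‖ ^ 2 = (l : ℝ)} :=
    (isClosed_eq (by fun_prop) continuous_const).measurableSet
  unfold sphereMeasure
  split_ifs with h
  · rw [ae_dirac_iff hmeas]
    simp [h]
  · refine Measure.ae_smul_measure ?_ _
    rw [ae_map_iff (continuous_sphere_smul m _).measurable.aemeasurable hmeas]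
    refine Filter.Eventually.of_forall fun y => ?_
    have hy : ‖y.1‖ = 1 := by simp
    rw [norm_smul, hy, mul_one, Real.norm_eq_abs, sq_abs, Real.sq_sqrt l.coe_nonneg]

/-- Dimension zero is excluded because there a sphere of positive radius is empty. -/
lemma sphereMeasure_univ_ne_zero {m : ℕ} (hm : 0 < m) (l : ℝ≥0) :
    sphereMeasure m l Set.univ ≠ 0 := by
  unfold sphereMeasure
  split_ifs with h
  · simp
  · have : Nonempty (Fin m) := ⟨⟨0, hm⟩⟩
    have hl : 0 < Real.sqrt l := Real.sqrt_pos.mpr (by exact_mod_cast pos_iff_ne_zero.mpr h)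
    rw [Measure.smul_apply, Measure.map_apply (continuous_sphere_smul m _).measurable .univ,
      Set.preimage_univ, smul_eq_mul]
    refine mul_ne_zero ?_ ?_
    · rw [ne_eq, ENNReal.ofReal_eq_zero, not_le]
      positivity
    · rw [ne_eq, Measure.measure_univ_eq_zero]
      exact Measure.toSphere_ne_zero _

/-! ### Products of spheres -/

lemma measurable_toLp_space (k : Fin n → ℕ) :
    Measurable (WithLp.toLp 2 : (∀ i, EuclideanSpace ℝ (Fin (k i))) → Space k) :=
  WithLp.measurable_toLp 2 _

instance isFiniteMeasure_polysphereMeasure (k : Fin n → ℕ) (l : Fin n → ℝ≥0) :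
    IsFiniteMeasure (polysphereMeasure k l) := by
  unfold polysphereMeasure
  infer_instance

lemma polysphereMeasure_univ_ne_zero {k : Fin n → ℕ} (hk : ∀ i, 0 < k i) (l : Fin n → ℝ≥0) :
    polysphereMeasure k l Set.univ ≠ 0 := by
  rw [polysphereMeasure, Measure.map_apply (measurable_toLp_space k) .univ, Set.preimage_univ,
    Measure.pi_univ]
  exact Finset.prod_ne_zero_iff.mpr fun i _ => sphereMeasure_univ_ne_zero (hk i) _

lemma polysphereVol_pos {k : Fin n → ℕ} (hk : ∀ i, 0 < k i) (l : Fin n → ℝ≥0) :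
    0 < polysphereVol k l :=
  ENNReal.toReal_pos (polysphereMeasure_univ_ne_zero hk l) (measure_ne_top _ _)

lemma ae_polysphereMeasure (k : Fin n → ℕ) (l : Fin n → ℝ≥0) :
    ∀ᵐ x ∂(polysphereMeasure k l), ∀ i, ‖x i‖ ^ 2 = (l i : ℝ) := by
  rw [ae_all_iff]
  intro i
  have hmeas : MeasurableSet {x : Space k | ‖x i‖ ^ 2 = (l i : ℝ)} :=
    (isClosed_eq (by fun_prop) continuous_const).measurableSet
  rw [polysphereMeasure, ae_map_iff (measurable_toLp_space k).aemeasurable hmeas]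
  exact (Measure.tendsto_eval_ae_ae (μ := fun i => sphereMeasure (k i) (l i)) (i := i)).eventually
    (ae_sphereMeasure (k i) (l i))

/-- Blockwise isometries of `ℝ^{k₁} × ⋯ × ℝ^{kₙ}`. -/
def blockIsometry (k : Fin n → ℕ)
    (U : ∀ i, EuclideanSpace ℝ (Fin (k i)) ≃ₗᵢ[ℝ] EuclideanSpace ℝ (Fin (k i))) :
    Space k ≃ₗᵢ[ℝ] Space k :=
  LinearIsometryEquiv.piLpCongrRight 2 U

lemma polysphereMeasure_map_blockIsometry (k : Fin n → ℕ) (l : Fin n → ℝ≥0)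
    (U : ∀ i, EuclideanSpace ℝ (Fin (k i)) ≃ₗᵢ[ℝ] EuclideanSpace ℝ (Fin (k i))) :
    (polysphereMeasure k l).map (blockIsometry k U) = polysphereMeasure k l := by
  have hU : ∀ i, Measurable (U i) := fun i => (U i).continuous.measurable
  have hpi : Measurable (fun (x : ∀ i, EuclideanSpace ℝ (Fin (k i))) i => U i (x i)) :=
    measurable_pi_iff.mpr fun i => (hU i).comp (measurable_pi_apply i)
  rw [polysphereMeasure, Measure.map_map (blockIsometry k U).continuous.measurable
    (measurable_toLp_space k)]
  have h : ∀ i, (sphereMeasure (k i) (l i)).map (U i) = sphereMeasure (k i) (l i) := fun i =>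
    sphereMeasure_map_isometry _ _ _
  have : ∀ i, SigmaFinite ((sphereMeasure (k i) (l i)).map (U i)) := fun i => by
    rw [h]
    infer_instance
  have h2 := Measure.pi_map_pi (μ := fun i => sphereMeasure (k i) (l i)) (f := fun i => U i)
    (fun i => (hU i).aemeasurable)
  simp only [h] at h2
  conv_rhs => rw [← h2]
  rw [Measure.map_map (measurable_toLp_space k) hpi]
  rfl

/-- The surface measure of a product of spheres, normalized to be a probability measure. -/
def polyProb (k : Fin n → ℕ) (l : Fin n → ℝ≥0) : Measure (Space k) :=
  (polysphereMeasure k l Set.univ)⁻¹ • polysphereMeasure k l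

lemma isProbabilityMeasure_polyProb {k : Fin n → ℕ} (hk : ∀ i, 0 < k i) (l : Fin n → ℝ≥0) :
    IsProbabilityMeasure (polyProb k l) := by
  refine ⟨?_⟩
  rw [polyProb, Measure.smul_apply, smul_eq_mul]
  exact ENNReal.inv_mul_cancel (polysphereMeasure_univ_ne_zero hk l) (measure_ne_top _ _)

/-- Passing to probability measures replaces the weights by the masses c·vol, which are the
quantities bounded in the growth condition and become the Fourier coefficients. -/
lemma integral_polysphereMeasure {k : Fin n → ℕ} (hk : ∀ i, 0 < k i) (l : Fin n → ℝ≥0)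
    (f : Space k → ℂ) :
    ∫ x, f x ∂(polysphereMeasure k l) = (polysphereVol k l : ℂ) * ∫ x, f x ∂(polyProb k l) := by
  have h := (polysphereVol_pos hk l).ne'
  rw [polyProb, integral_smul_measure, ENNReal.toReal_inv]
  change _ = (polysphereVol k l : ℂ) * ((polysphereVol k l)⁻¹ • _)
  rw [Complex.real_smul, ← mul_assoc, ← Complex.ofReal_mul, mul_inv_cancel₀ h, Complex.ofReal_one,
    one_mul]

lemma ae_polyProb (k : Fin n → ℕ) (l : Fin n → ℝ≥0) :
    ∀ᵐ x ∂(polyProb k l), ∀ i, ‖x i‖ ^ 2 = (l i : ℝ) :=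
  Measure.ae_smul_measure (ae_polysphereMeasure k l) _

lemma ae_norm_sq_polyProb (k : Fin n → ℕ) (l : Fin n → ℝ≥0) :
    ∀ᵐ x ∂(polyProb k l), ‖x‖ ^ 2 = ∑ i, (l i : ℝ) := by
  filter_upwards [ae_polyProb k l] with x hx
  rw [PiLp.norm_sq_eq_of_L2]
  exact Finset.sum_congr rfl fun i _ => hx i

lemma integral_polyProb_comp_blockIsometry (k : Fin n → ℕ) (l : Fin n → ℝ≥0)
    (U : ∀ i, EuclideanSpace ℝ (Fin (k i)) ≃ₗᵢ[ℝ] EuclideanSpace ℝ (Fin (k i)))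
    (f : Space k → ℂ) :
    ∫ x, f (blockIsometry k U x) ∂(polyProb k l) = ∫ x, f x ∂(polyProb k l) := by
  have h : (polyProb k l).map (blockIsometry k U) = polyProb k l := by
    rw [polyProb, Measure.map_smul, polysphereMeasure_map_blockIsometry]
  conv_rhs => rw [← h]
  exact ((blockIsometry k U).toHomeomorph.measurableEmbedding.integral_map f).symm

lemma integral_gaussian_polyProb {k : Fin n → ℕ} (hk : ∀ i, 0 < k i) (l : Fin n → ℝ≥0)
    (τ : Fin n → ℍ) : ∫ x, gaussian k τ x ∂(polyProb k l) = expo l τ := by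
  have := isProbabilityMeasure_polyProb hk l
  have h : ∀ᵐ x ∂(polyProb k l), gaussian k τ x = expo l τ := by
    filter_upwards [ae_polyProb k l] with x hx
    rw [gaussian_apply, expo, quad]
    congr 2
    refine Finset.sum_congr rfl fun i _ => ?_
    rw [hx i, mul_comm]
  rw [integral_congr_ae h]
  simp

lemma norm_integral_polyProb_le {k : Fin n → ℕ} (hk : ∀ i, 0 < k i) (l : Fin n → ℝ≥0)
    {f : Space k → ℂ} {C : ℝ} {M : ℕ} (hf : ∀ x, ‖f x‖ ≤ C * ((1 + ‖x‖ ^ 2) ^ M)⁻¹) :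
    ‖∫ x, f x ∂(polyProb k l)‖ ≤ C * ((1 + ∑ i, (l i : ℝ)) ^ M)⁻¹ := by
  have := isProbabilityMeasure_polyProb hk l
  have h : ∀ᵐ x ∂(polyProb k l), ‖f x‖ ≤ C * ((1 + ∑ i, (l i : ℝ)) ^ M)⁻¹ := by
    filter_upwards [ae_norm_sq_polyProb k l] with x hx
    rw [← hx]
    exact hf x
  simpa using norm_integral_le_of_norm_le_const h

/-! ### Summability -/

/-- The weight `(1 + |l|)^{-M}`. -/
def wt (l : Fin n → ℝ≥0) (M : ℕ) : ℝ := ((1 + ∑ i, (l i : ℝ)) ^ M)⁻¹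

lemma wt_nonneg (l : Fin n → ℝ≥0) (M : ℕ) : 0 ≤ wt l M := by
  have : 0 ≤ ∑ i, (l i : ℝ) := Finset.sum_nonneg fun i _ => (l i).2
  unfold wt
  positivity

/-- The terms are grouped into shells j ≤ |λ| < j + 1. A shell has mass at most C(2 + j)^N, and the
two extra powers in the weight leave a multiple of ∑ (j + 1)⁻². -/
lemma PolyGrowth.exists_summable {l : ℕ → Fin n → ℝ≥0} {c : ℕ → ℂ} (h : PolyGrowth l c) :
    ∃ M, Summable (fun m => ‖c m‖ * wt (l m) M) := by
  obtain ⟨C, N, hC⟩ := h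
  have hC0 : 0 ≤ C := by simpa using hC 0 ∅ (by simp)
  have hsum : Summable (fun j : ℕ => C * 2 ^ N * (1 / ((j : ℝ) + 1) ^ 2)) := by
    refine Summable.mul_left _ ?_
    have := (summable_nat_add_iff 1).mpr (Real.summable_one_div_nat_pow (p := 2).mpr one_lt_two)
    simpa using this
  refine ⟨N + 2, summable_of_sum_le (c := ∑' j : ℕ, C * 2 ^ N * (1 / ((j : ℝ) + 1) ^ 2))
    (fun m => mul_nonneg (norm_nonneg _) (wt_nonneg _ _)) fun s => ?_⟩
  let g : ℕ → ℕ := fun m => ⌊∑ i, l m i⌋₊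
  obtain ⟨J, hJ⟩ : ∃ J, ∀ m ∈ s, g m ∈ Finset.range J := by
    refine ⟨s.sup g + 1, fun m hm => Finset.mem_range.mpr (Nat.lt_succ_of_le (Finset.le_sup hm))⟩
  rw [← Finset.sum_fiberwise_of_maps_to hJ]
  refine le_trans (Finset.sum_le_sum fun j _ => ?_)
    (hsum.sum_le_tsum (Finset.range J) fun j _ => by positivity)
  have hfib : ∀ m ∈ s.filter (fun m => g m = j), ‖c m‖ * wt (l m) (N + 2) ≤
      ‖c m‖ * (((j : ℝ) + 1) ^ (N + 2))⁻¹ := by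
    intro m hm
    have hj := (Finset.mem_filter.mp hm).2
    have h1 : ((j : ℕ) : ℝ≥0) ≤ ∑ i, l m i := by
      rw [← hj]
      exact Nat.floor_le zero_le
    have h2 : (j : ℝ) ≤ ∑ i, (l m i : ℝ) := by exact_mod_cast h1
    unfold wt
    gcongr ‖c m‖ * (?_ ^ (N + 2))⁻¹
    linarith
  refine (Finset.sum_le_sum hfib).trans ?_
  rw [← Finset.sum_mul]
  have h3 := hC ((j : ℝ≥0) + 1) (s.filter fun m => g m = j) (fun m hm => by
    have hj := (Finset.mem_filter.mp hm).2
    rw [← hj]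
    exact (Nat.lt_floor_add_one _).le)
  calc _ ≤ C * (1 + (((j : ℝ≥0) + 1 : ℝ≥0) : ℝ)) ^ N * (((j : ℝ) + 1) ^ (N + 2))⁻¹ := by gcongr
    _ ≤ C * (2 * ((j : ℝ) + 1)) ^ N * (((j : ℝ) + 1) ^ (N + 2))⁻¹ := by
        gcongr
        push_cast
        have : (0 : ℝ) ≤ j := Nat.cast_nonneg j
        linarith
    _ = _ := by
        have : (0 : ℝ) < (j : ℝ) + 1 := by positivity
        rw [mul_pow, pow_add]
        field_simp

lemma exists_exp_le_wt {a : ℝ} (ha : 0 < a) (M : ℕ) : ∃ B : ℝ, ∀ l : Fin n → ℝ≥0,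
    Real.exp (-(a * ∑ i, (l i : ℝ))) ≤ B * wt l M := by
  -- The bound is used at r = √t, with exponent 2M because 1 + t ≤ (1 + √t)².
  obtain ⟨B, hB⟩ := exists_gaussian_bound ha (2 * M)
  refine ⟨B, fun l => ?_⟩
  have h0 : 0 ≤ ∑ i, (l i : ℝ) := Finset.sum_nonneg fun i _ => (l i).2
  set t := ∑ i, (l i : ℝ) with ht
  have h1 := hB (Real.sqrt t) (Real.sqrt_nonneg _)
  rw [Real.sq_sqrt h0, pow_mul] at h1
  have h2 : 1 + t ≤ (1 + Real.sqrt t) ^ 2 := by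
    nlinarith [Real.sq_sqrt h0, Real.sqrt_nonneg t]
  rw [wt, ← ht, ← div_eq_mul_inv, le_div_iff₀ (by positivity), mul_comm]
  refine le_trans ?_ h1
  gcongr

/-! ### Expansions in sphere measures -/

lemma SchwartzMap.norm_le_inv_pow {E : Type*} [NormedAddCommGroup E] [NormedSpace ℝ E]
    (φ : 𝓢(E, ℂ)) (M : ℕ) (x : E) :
    ‖φ x‖ ≤ (2 ^ (2 * M) * (Finset.Iic (2 * M, 0)).sup (schwartzSeminormFamily ℂ E ℂ) φ) *
      ((1 + ‖x‖ ^ 2) ^ M)⁻¹ := by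
  have h := SchwartzMap.one_add_le_sup_seminorm_apply (𝕜 := ℂ) (m := (2 * M, 0)) le_rfl le_rfl φ x
  rw [norm_iteratedFDeriv_zero] at h
  have h1 : (1 + ‖x‖ ^ 2) ^ M ≤ (1 + ‖x‖) ^ (2 * M) := by
    rw [pow_mul]
    gcongr
    nlinarith [norm_nonneg x]
  rw [← div_eq_mul_inv, le_div_iff₀ (by positivity), mul_comm]
  exact (mul_le_mul_of_nonneg_right h1 (norm_nonneg _)).trans h

lemma norm_term_le {k : Fin n → ℕ} (hk : ∀ i, 0 < k i) (l : Fin n → ℝ≥0) (c : ℂ)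
    {f : Space k → ℂ} {C : ℝ} {M : ℕ} (hf : ∀ x, ‖f x‖ ≤ C * ((1 + ‖x‖ ^ 2) ^ M)⁻¹) :
    ‖c * ∫ x, f x ∂(polyProb k l)‖ ≤ C * (‖c‖ * wt l M) := by
  rw [norm_mul, mul_left_comm]
  exact mul_le_mul_of_nonneg_left (norm_integral_polyProb_le hk l hf) (norm_nonneg _)

lemma integrable_polyProb {k : Fin n → ℕ} (hk : ∀ i, 0 < k i) (l : Fin n → ℝ≥0)
    (φ : 𝓢(Space k, ℂ)) : Integrable (fun x => φ x) (polyProb k l) := by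
  have := isProbabilityMeasure_polyProb hk l
  exact Integrable.of_bound φ.continuous.aestronglyMeasurable _
    (Filter.Eventually.of_forall (φ.norm_le_seminorm ℂ))

/-- Polynomially growing weights define a tempered distribution. -/
lemma exists_sphereDist {k : Fin n → ℕ} (hk : ∀ i, 0 < k i) {l : ℕ → Fin n → ℝ≥0} {c : ℕ → ℂ}
    (hc : PolyGrowth l c) : ∃ μ : 𝓢'(Space k, ℂ), ∀ φ : 𝓢(Space k, ℂ),
      HasSum (fun m => c m * ∫ x, φ x ∂(polyProb k (l m))) (μ φ) := by
  obtain ⟨M, hM⟩ := hc.exists_summable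
  -- A seminorm of φ times a summable sequence: this gives both convergence and continuity of the
  -- functional.
  have hb : ∀ (φ : 𝓢(Space k, ℂ)) (m : ℕ), ‖c m * ∫ x, φ x ∂(polyProb k (l m))‖ ≤
      (2 ^ (2 * M) * (Finset.Iic (2 * M, 0)).sup (schwartzSeminormFamily ℂ (Space k) ℂ) φ) *
        (‖c m‖ * wt (l m) M) := fun φ m =>
    norm_term_le hk _ _ (SchwartzMap.norm_le_inv_pow φ M)
  have hs : ∀ φ : 𝓢(Space k, ℂ), Summable (fun m => c m * ∫ x, φ x ∂(polyProb k (l m))) :=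
    fun φ => Summable.of_norm_bounded (hM.mul_left _) (hb φ)
  let A : 𝓢(Space k, ℂ) →L[ℂ] ℂ := SchwartzMap.mkCLMtoNormedSpace
    (fun φ => ∑' m, c m * ∫ x, φ x ∂(polyProb k (l m)))
    (fun φ ψ => by
      rw [← (hs φ).tsum_add (hs ψ)]
      congr 1
      funext m
      rw [← mul_add, ← integral_add (integrable_polyProb hk _ φ) (integrable_polyProb hk _ ψ)]
      rfl)
    (fun a φ => by
      rw [RingHom.id_apply, smul_eq_mul, ← tsum_mul_left]
      congr 1
      funext m
      have e : ∫ x, (a • φ) x ∂(polyProb k (l m)) = a * ∫ x, φ x ∂(polyProb k (l m)) :=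
        integral_const_mul a _
      rw [e]
      ring)
    ⟨Finset.Iic (2 * M, 0), 2 ^ (2 * M) * ∑' m, ‖c m‖ * wt (l m) M,
      mul_nonneg (by positivity)
        (tsum_nonneg fun m => mul_nonneg (norm_nonneg _) (wt_nonneg _ _)), fun φ => by
      have h := tsum_of_norm_bounded (hM.mul_left
        (2 ^ (2 * M) * (Finset.Iic (2 * M, 0)).sup (schwartzSeminormFamily ℂ (Space k) ℂ) φ)).hasSum
        (hb φ)
      rw [tsum_mul_left] at h
      exact h.trans (le_of_eq (by ring))⟩
  exact ⟨ContinuousLinearMap.toPointwiseConvergenceCLM _ _ _ _ A, fun φ => (hs φ).hasSum⟩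

lemma IsSphereExpansion.hasSum_polyProb {k : Fin n → ℕ} (hk : ∀ i, 0 < k i)
    {l : ℕ → Fin n → ℝ≥0} {c : ℕ → ℂ} {μ : 𝓢'(Space k, ℂ)} (h : IsSphereExpansion k l c μ)
    (φ : 𝓢(Space k, ℂ)) :
    HasSum (fun m => (c m * (polysphereVol k (l m) : ℂ)) * ∫ x, φ x ∂(polyProb k (l m)))
      (μ φ) := by
  have := h.hasSum φ
  simpa only [integral_polysphereMeasure hk, ← mul_assoc] using this

lemma isSphereExpansion_of_hasSum_polyProb {k : Fin n → ℕ} (hk : ∀ i, 0 < k i)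
    {l : ℕ → Fin n → ℝ≥0} {c : ℕ → ℂ} {μ : 𝓢'(Space k, ℂ)} (hl : IsLocallyFiniteSeq l)
    (hc : PolyGrowth l c)
    (h : ∀ φ : 𝓢(Space k, ℂ), HasSum (fun m => c m * ∫ x, φ x ∂(polyProb k (l m))) (μ φ)) :
    IsSphereExpansion k l (fun m => c m / (polysphereVol k (l m) : ℂ)) μ := by
  have hv : ∀ m, (polysphereVol k (l m) : ℂ) ≠ 0 := fun m => by
    exact_mod_cast (polysphereVol_pos hk (l m)).ne'
  have e : ∀ m, c m / (polysphereVol k (l m) : ℂ) * (polysphereVol k (l m) : ℂ) = c m :=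
    fun m => div_mul_cancel₀ _ (hv m)
  refine ⟨hl, ?_, fun φ => ?_⟩
  · simpa only [e] using hc
  · simpa only [integral_polysphereMeasure hk, ← mul_assoc, e] using h φ

lemma isFourierExpansion_theta {k : Fin n → ℕ} (hk : ∀ i, 0 < k i)
    {l : ℕ → Fin n → ℝ≥0} {c : ℕ → ℂ} {μ : 𝓢'(Space k, ℂ)} (hl : IsLocallyFiniteSeq l)
    (hc : PolyGrowth l c)
    (h : ∀ φ : 𝓢(Space k, ℂ), HasSum (fun m => c m * ∫ x, φ x ∂(polyProb k (l m))) (μ φ)) :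
    IsFourierExpansion l c (theta k μ) := by
  refine ⟨hl, hc, fun τ => ?_⟩
  have := h (gaussian k τ)
  simp only [integral_gaussian_polyProb hk] at this
  exact this

/-! ### Holomorphy of Fourier series -/

/-- The linear form `z ↦ πi ∑ lᵢ zᵢ`. -/
def expoForm (l : Fin n → ℝ≥0) : (Fin n → ℂ) →L[ℂ] ℂ :=
  ∑ i, ((Real.pi : ℂ) * Complex.I * ((l i : ℝ) : ℂ)) • ContinuousLinearMap.proj i

lemma expoForm_apply (l : Fin n → ℝ≥0) (z : Fin n → ℂ) :
    expoForm l z = Real.pi * Complex.I * ∑ i, ((l i : ℝ) : ℂ) * z i := by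
  simp [expoForm, Finset.mul_sum, mul_assoc]

lemma norm_expoForm_le (l : Fin n → ℝ≥0) : ‖expoForm l‖ ≤ Real.pi * (1 + ∑ i, (l i : ℝ)) := by
  have h0 : 0 ≤ ∑ i, (l i : ℝ) := Finset.sum_nonneg fun i _ => (l i).2
  refine ContinuousLinearMap.opNorm_le_bound _ (by positivity) fun z => ?_
  rw [expoForm_apply, norm_mul]
  have h1 : ‖(Real.pi * Complex.I : ℂ)‖ = Real.pi := by simp [abs_of_pos Real.pi_pos]
  rw [h1, mul_assoc]
  refine mul_le_mul_of_nonneg_left ?_ Real.pi_pos.le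
  calc ‖∑ i, ((l i : ℝ) : ℂ) * z i‖ ≤ ∑ i, (l i : ℝ) * ‖z‖ := by
        refine (norm_sum_le _ _).trans (Finset.sum_le_sum fun i _ => ?_)
        rw [norm_mul, Complex.norm_real, Real.norm_eq_abs, abs_of_nonneg (l i).coe_nonneg]
        exact mul_le_mul_of_nonneg_left (norm_le_pi_norm z i) (l i).coe_nonneg
    _ ≤ (1 + ∑ i, (l i : ℝ)) * ‖z‖ := by
        rw [← Finset.sum_mul]
        gcongr
        linarith

lemma norm_exp_expoForm_le (l : Fin n → ℝ≥0) {δ : ℝ} {z : Fin n → ℂ} (hz : ∀ i, δ ≤ (z i).im) :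
    ‖Complex.exp (expoForm l z)‖ ≤ Real.exp (-(Real.pi * δ * ∑ i, (l i : ℝ))) := by
  rw [Complex.norm_exp]
  gcongr
  have e : expoForm l z = Complex.I * ((Real.pi : ℂ) * ∑ i, ((l i : ℝ) : ℂ) * z i) := by
    rw [expoForm_apply]
    ring
  rw [e, Complex.I_mul_re, Complex.im_ofReal_mul, Complex.im_sum, neg_le_neg_iff, mul_assoc,
    Finset.mul_sum]
  simp only [Complex.im_ofReal_mul]
  refine mul_le_mul_of_nonneg_left (Finset.sum_le_sum fun i _ => ?_) Real.pi_pos.le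
  rw [mul_comm]
  exact mul_le_mul_of_nonneg_left (hz i) (l i).coe_nonneg

/-- The series is differentiated termwise where all imaginary parts exceed δ; exponential decay
there beats the polynomial growth of the coefficients. -/
lemma IsFourierExpansion.isHolo {l : ℕ → Fin n → ℝ≥0} {c : ℕ → ℂ} {f : (Fin n → ℍ) → ℂ}
    (h : IsFourierExpansion l c f) : IsHolo f := by
  intro z₀ hz₀
  obtain ⟨δ, hδ, hδi⟩ : ∃ δ : ℝ, 0 < δ ∧ ∀ i, δ < (z₀ i).im := by
    obtain ⟨v, hv, hvi⟩ := exists_im_lower_bound (fun i => (⟨z₀ i, hz₀ i⟩ : ℍ))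
    exact ⟨v / 2, by positivity, fun i => (half_lt_self hv).trans_le (hvi i)⟩
  set s : Set (Fin n → ℂ) := {z | ∀ i, δ < (z i).im} with hs
  have hso : IsOpen s := by
    have : s = ⋂ i, {z : Fin n → ℂ | δ < (z i).im} := by
      ext z
      simp [hs]
    rw [this]
    exact isOpen_iInter_of_finite fun i =>
      isOpen_lt continuous_const (Complex.continuous_im.comp (continuous_apply i))
  have hsc : Convex ℝ s := by
    intro x hx y hy a b ha hb hab i
    have h1 := hx i
    have h2 := hy i
    simp only [Pi.add_apply, Pi.smul_apply, Complex.add_im, Complex.smul_im, smul_eq_mul]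
    rcases ha.eq_or_lt with h0 | h0
    · rw [← h0] at hab ⊢
      rw [zero_add] at hab
      rw [hab]
      simpa using h2
    · nlinarith
  obtain ⟨M, hM⟩ := h.growth.exists_summable
  -- The extra power M + 1 pays for the factor π(1 + |λ|) produced by differentiation.
  obtain ⟨B, hB⟩ := exists_exp_le_wt (n := n) (a := Real.pi * δ) (by positivity) (M + 1)
  have hbound : ∀ m, ∀ z ∈ s, ‖c m • Complex.exp (expoForm (l m) z) • expoForm (l m)‖ ≤
      Real.pi * B * (‖c m‖ * wt (l m) M) := by
    intro m z hz
    have h0 : 0 ≤ ∑ i, (l m i : ℝ) := Finset.sum_nonneg fun i _ => (l m i).2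
    rw [norm_smul, norm_smul]
    calc _ ≤ ‖c m‖ * ((B * wt (l m) (M + 1)) * (Real.pi * (1 + ∑ i, (l m i : ℝ)))) := by
          gcongr
          · exact (norm_nonneg _).trans ((norm_exp_expoForm_le (l m) fun i => (hz i).le).trans
              (hB _))
          · exact (norm_exp_expoForm_le (l m) fun i => (hz i).le).trans (hB _)
          · exact norm_expoForm_le _
      _ = _ := by
          unfold wt
          rw [pow_succ]
          field_simp
  have hval : ∀ z ∈ s, HasSum (fun m => c m * Complex.exp (expoForm (l m) z))
      (f (fun i => UpperHalfPlane.ofComplex (z i))) := by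
    intro z hz
    have h1 := h.hasSum (fun i => UpperHalfPlane.ofComplex (z i))
    refine (congrArg (fun u => HasSum u _) ?_).mpr h1
    funext m
    rw [expo, expoForm_apply]
    congr 3
    refine Finset.sum_congr rfl fun i _ => ?_
    rw [UpperHalfPlane.ofComplex_apply_of_im_pos (hδ.trans (hz i))]
  have hd := hasFDerivAt_tsum_of_isPreconnected (𝕜 := ℂ)
    (f := fun m z => c m * Complex.exp (expoForm (l m) z))
    (f' := fun m z => c m • Complex.exp (expoForm (l m) z) • expoForm (l m))
    (hM.mul_left (Real.pi * B)) hso hsc.isPreconnected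
    (fun m z _ => ((expoForm (l m)).hasFDerivAt.cexp).const_mul (c m)) hbound
    (x₀ := z₀) hδi (hval z₀ hδi).summable hδi
  refine (hd.differentiableAt.congr_of_eventuallyEq ?_).differentiableWithinAt
  filter_upwards [hso.mem_nhds hδi] with z hz
  exact (hval z hz).tsum_eq.symm

/-! ### Density of compactly supported functions -/

section Density

variable {E : Type*} [NormedAddCommGroup E] [InnerProductSpace ℝ E] [FiniteDimensional ℝ E]

/-- A smooth function with compact support that is `1` near the origin. -/
def cutoffBump (E : Type*) [NormedAddCommGroup E] [InnerProductSpace ℝ E]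
    [FiniteDimensional ℝ E] : ContDiffBump (0 : E) :=
  ⟨1, 2, one_pos, one_lt_two⟩

/-- The cutoff functions `x ↦ χ(x / (N + 1))`. -/
def cutoff (E : Type*) [NormedAddCommGroup E] [InnerProductSpace ℝ E]
    [FiniteDimensional ℝ E] (N : ℕ) (x : E) : ℂ :=
  ((cutoffBump E (((N : ℝ) + 1)⁻¹ • x) : ℝ) : ℂ)

/-- The function `x ↦ 1 - χ(x)`. -/
def coBump (E : Type*) [NormedAddCommGroup E] [InnerProductSpace ℝ E]
    [FiniteDimensional ℝ E] (x : E) : ℂ := 1 - ((cutoffBump E x : ℝ) : ℂ)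

lemma contDiff_cutoffBump : ContDiff ℝ ∞ (fun x : E => ((cutoffBump E x : ℝ) : ℂ)) :=
  Complex.ofRealCLM.contDiff.comp (cutoffBump E).contDiff

lemma contDiff_cutoff (N : ℕ) : ContDiff ℝ ∞ (cutoff E N) :=
  contDiff_cutoffBump.comp (contDiff_const_smul _)

lemma hasCompactSupport_cutoff (N : ℕ) : HasCompactSupport (cutoff E N) := by
  have h1 : HasCompactSupport (fun x : E => ((cutoffBump E x : ℝ) : ℂ)) :=
    (cutoffBump E).hasCompactSupport.comp_left (g := fun r : ℝ => (r : ℂ)) Complex.ofReal_zero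
  exact h1.comp_homeomorph (Homeomorph.smulOfNeZero (((N : ℝ) + 1)⁻¹)
    (inv_ne_zero (by positivity)))

lemma contDiff_coBump : ContDiff ℝ ∞ (coBump E) :=
  contDiff_const.sub contDiff_cutoffBump

lemma exists_bound_iteratedFDeriv_coBump (m : ℕ) :
    ∃ B : ℝ, ∀ x : E, ‖iteratedFDeriv ℝ m (coBump E) x‖ ≤ B := by
  have hs : HasCompactSupport (fun x : E => ((cutoffBump E x : ℝ) : ℂ)) :=
    (cutoffBump E).hasCompactSupport.comp_left (g := fun r : ℝ => (r : ℂ)) Complex.ofReal_zero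
  obtain ⟨B, hB⟩ := (hs.iteratedFDeriv (𝕜 := ℝ) m).exists_bound_of_continuous
    ((contDiff_cutoffBump (E := E)).continuous_iteratedFDeriv (m := m) (by exact_mod_cast le_top))
  obtain ⟨B', hB'⟩ : ∃ B' : ℝ, ∀ x : E, ‖iteratedFDeriv ℝ m (fun _ : E => (1 : ℂ)) x‖ ≤ B' := by
    refine ⟨1, fun x => ?_⟩
    rcases m.eq_zero_or_pos with rfl | hm
    · simp
    · rw [iteratedFDeriv_const_of_ne hm.ne']
      simp
  refine ⟨B' + B, fun x => ?_⟩
  have e : coBump E = (fun _ : E => (1 : ℂ)) - fun x : E => ((cutoffBump E x : ℝ) : ℂ) := rfl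
  rw [e, iteratedFDeriv_sub_apply contDiff_const.contDiffAt
    (contDiff_cutoffBump.contDiffAt.of_le (by exact_mod_cast le_top))]
  exact (norm_sub_le _ _).trans (add_le_add (hB' x) (hB x))

lemma norm_iteratedFDeriv_coBump_smul_le (m N : ℕ) {B : ℝ}
    (hB : ∀ x : E, ‖iteratedFDeriv ℝ m (coBump E) x‖ ≤ B) (x : E) :
    ‖iteratedFDeriv ℝ m (fun x : E => coBump E (((N : ℝ) + 1)⁻¹ • x)) x‖ ≤ B := by
  rw [iteratedFDeriv_comp_const_smul _ (contDiff_coBump.of_le (by exact_mod_cast le_top)), norm_smul,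
    norm_pow, norm_inv]
  have h1 : (1 : ℝ) ≤ ‖(N : ℝ) + 1‖ := by
    rw [Real.norm_of_nonneg (by positivity)]
    linarith [(Nat.cast_nonneg N : (0 : ℝ) ≤ N)]
  have h2 : (‖(N : ℝ) + 1‖⁻¹) ^ m ≤ 1 :=
    pow_le_one₀ (by positivity) (inv_le_one_of_one_le₀ h1)
  calc _ ≤ 1 * ‖iteratedFDeriv ℝ m (coBump E) (((N : ℝ) + 1)⁻¹ • x)‖ := by gcongr
    _ ≤ B := by simpa using hB _

lemma cutoff_hasTemperateGrowth (N : ℕ) : (cutoff E N).HasTemperateGrowth :=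
  ((hasCompactSupport_cutoff N).toSchwartzMap (contDiff_cutoff N)).hasTemperateGrowth

/-- The truncation of a Schwartz function. -/
def truncate (N : ℕ) (φ : 𝓢(E, ℂ)) : 𝓢(E, ℂ) := SchwartzMap.smulLeftCLM ℂ (cutoff E N) φ

lemma truncate_apply (N : ℕ) (φ : 𝓢(E, ℂ)) (x : E) : truncate N φ x = cutoff E N x * φ x := by
  rw [truncate, SchwartzMap.smulLeftCLM_apply_apply (cutoff_hasTemperateGrowth N), smul_eq_mul]

/-- The function 1 - χ(x/(N+1)) vanishes for ‖x‖ < N + 1. Outside, the factor ‖x‖/(N+1) ≥ 1 can be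
inserted, trading one power of ‖x‖ for the decay in N. -/
lemma seminorm_truncate_sub_le (φ : 𝓢(E, ℂ)) (p m : ℕ) : ∃ A : ℝ, ∀ N : ℕ,
    SchwartzMap.seminorm ℂ p m (φ - truncate N φ) ≤ A * ((N : ℝ) + 1)⁻¹ := by
  choose B hB using fun i => exists_bound_iteratedFDeriv_coBump (E := E) i
  have hB0 : ∀ i, 0 ≤ B i := fun i => (norm_nonneg _).trans (hB i 0)
  refine ⟨∑ i ∈ Finset.range (m + 1), (m.choose i : ℝ) * B i *
    SchwartzMap.seminorm ℂ (p + 1) (m - i) φ, fun N => ?_⟩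
  have hN : (0 : ℝ) < (N : ℝ) + 1 := by positivity
  have hA : 0 ≤ ∑ i ∈ Finset.range (m + 1), (m.choose i : ℝ) * B i *
      SchwartzMap.seminorm ℂ (p + 1) (m - i) φ :=
    Finset.sum_nonneg fun i _ => mul_nonneg (mul_nonneg (Nat.cast_nonneg _) (hB0 i))
      (apply_nonneg _ _)
  have hfun : ⇑(φ - truncate N φ) = fun x => coBump E (((N : ℝ) + 1)⁻¹ • x) * φ x := by
    funext x
    rw [sub_apply, truncate_apply, coBump, sub_mul, one_mul]
    rfl
  refine SchwartzMap.seminorm_le_bound ℂ p m _ (mul_nonneg hA (inv_nonneg.mpr hN.le)) fun x => ?_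
  rw [hfun]
  rcases lt_or_ge ‖x‖ ((N : ℝ) + 1) with hx | hx
  · have h0 : (fun x => coBump E (((N : ℝ) + 1)⁻¹ • x) * φ x) =ᶠ[nhds x] fun _ => 0 := by
      filter_upwards [(isOpen_lt continuous_norm continuous_const).mem_nhds hx] with y hy
      have h1 : cutoffBump E (((N : ℝ) + 1)⁻¹ • y) = 1 := by
        refine (cutoffBump E).one_of_mem_closedBall ?_
        rw [mem_closedBall_zero_iff, norm_smul, norm_inv, Real.norm_of_nonneg hN.le,
          inv_mul_le_iff₀ hN, show (cutoffBump E).rIn = 1 from rfl, mul_one]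
        exact le_of_lt hy
      rw [coBump, h1]
      simp
    rw [(h0.iteratedFDeriv ℝ m).eq_of_nhds]
    have h2 : iteratedFDeriv ℝ m (fun _ : E => (0 : ℂ)) x = 0 := by
      rw [iteratedFDeriv_fun_zero]
      rfl
    rw [h2, norm_zero, mul_zero]
    exact mul_nonneg hA (inv_nonneg.mpr hN.le)
  · have hcb : ContDiff ℝ ∞ (fun x : E => coBump E (((N : ℝ) + 1)⁻¹ • x)) :=
      contDiff_coBump.comp (contDiff_const_smul _)
    have h1 := norm_iteratedFDeriv_mul_le hcb (φ.smooth ⊤) x (n := m) (by exact_mod_cast le_top)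
    have h2 : ‖x‖ ^ p ≤ ‖x‖ ^ (p + 1) * ((N : ℝ) + 1)⁻¹ := by
      rw [← div_eq_mul_inv, le_div_iff₀ hN, pow_succ]
      gcongr
    calc ‖x‖ ^ p * _ ≤ (‖x‖ ^ (p + 1) * ((N : ℝ) + 1)⁻¹) * _ := by gcongr
      _ ≤ (‖x‖ ^ (p + 1) * ((N : ℝ) + 1)⁻¹) * ∑ i ∈ Finset.range (m + 1),
          (m.choose i : ℝ) * B i * ‖iteratedFDeriv ℝ (m - i) φ x‖ := by
          refine mul_le_mul_of_nonneg_left (h1.trans (Finset.sum_le_sum fun i _ => ?_))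
            (by positivity)
          gcongr
          exact norm_iteratedFDeriv_coBump_smul_le i N (hB i) x
      _ = (∑ i ∈ Finset.range (m + 1), (m.choose i : ℝ) * B i *
            (‖x‖ ^ (p + 1) * ‖iteratedFDeriv ℝ (m - i) φ x‖)) * ((N : ℝ) + 1)⁻¹ := by
          rw [Finset.mul_sum, Finset.sum_mul]
          exact Finset.sum_congr rfl fun i _ => by ring
      _ ≤ _ := by
          gcongr with i
          · exact mul_nonneg (Nat.cast_nonneg _) (hB0 i)
          · exact φ.le_seminorm ℂ (p + 1) (m - i) x

lemma tendsto_truncate (φ : 𝓢(E, ℂ)) :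
    Filter.Tendsto (fun N => truncate N φ) Filter.atTop (nhds φ) := by
  rw [(schwartz_withSeminorms ℂ E ℂ).tendsto_nhds]
  rintro ⟨p, m⟩ ε hε
  obtain ⟨A, hA⟩ := seminorm_truncate_sub_le φ p m
  have h : Filter.Tendsto (fun N : ℕ => A * ((N : ℝ) + 1)⁻¹) Filter.atTop (nhds 0) := by
    simpa using (tendsto_one_div_add_atTop_nhds_zero_nat (𝕜 := ℝ)).const_mul A
  filter_upwards [h.eventually (gt_mem_nhds hε)] with N hN
  rw [map_sub_rev]
  exact (hA N).trans_lt hN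

end Density

lemma hasCompactSupport_truncate {E : Type*} [NormedAddCommGroup E] [InnerProductSpace ℝ E]
    [FiniteDimensional ℝ E] (N : ℕ) (φ : 𝓢(E, ℂ)) : HasCompactSupport (truncate N φ) := by
  have e : ⇑(truncate N φ) = fun x => cutoff E N x * φ x := funext (truncate_apply N φ)
  rw [e]
  exact (hasCompactSupport_cutoff N).mul_right

/-- A tempered distribution that is killed by multiplication with a Gaussian vanishes. -/
lemma eq_zero_of_mulGaussian {k : Fin n → ℕ} {τ : Fin n → ℍ} {T : 𝓢'(Space k, ℂ)}
    (h : ∀ φ, T (mulGaussian k τ φ) = 0) : T = 0 := by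
  have key : ∀ N φ, T (truncate N φ) = 0 := by
    intro N φ
    -- A truncated function is compactly supported, so its quotient by the nowhere vanishing
    -- Gaussian is again Schwartz.
    have hsmooth : ContDiff ℝ ∞ (fun x => truncate N φ x * (gaussian k τ x)⁻¹) :=
      ((truncate N φ).smooth ⊤).mul (((gaussian k τ).smooth ⊤).inv (gaussian_ne_zero k τ))
    have hcs : HasCompactSupport (fun x => truncate N φ x * (gaussian k τ x)⁻¹) :=
      (hasCompactSupport_truncate N φ).mul_right
    have e : mulGaussian k τ (hcs.toSchwartzMap hsmooth) = truncate N φ := by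
      ext x
      rw [mulGaussian_apply, HasCompactSupport.toSchwartzMap_toFun, mul_left_comm,
        mul_inv_cancel₀ (gaussian_ne_zero k τ x), mul_one]
    rw [← e, h]
  ext φ
  have hc : Continuous (fun φ : 𝓢(Space k, ℂ) => T φ) := map_continuous T
  have h1 := (hc.tendsto φ).comp (tendsto_truncate φ)
  have h2 : (fun φ : 𝓢(Space k, ℂ) => T φ) ∘ (fun N => truncate N φ) = fun _ => 0 :=
    funext fun N => key N φ
  rw [h2] at h1
  exact tendsto_nhds_unique h1 tendsto_const_nhds

/-! ### Functions of the norms of the blocks -/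

/-- The point with blocks of norms `√sᵢ` in fixed directions. -/
def sectionPt {k : Fin n → ℕ} (hk : ∀ i, 0 < k i) (s : EuclideanSpace ℝ (Fin n)) : Space k :=
  WithLp.toLp 2 (fun i => Real.sqrt (s i) • EuclideanSpace.single (⟨0, hk i⟩ : Fin (k i)) (1 : ℝ))

lemma continuous_sectionPt {k : Fin n → ℕ} (hk : ∀ i, 0 < k i) :
    Continuous (sectionPt hk) := by
  refine (PiLp.continuous_toLp 2 _).comp (continuous_pi fun i => ?_)
  exact (Real.continuous_sqrt.comp (by fun_prop)).smul continuous_const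

/-- The squares of the norms of the blocks. -/
def blockSq (k : Fin n → ℕ) (v : Space k) : EuclideanSpace ℝ (Fin n) :=
  WithLp.toLp 2 (fun i => ‖v i‖ ^ 2)

lemma continuous_blockSq (k : Fin n → ℕ) : Continuous (blockSq k) := by
  refine (PiLp.continuous_toLp 2 _).comp (continuous_pi fun i => ?_)
  fun_prop

lemma norm_sectionPt_blockSq {k : Fin n → ℕ} (hk : ∀ i, 0 < k i) (v : Space k) (i : Fin n) :
    ‖sectionPt hk (blockSq k v) i‖ = ‖v i‖ := by
  have h : sectionPt hk (blockSq k v) i =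
      Real.sqrt (‖v i‖ ^ 2) • EuclideanSpace.single (⟨0, hk i⟩ : Fin (k i)) (1 : ℝ) := rfl
  rw [h, Real.sqrt_sq (norm_nonneg _), norm_smul]
  simp

lemma norm_chirp (k : Fin n → ℕ) (t : Fin n → ℝ) (v : Space k) : ‖chirp k t v‖ = 1 := by
  rw [chirp, Complex.norm_exp, quad_re]
  simp

lemma continuous_chirp (k : Fin n → ℕ) (t : Fin n → ℝ) : Continuous (chirp k t) :=
  (chirp_hasTemperateGrowth k t).1.continuous

/-- The character exp(i⟨t, (|vᵢ|²)⟩) is the chirp with parameter t/π. -/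
lemma charFun_map_blockSq (k : Fin n → ℕ) (r : Space k → ℝ) (hr : Measurable r)
    (t : EuclideanSpace ℝ (Fin n)) :
    charFun ((volume.withDensity (fun v => ENNReal.ofReal (r v))).map (blockSq k)) t =
      ∫ v, ((max (r v) 0 : ℝ) : ℂ) * chirp k (fun i => t i / Real.pi) v := by
  have hq := (continuous_blockSq k).measurable
  have hexp : Continuous (fun x : EuclideanSpace ℝ (Fin n) =>
      Complex.exp (((inner ℝ x t : ℝ) : ℂ) * Complex.I)) := by fun_prop
  rw [charFun_apply, integral_map hq.aemeasurable hexp.aestronglyMeasurable,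
    integral_withDensity_eq_integral_toReal_smul hr.ennreal_ofReal
      (Filter.Eventually.of_forall fun _ => ENNReal.ofReal_lt_top)]
  congr 1
  funext v
  rw [ENNReal.toReal_ofReal', Complex.real_smul]
  congr 1
  rw [chirp, quad]
  congr 1
  simp only [blockSq, PiLp.inner_apply, RCLike.inner_apply, conj_trivial]
  push_cast
  rw [Finset.mul_sum, Finset.sum_mul]
  refine Finset.sum_congr rfl fun i _ => ?_
  have hpi : (Real.pi : ℂ) ≠ 0 := by exact_mod_cast Real.pi_ne_zero
  field_simp

/-- The measures r⁺dv and r⁻dv have pushforwards under v ↦ (|vᵢ|²) with equal characteristic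
functions, so these pushforwards coincide. As r is block-radial, {r > 0} is a preimage under this
map; it is null for r⁻dv, hence for r⁺dv. -/
lemma nonpos_of_integral_chirp_mul {k : Fin n → ℕ} (hk : ∀ i, 0 < k i) {r : Space k → ℝ}
    (hc : Continuous r) (hi : Integrable r)
    (hinv : ∀ v w : Space k, (∀ i, ‖v i‖ = ‖w i‖) → r v = r w)
    (h : ∀ t, ∫ v, chirp k t v * (r v : ℂ) = 0) (v : Space k) : r v ≤ 0 := by
  have hq := (continuous_blockSq k).measurable
  set μ₁ := (volume : Measure (Space k)).withDensity (fun v => ENNReal.ofReal (r v)) with hμ₁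
  set μ₂ := (volume : Measure (Space k)).withDensity (fun v => ENNReal.ofReal (-r v)) with hμ₂
  have hf₁ : IsFiniteMeasure μ₁ := isFiniteMeasure_withDensity_ofReal hi.2
  have hf₂ : IsFiniteMeasure μ₂ := isFiniteMeasure_withDensity_ofReal hi.neg.2
  have hint : ∀ (g : Space k → ℝ) (t : Fin n → ℝ), Integrable g →
      Integrable (fun v => ((max (g v) 0 : ℝ) : ℂ) * chirp k t v) := by
    intro g t hg
    refine (hg.pos_part.ofReal (𝕜 := ℂ)).mul_bdd (c := 1)
      (continuous_chirp k t).aestronglyMeasurable ?_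
    exact Filter.Eventually.of_forall fun v => (norm_chirp k t v).le
  have hmap : μ₁.map (blockSq k) = μ₂.map (blockSq k) := by
    refine Measure.ext_of_charFun (funext fun t => ?_)
    rw [charFun_map_blockSq k r hc.measurable, charFun_map_blockSq k (fun v => -r v)
      hc.measurable.neg, ← sub_eq_zero, ← integral_sub (hint r _ hi) (hint (fun v => -r v) _ hi.neg),
      ← h (fun i => t i / Real.pi)]
    congr 1
    funext v
    rw [← sub_mul, ← Complex.ofReal_sub, max_zero_sub_max_neg_zero_eq_self, mul_comm]
  -- The continuous section of the norm map exhibits {r > 0} as the preimage of a measurable set.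
  set A : Set (EuclideanSpace ℝ (Fin n)) := {s | 0 < r (sectionPt hk s)} with hA
  have hAm : MeasurableSet A :=
    (isOpen_lt continuous_const (hc.comp (continuous_sectionPt hk))).measurableSet
  have hP : blockSq k ⁻¹' A = {v | 0 < r v} := by
    ext w
    simp only [Set.mem_preimage, hA, Set.mem_ofPred_eq]
    rw [hinv _ w (norm_sectionPt_blockSq hk w)]
  have hPo : IsOpen {v | 0 < r v} := isOpen_lt continuous_const hc
  have h1 : μ₁ {v | 0 < r v} = μ₂ {v | 0 < r v} := by
    rw [← hP, ← Measure.map_apply hq hAm, ← Measure.map_apply hq hAm, hmap]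
  have h2 : μ₂ {v | 0 < r v} = 0 := by
    rw [hμ₂, withDensity_apply _ hPo.measurableSet]
    refine setLIntegral_eq_zero hPo.measurableSet fun w hw => ?_
    exact ENNReal.ofReal_eq_zero.mpr (by simpa using le_of_lt hw)
  rw [h2, hμ₁, withDensity_apply _ hPo.measurableSet,
    setLIntegral_eq_zero_iff hPo.measurableSet hc.measurable.ennreal_ofReal] at h1
  have h3 : volume {v | 0 < r v} = 0 := by
    refine measure_mono_null (fun w hw => ?_) h1
    simp only [Set.mem_compl_iff, Set.mem_ofPred_eq, not_forall]
    exact ⟨hw, fun h0 => absurd (ENNReal.ofReal_eq_zero.mp h0) (not_le.mpr hw)⟩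
  -- A null open set is empty: here continuity of r turns "almost everywhere" into "everywhere".
  rw [hPo.measure_eq_zero_iff (volume : Measure (Space k))] at h3
  by_contra hv
  have : v ∈ {v | 0 < r v} := not_le.mp hv
  rw [h3] at this
  exact this

lemma eq_zero_of_integral_chirp_mul_real {k : Fin n → ℕ} (hk : ∀ i, 0 < k i) {r : Space k → ℝ}
    (hc : Continuous r) (hi : Integrable r)
    (hinv : ∀ v w : Space k, (∀ i, ‖v i‖ = ‖w i‖) → r v = r w)
    (h : ∀ t, ∫ v, chirp k t v * (r v : ℂ) = 0) (v : Space k) : r v = 0 := by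
  refine le_antisymm (nonpos_of_integral_chirp_mul hk hc hi hinv h v) ?_
  have h2 := nonpos_of_integral_chirp_mul hk (r := fun v => -r v) hc.neg hi.neg
    (fun v w hvw => by rw [hinv v w hvw]) (fun t => by
      simp only [Complex.ofReal_neg, mul_neg]
      rw [integral_neg, h, neg_zero]) v
  linarith

/-- The chirp integral of the conjugate of u at t is the conjugate of that of u at -t, so the real
part of u inherits the vanishing. -/
lemma re_eq_zero_of_integral_chirp_mul {k : Fin n → ℕ} (hk : ∀ i, 0 < k i) {u : Space k → ℂ}
    (hc : Continuous u) (hi : Integrable u)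
    (hinv : ∀ v w : Space k, (∀ i, ‖v i‖ = ‖w i‖) → u v = u w)
    (h : ∀ t, ∫ v, chirp k t v * u v = 0) (v : Space k) : (u v).re = 0 := by
  have hstar : ∀ t v, starRingEnd ℂ (chirp k (fun i => -t i) v) = chirp k t v := by
    intro t v
    rw [chirp, chirp, ← Complex.exp_conj]
    congr 1
    simp only [quad, map_mul, map_sum, Complex.conj_ofReal, Complex.conj_I]
    push_cast
    simp [Finset.mul_sum]
  have hint : ∀ (t : Fin n → ℝ) (w : Space k → ℂ), Integrable w →
      Integrable (fun v => chirp k t v * w v) := fun t w hw =>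
    hw.bdd_mul (c := 1) (continuous_chirp k t).aestronglyMeasurable
      (Filter.Eventually.of_forall fun v => (norm_chirp k t v).le)
  have hi' : Integrable (fun v => starRingEnd ℂ (u v)) :=
    (LinearIsometryEquiv.integrable_comp_iff Complex.conjLIE).mpr hi
  refine eq_zero_of_integral_chirp_mul_real hk (r := fun v => (u v).re)
    (Complex.continuous_re.comp hc) hi.re (fun v w hvw => by rw [hinv v w hvw]) (fun t => ?_) v
  have e : ∀ v, chirp k t v * (((u v).re : ℝ) : ℂ) =
      (1 / 2 : ℂ) * (chirp k t v * u v + chirp k t v * starRingEnd ℂ (u v)) := by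
    intro v
    rw [Complex.re_eq_add_conj]
    ring
  simp_rw [e]
  rw [integral_const_mul, integral_add (hint t u hi) (hint t _ hi'), h t, zero_add]
  have e2 : ∀ v, chirp k t v * starRingEnd ℂ (u v) =
      starRingEnd ℂ (chirp k (fun i => -t i) v * u v) := fun v => by
    rw [map_mul, hstar]
  simp_rw [e2]
  rw [integral_conj, h, map_zero, mul_zero]

lemma eq_zero_of_integral_chirp_mul {k : Fin n → ℕ} (hk : ∀ i, 0 < k i) {u : Space k → ℂ}
    (hc : Continuous u) (hi : Integrable u)
    (hinv : ∀ v w : Space k, (∀ i, ‖v i‖ = ‖w i‖) → u v = u w)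
    (h : ∀ t, ∫ v, chirp k t v * u v = 0) (v : Space k) : u v = 0 := by
  refine Complex.ext (re_eq_zero_of_integral_chirp_mul hk hc hi hinv h v) ?_
  have := re_eq_zero_of_integral_chirp_mul hk (u := fun v => Complex.I * u v)
    (continuous_const.mul hc) (hi.const_mul _) (fun v w hvw => by rw [hinv v w hvw]) (fun t => by
      simp_rw [mul_left_comm _ Complex.I]
      rw [integral_const_mul, h, mul_zero]) v
  simpa using this

/-! ### Families of test functions -/

lemma inv_pow_one_add_norm_sq_le_one {E : Type*} [NormedAddCommGroup E] (M : ℕ) (x : E) :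
    ((1 + ‖x‖ ^ 2) ^ M)⁻¹ ≤ 1 :=
  inv_le_one_of_one_le₀ (one_le_pow₀ (by nlinarith [sq_nonneg ‖x‖]))

lemma SchwartzMap.integrable_norm_mul_pow {k : Fin n → ℕ} (ψ : 𝓢(Space k, ℂ)) (M : ℕ) :
    Integrable (fun v => ‖ψ v‖ * (1 + ‖v‖ ^ 2) ^ M) := by
  have h0 := ψ.integrable_pow_mul (volume : Measure (Space k)) 0
  have h1 := ψ.integrable_pow_mul (volume : Measure (Space k)) (2 * M)
  refine ((h0.add h1).const_mul (2 ^ (M - 1))).mono' (by fun_prop) ?_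
  refine Filter.Eventually.of_forall fun v => ?_
  rw [Real.norm_of_nonneg (by positivity)]
  have h := add_pow_le (zero_le_one' ℝ) (sq_nonneg ‖v‖) M
  simp only [Pi.add_apply, pow_zero, one_mul]
  calc ‖ψ v‖ * (1 + ‖v‖ ^ 2) ^ M ≤ ‖ψ v‖ * (2 ^ (M - 1) * (1 ^ M + (‖v‖ ^ 2) ^ M)) := by gcongr
    _ = _ := by rw [one_pow, ← pow_mul]; ring

/-- The integral of a family of test functions against a sphere measure is continuous. -/
lemma continuous_integral_polyProb {k : Fin n → ℕ} (hk : ∀ i, 0 < k i) (l : Fin n → ℝ≥0)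
    {K : Space k → Space k → ℂ} (hK : Continuous (fun p : Space k × Space k => K p.1 p.2)) {b : Space k → ℝ}
    (hb : Continuous b) (hb0 : ∀ v, 0 < b v) (hKb : ∀ v x, ‖K v x‖ ≤ b v) :
    Continuous (fun v => ∫ x, K v x ∂(polyProb k l)) := by
  have := isProbabilityMeasure_polyProb hk l
  have hbc : ∀ v, ((b v : ℝ) : ℂ) ≠ 0 := fun v => by exact_mod_cast (hb0 v).ne'
  -- Dividing by b(v) makes the constant 1 a dominating function uniformly in v.
  have h1 : Continuous (fun v => ∫ x, ((b v)⁻¹ : ℂ) * K v x ∂(polyProb k l)) := by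
    refine continuous_of_dominated (bound := fun _ => 1) (fun v => ?_) (fun v => ?_)
      (integrable_const _) ?_
    · exact (continuous_const.mul (hK.comp (Continuous.prodMk_right v))).aestronglyMeasurable
    · refine Filter.Eventually.of_forall fun x => ?_
      rw [norm_mul, norm_inv, Complex.norm_real, Real.norm_of_nonneg (hb0 v).le,
        inv_mul_le_one₀ (hb0 v)]
      exact hKb v x
    · exact Filter.Eventually.of_forall fun x =>
        ((Complex.continuous_ofReal.comp hb).inv₀ hbc).mul (hK.comp (Continuous.prodMk_left x))
  have h2 : Continuous (fun v => ((b v : ℝ) : ℂ) * ∫ x, ((b v)⁻¹ : ℂ) * K v x ∂(polyProb k l)) :=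
    (Complex.continuous_ofReal.comp hb).mul h1
  refine h2.congr fun v => ?_
  rw [integral_const_mul, mul_inv_cancel_left₀ (hbc v)]

section Family

variable {k : Fin n → ℕ} {l : ℕ → Fin n → ℝ≥0} {c : ℕ → ℂ} {M : ℕ} {μ : 𝓢'(Space k, ℂ)}
  {K : Space k → 𝓢(Space k, ℂ)} {b : Space k → ℝ}

lemma continuous_apply_family (hk : ∀ i, 0 < k i)
    (hM : Summable (fun m => ‖c m‖ * wt (l m) M))
    (h : ∀ φ : 𝓢(Space k, ℂ), HasSum (fun m => c m * ∫ x, φ x ∂(polyProb k (l m))) (μ φ))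
    (hK : Continuous (fun p : Space k × Space k => K p.1 p.2)) (hb : Continuous b)
    (hb0 : ∀ v, 0 < b v) (hKb : ∀ v x, ‖K v x‖ ≤ b v * ((1 + ‖x‖ ^ 2) ^ M)⁻¹) :
    Continuous (fun v => μ (K v)) := by
  have hKb' : ∀ v x, ‖K v x‖ ≤ b v := fun v x =>
    (hKb v x).trans (mul_le_of_le_one_right (hb0 v).le (inv_pow_one_add_norm_sq_le_one M x))
  have hbc : ∀ v, ((b v : ℝ) : ℂ) ≠ 0 := fun v => by exact_mod_cast (hb0 v).ne'
  have h1 : Continuous (fun v => ∑' m, ((b v)⁻¹ : ℂ) *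
      (c m * ∫ x, K v x ∂(polyProb k (l m)))) := by
    refine continuous_tsum (fun m => ?_) hM fun m v => ?_
    · exact ((Complex.continuous_ofReal.comp hb).inv₀ hbc).mul
        (continuous_const.mul (continuous_integral_polyProb hk (l m) (K := fun v x => K v x) hK hb hb0 hKb'))
    · rw [norm_mul, norm_inv, Complex.norm_real, Real.norm_of_nonneg (hb0 v).le,
        inv_mul_le_iff₀ (hb0 v)]
      exact norm_term_le hk (l m) (c m) (hKb v)
  have h2 : Continuous (fun v => ((b v : ℝ) : ℂ) * ∑' m, ((b v)⁻¹ : ℂ) *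
      (c m * ∫ x, K v x ∂(polyProb k (l m)))) := (Complex.continuous_ofReal.comp hb).mul h1
  refine h2.congr fun v => ?_
  rw [tsum_mul_left, (h (K v)).tsum_eq, mul_inv_cancel_left₀ (hbc v)]

lemma norm_apply_family_le (hk : ∀ i, 0 < k i)
    (hM : Summable (fun m => ‖c m‖ * wt (l m) M))
    (h : ∀ φ : 𝓢(Space k, ℂ), HasSum (fun m => c m * ∫ x, φ x ∂(polyProb k (l m))) (μ φ))
    (hKb : ∀ v x, ‖K v x‖ ≤ b v * ((1 + ‖x‖ ^ 2) ^ M)⁻¹) (v : Space k) :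
    ‖μ (K v)‖ ≤ b v * ∑' m, ‖c m‖ * wt (l m) M := by
  rw [← (h (K v)).tsum_eq, ← tsum_mul_left]
  exact tsum_of_norm_bounded (hM.mul_left (b v)).hasSum
    fun m => norm_term_le hk (l m) (c m) (hKb v)

/-- Two interchanges: the v-integral with the sum over m, by summability of the integrated norms,
and then with the sphere integral, by Fubini. -/
lemma integral_mul_apply_family (hk : ∀ i, 0 < k i)
    (hM : Summable (fun m => ‖c m‖ * wt (l m) M))
    (h : ∀ φ : 𝓢(Space k, ℂ), HasSum (fun m => c m * ∫ x, φ x ∂(polyProb k (l m))) (μ φ))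
    (hK : Continuous (fun p : Space k × Space k => K p.1 p.2)) (hb : Continuous b)
    (hb0 : ∀ v, 0 < b v) (hKb : ∀ v x, ‖K v x‖ ≤ b v * ((1 + ‖x‖ ^ 2) ^ M)⁻¹)
    {ψ φ : 𝓢(Space k, ℂ)} (hψ : Integrable (fun v => ‖ψ v‖ * b v))
    (hφ : ∀ x, φ x = ∫ v, ψ v * K v x) :
    ∫ v, ψ v * μ (K v) = μ φ := by
  have hKb' : ∀ v x, ‖K v x‖ ≤ b v := fun v x =>
    (hKb v x).trans (mul_le_of_le_one_right (hb0 v).le (inv_pow_one_add_norm_sq_le_one M x))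
  have hbd : ∀ m v, ‖ψ v * (c m * ∫ x, K v x ∂(polyProb k (l m)))‖ ≤
      ‖ψ v‖ * b v * (‖c m‖ * wt (l m) M) := fun m v => by
    rw [norm_mul, mul_assoc]
    exact mul_le_mul_of_nonneg_left (norm_term_le hk (l m) (c m) (hKb v)) (norm_nonneg _)
  have hint : ∀ m, Integrable (fun v => ψ v * (c m * ∫ x, K v x ∂(polyProb k (l m)))) := by
    intro m
    refine (hψ.mul_const (‖c m‖ * wt (l m) M)).mono' ?_ (Filter.Eventually.of_forall (hbd m))
    exact (ψ.continuous.mul (continuous_const.mul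
      (continuous_integral_polyProb hk (l m) (K := fun v x => K v x) hK hb hb0 hKb'))).aestronglyMeasurable
  have hsum : Summable (fun m => ∫ v, ‖ψ v * (c m * ∫ x, K v x ∂(polyProb k (l m)))‖) := by
    refine Summable.of_nonneg_of_le (fun m => integral_nonneg fun v => norm_nonneg _) (fun m => ?_)
      (hM.mul_left (∫ v, ‖ψ v‖ * b v))
    rw [← integral_mul_const]
    exact integral_mono (hint m).norm (hψ.mul_const _) (hbd m)
  have h1 := hasSum_integral_of_summable_integral_norm hint hsum
  have h2 : ∀ v, ∑' m, ψ v * (c m * ∫ x, K v x ∂(polyProb k (l m))) = ψ v * μ (K v) :=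
    fun v => by rw [tsum_mul_left, (h (K v)).tsum_eq]
  have h3 : ∀ m, ∫ v, ψ v * (c m * ∫ x, K v x ∂(polyProb k (l m))) =
      c m * ∫ x, φ x ∂(polyProb k (l m)) := by
    intro m
    have := isProbabilityMeasure_polyProb hk (l m)
    simp_rw [hφ, mul_left_comm _ (c m), ← integral_const_mul (ψ _)]
    rw [integral_const_mul, integral_integral_swap]
    refine (hψ.comp_fst (polyProb k (l m))).mono' ?_ (Filter.Eventually.of_forall fun p => ?_)
    · exact ((ψ.continuous.comp continuous_fst).mul hK).aestronglyMeasurable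
    · rw [Function.uncurry_apply_pair, norm_mul]
      exact mul_le_mul_of_nonneg_left (hKb' _ _) (norm_nonneg _)
  simp_rw [h2, h3] at h1
  exact h1.unique (h φ)

end Family

/-- The bound is required for every M because the growth of the weights dictates M. Its growth in v
is polynomial, so any Schwartz ψ absorbs it. -/
lemma apply_family {k : Fin n → ℕ} {l : ℕ → Fin n → ℝ≥0} {c : ℕ → ℂ} {μ : 𝓢'(Space k, ℂ)}
    {K : Space k → 𝓢(Space k, ℂ)} (hk : ∀ i, 0 < k i) (hc : PolyGrowth l c)
    (h : ∀ φ : 𝓢(Space k, ℂ), HasSum (fun m => c m * ∫ x, φ x ∂(polyProb k (l m))) (μ φ))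
    (hK : Continuous (fun p : Space k × Space k => K p.1 p.2))
    (hKb : ∀ M : ℕ, ∃ B : ℝ, 0 < B ∧ ∀ v x,
      ‖K v x‖ ≤ B * (1 + ‖v‖ ^ 2) ^ M * ((1 + ‖x‖ ^ 2) ^ M)⁻¹)
    {A : 𝓢(Space k, ℂ) → 𝓢(Space k, ℂ)} (hA : ∀ ψ x, A ψ x = ∫ v, ψ v * K v x) :
    Continuous (fun v => μ (K v)) ∧
      (∀ ψ : 𝓢(Space k, ℂ), Integrable (fun v => ψ v * μ (K v))) ∧
      ∀ ψ : 𝓢(Space k, ℂ), ∫ v, ψ v * μ (K v) = μ (A ψ) := by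
  obtain ⟨M, hM⟩ := hc.exists_summable
  obtain ⟨B, hB0, hB⟩ := hKb M
  have hb : Continuous (fun v : Space k => B * (1 + ‖v‖ ^ 2) ^ M) := by fun_prop
  have hb0 : ∀ v : Space k, 0 < B * (1 + ‖v‖ ^ 2) ^ M := fun v => by positivity
  have hcont := continuous_apply_family hk hM h hK hb hb0 hB
  have hint : ∀ ψ : 𝓢(Space k, ℂ), Integrable (fun v => ‖ψ v‖ * (B * (1 + ‖v‖ ^ 2) ^ M)) :=
    fun ψ => by
      simpa only [mul_left_comm] using (SchwartzMap.integrable_norm_mul_pow ψ M).const_mul B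
  refine ⟨hcont, fun ψ => ?_, fun ψ =>
    integral_mul_apply_family hk hM h hK hb hb0 hB (hint ψ) (hA ψ)⟩
  refine ((hint ψ).mul_const (∑' m, ‖c m‖ * wt (l m) M)).mono'
    (ψ.continuous.mul hcont).aestronglyMeasurable (Filter.Eventually.of_forall fun v => ?_)
  rw [norm_mul, mul_assoc]
  exact mul_le_mul_of_nonneg_left (norm_apply_family_le hk hM h hB v) (norm_nonneg _)

/-! ### Modulated Gaussians and their Fourier transforms -/

/-- The modulated Gaussian `x ↦ exp (-π |x|² + 2πi ⟨x, v⟩)`. -/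
def modGaussian (k : Fin n → ℕ) (v : Space k) : 𝓢(Space k, ℂ) := gaussLin k (ptI n) (toC k v)

lemma gaussian_ptI_apply (k : Fin n → ℕ) (x : Space k) :
    gaussian k (ptI n) x = ((Real.exp (-(Real.pi * ‖x‖ ^ 2)) : ℝ) : ℂ) := by
  rw [gaussian_apply, quad, PiLp.norm_sq_eq_of_L2]
  push_cast
  congr 1
  simp only [ptI, UpperHalfPlane.coe_I, ← Finset.mul_sum]
  linear_combination (Real.pi * ∑ i, (‖x i‖ : ℂ) ^ 2) * Complex.I_mul_I

lemma modGaussian_apply (k : Fin n → ℕ) (v x : Space k) :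
    modGaussian k v x = ((Real.exp (-(Real.pi * ‖x‖ ^ 2)) : ℝ) : ℂ) *
      Complex.exp (2 * Real.pi * Complex.I * ((inner ℝ x v : ℝ) : ℂ)) := by
  rw [modGaussian, gaussLin_toC_apply, gaussian_ptI_apply]

lemma autFactor_ptI (k : Fin n → ℕ) : autFactor k (ptI n) = 1 := by
  simp [autFactor, ptI]

lemma fourier_modGaussian_apply (k : Fin n → ℕ) (v x : Space k) :
    𝓕 (modGaussian k v) x = ((Real.exp (-(Real.pi * ‖x - v‖ ^ 2)) : ℝ) : ℂ) := by
  rw [modGaussian, fourier_gaussLin_apply, autFactor_ptI, inv_one, one_mul,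
    PiLp.norm_sq_eq_of_L2]
  push_cast
  congr 2
  rw [mul_assoc]
  congr 1
  rw [Finset.mul_sum]
  refine Finset.sum_congr rfl fun i _ => ?_
  have h := sum_sq_coord k (x - v) i
  push_cast at h
  rw [h, sqSum, ptI, UpperHalfPlane.coe_I, mul_div_cancel₀ _ Complex.I_ne_zero]
  refine Finset.sum_congr rfl fun j _ => ?_
  simp only [toC, PiLp.sub_apply]
  push_cast
  ring

lemma exists_gaussian_le {E : Type*} [NormedAddCommGroup E] (M : ℕ) : ∃ B : ℝ, 0 < B ∧ ∀ x : E,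
    Real.exp (-(Real.pi * ‖x‖ ^ 2)) ≤ B * ((1 + ‖x‖ ^ 2) ^ M)⁻¹ := by
  obtain ⟨B, hB⟩ := exists_gaussian_bound Real.pi_pos (2 * M)
  have hB0 : 0 < B := lt_of_lt_of_le (by simp) (hB 0 le_rfl)
  refine ⟨B, hB0, fun x => ?_⟩
  rw [← div_eq_mul_inv, le_div_iff₀ (by positivity), mul_comm]
  refine le_trans (mul_le_mul_of_nonneg_right ?_ (Real.exp_pos _).le) (hB ‖x‖ (norm_nonneg x))
  rw [pow_mul]
  gcongr
  nlinarith [norm_nonneg x]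

lemma exists_norm_modGaussian_le (k : Fin n → ℕ) (M : ℕ) : ∃ B : ℝ, 0 < B ∧ ∀ v x,
    ‖modGaussian k v x‖ ≤ B * (1 + ‖v‖ ^ 2) ^ M * ((1 + ‖x‖ ^ 2) ^ M)⁻¹ := by
  obtain ⟨B, hB0, hB⟩ := exists_gaussian_le (E := Space k) M
  refine ⟨B, hB0, fun v x => ?_⟩
  have h1 : ‖Complex.exp (2 * Real.pi * Complex.I * ((inner ℝ x v : ℝ) : ℂ))‖ = 1 := by
    rw [Complex.norm_exp]
    simp
  rw [modGaussian_apply, norm_mul, h1, mul_one, Complex.norm_real,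
    Real.norm_of_nonneg (Real.exp_pos _).le]
  refine (hB x).trans (mul_le_mul_of_nonneg_right (le_mul_of_one_le_right hB0.le ?_)
    (by positivity))
  exact one_le_pow₀ (by nlinarith [sq_nonneg ‖v‖])

lemma exists_norm_fourier_modGaussian_le (k : Fin n → ℕ) (M : ℕ) : ∃ B : ℝ, 0 < B ∧ ∀ v x,
    ‖𝓕 (modGaussian k v) x‖ ≤ B * (1 + ‖v‖ ^ 2) ^ M * ((1 + ‖x‖ ^ 2) ^ M)⁻¹ := by
  obtain ⟨B, hB0, hB⟩ := exists_gaussian_le (E := Space k) M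
  refine ⟨B * 2 ^ M, by positivity, fun v x => ?_⟩
  rw [fourier_modGaussian_apply, Complex.norm_real, Real.norm_of_nonneg (Real.exp_pos _).le]
  refine (hB (x - v)).trans ?_
  -- Peetre's inequality: decay around v becomes decay around the origin at polynomial cost in v.
  have h2 : 1 + ‖x‖ ^ 2 ≤ 2 * (1 + ‖v‖ ^ 2) * (1 + ‖x - v‖ ^ 2) := by
    have h3 : ‖x‖ ≤ ‖x - v‖ + ‖v‖ := by simpa using norm_add_le (x - v) v
    have h4 : ‖x‖ ^ 2 ≤ (‖x - v‖ + ‖v‖) ^ 2 := by gcongr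
    nlinarith [sq_nonneg (‖x - v‖ - ‖v‖), mul_nonneg (sq_nonneg ‖x - v‖) (sq_nonneg ‖v‖)]
  rw [mul_assoc, mul_assoc]
  refine mul_le_mul_of_nonneg_left ?_ hB0.le
  rw [← mul_assoc, ← mul_pow, ← div_eq_mul_inv, le_div_iff₀ (by positivity),
    inv_mul_le_iff₀ (by positivity), ← mul_pow]
  refine pow_le_pow_left₀ (by positivity) (h2.trans (le_of_eq (by ring))) M

lemma continuous_modGaussian (k : Fin n → ℕ) :
    Continuous (fun p : Space k × Space k => modGaussian k p.1 p.2) := by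
  simp only [modGaussian_apply]
  fun_prop

lemma continuous_fourier_modGaussian (k : Fin n → ℕ) :
    Continuous (fun p : Space k × Space k => 𝓕 (modGaussian k p.1) p.2) := by
  simp only [fourier_modGaussian_apply]
  fun_prop

lemma mulGaussian_fourierInv_apply (k : Fin n → ℕ) (ψ : 𝓢(Space k, ℂ)) (x : Space k) :
    mulGaussian k (ptI n) (𝓕⁻ ψ) x = ∫ v, ψ v * modGaussian k v x := by
  rw [mulGaussian_apply, SchwartzMap.fourierInv_coe, Real.fourierInv_eq', ← integral_const_mul]
  congr 1
  funext v
  rw [modGaussian, gaussLin_toC_apply, smul_eq_mul, real_inner_comm]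
  push_cast
  rw [mul_left_comm (ψ v), mul_comm (ψ v)]
  congr 3
  ring

lemma fourier_mulGaussian_fourierInv_apply (k : Fin n → ℕ) (ψ : 𝓢(Space k, ℂ)) (x : Space k) :
    𝓕 (mulGaussian k (ptI n) (𝓕⁻ ψ)) x = ∫ v, ψ v * 𝓕 (modGaussian k v) x := by
  rw [fourier_mulGaussian]
  -- The inverse transform is moved from ψ to the Gaussian, where it is explicit.
  have h := SchwartzMap.integral_fourierInv_mul_eq (gaussLin k (ptI n) (toC k (-x))) ψ
  rw [← h]
  congr 1
  funext v
  have e : (𝓕⁻ (gaussLin k (ptI n) (toC k (-x))) : 𝓢(Space k, ℂ)) v =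
      𝓕 (modGaussian k (-x)) (-v) := fourierInv_apply_neg k _ v
  rw [e, fourier_modGaussian_apply, fourier_modGaussian_apply, mul_comm]
  congr 5
  abel_nf

/-! ### Stability of pure Gaussians under Fourier inversion, products and chirps. -/

lemma fourierInv_gaussian (k : Fin n → ℕ) (τ : Fin n → ℍ) :
    (𝓕⁻ (gaussian k τ) : 𝓢(Space k, ℂ)) = (autFactor k τ)⁻¹ • gaussian k (negInv τ) := by
  rw [← fourier_gaussian]
  ext x
  rw [fourierInv_apply_neg, fourier_gaussian]
  simp [gaussian_apply, quad]

lemma mulGaussian_gaussian (k : Fin n → ℕ) (τ σ : Fin n → ℍ) :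
    ∃ ρ : Fin n → ℍ, mulGaussian k τ (gaussian k σ) = gaussian k ρ := by
  refine ⟨fun i => ⟨(τ i : ℂ) + σ i, add_pos (τ i).im_pos (σ i).im_pos⟩, ?_⟩
  ext x
  rw [mulGaussian_apply, gaussian_apply, gaussian_apply, gaussian_apply, ← Complex.exp_add,
    ← quad_add]

lemma exists_gaussian_eq_chirp_mul (k : Fin n → ℕ) (t : Fin n → ℝ) :
    ∃ ρ : Fin n → ℍ, ∀ v, gaussian k ρ v = chirp k t v * gaussian k (ptI n) v := by
  refine ⟨fun i => t i +ᵥ ptI n i, fun v => ?_⟩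
  rw [gaussian_apply, gaussian_apply, chirp, ← Complex.exp_add]
  simp only [UpperHalfPlane.coe_vadd, quad_add]

/-! ### Sphere expansions are determined by theta functions -/

/-- In each block, reflection in the hyperplane orthogonal to vᵢ - wᵢ exchanges two vectors of equal
norm. -/
lemma exists_blockIsometry {k : Fin n → ℕ} {v w : Space k} (h : ∀ i, ‖v i‖ = ‖w i‖) :
    ∃ U : ∀ i, EuclideanSpace ℝ (Fin (k i)) ≃ₗᵢ[ℝ] EuclideanSpace ℝ (Fin (k i)),
      blockIsometry k U v = w := by
  refine ⟨fun i => Submodule.reflection (ℝ ∙ (v i - w i))ᗮ, ?_⟩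
  ext i : 1
  exact Submodule.reflection_sub (h i)

lemma apply_eq_of_comp_blockIsometry {k : Fin n → ℕ} {l : ℕ → Fin n → ℝ≥0} {c : ℕ → ℂ}
    {μ : 𝓢'(Space k, ℂ)}
    (h : ∀ φ : 𝓢(Space k, ℂ), HasSum (fun m => c m * ∫ x, φ x ∂(polyProb k (l m))) (μ φ))
    (U : ∀ i, EuclideanSpace ℝ (Fin (k i)) ≃ₗᵢ[ℝ] EuclideanSpace ℝ (Fin (k i)))
    {φ ψ : 𝓢(Space k, ℂ)} (hφ : ∀ x, ψ (blockIsometry k U x) = φ x) : μ φ = μ ψ := by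
  refine (h φ).unique ?_
  have e : ∀ m, ∫ x, φ x ∂(polyProb k (l m)) = ∫ x, ψ x ∂(polyProb k (l m)) := fun m => by
    simp_rw [← hφ]
    exact integral_polyProb_comp_blockIsometry k (l m) U ψ
  simpa only [e] using h ψ

lemma modGaussian_blockIsometry (k : Fin n → ℕ)
    (U : ∀ i, EuclideanSpace ℝ (Fin (k i)) ≃ₗᵢ[ℝ] EuclideanSpace ℝ (Fin (k i)))
    (v x : Space k) :
    modGaussian k (blockIsometry k U v) (blockIsometry k U x) = modGaussian k v x := by
  rw [modGaussian_apply, modGaussian_apply, LinearIsometryEquiv.norm_map,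
    LinearIsometryEquiv.inner_map_map]

lemma fourier_modGaussian_blockIsometry (k : Fin n → ℕ)
    (U : ∀ i, EuclideanSpace ℝ (Fin (k i)) ≃ₗᵢ[ℝ] EuclideanSpace ℝ (Fin (k i)))
    (v x : Space k) :
    𝓕 (modGaussian k (blockIsometry k U v)) (blockIsometry k U x) = 𝓕 (modGaussian k v) x := by
  rw [fourier_modGaussian_apply, fourier_modGaussian_apply, ← map_sub,
    LinearIsometryEquiv.norm_map]

/-- If `μ` and `μ'` are sums of sphere measures, then `μ'` is the Fourier transform of `μ` as soon
as the theta functions of `μ'` and of the Fourier transform of `μ` agree. -/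
theorem fourier_eq_of_dualFun_theta_eq {k : Fin n → ℕ} (hk : ∀ i, 0 < k i)
    {l l' : ℕ → Fin n → ℝ≥0} {c c' : ℕ → ℂ} {μ μ' : 𝓢'(Space k, ℂ)}
    (hc : PolyGrowth l c) (hc' : PolyGrowth l' c')
    (h : ∀ φ : 𝓢(Space k, ℂ), HasSum (fun m => c m * ∫ x, φ x ∂(polyProb k (l m))) (μ φ))
    (h' : ∀ φ : 𝓢(Space k, ℂ), HasSum (fun m => c' m * ∫ x, φ x ∂(polyProb k (l' m))) (μ' φ))
    (hθ : dualFun k (theta k μ) = theta k μ') : 𝓕 μ = μ' := by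
  obtain ⟨hcont, hint, heq⟩ := apply_family (K := fun v => 𝓕 (modGaussian k v)) hk hc h
    (continuous_fourier_modGaussian k) (exists_norm_fourier_modGaussian_le k)
    (A := fun ψ => 𝓕 (mulGaussian k (ptI n) (𝓕⁻ ψ))) (fourier_mulGaussian_fourierInv_apply k)
  obtain ⟨hcont', hint', heq'⟩ := apply_family (K := modGaussian k) hk hc' h'
    (continuous_modGaussian k) (exists_norm_modGaussian_le k)
    (A := fun ψ => mulGaussian k (ptI n) (𝓕⁻ ψ)) (mulGaussian_fourierInv_apply k)
  set T : 𝓢'(Space k, ℂ) := 𝓕 μ - μ' with hT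
  have hTapp : ∀ φ, T φ = μ (𝓕 φ) - μ' φ := fun φ => by
    rw [hT, sub_apply, TemperedDistribution.fourier_apply]
  -- This is the hypothesis on theta functions, read through `theta_fourier`.
  have hTg : ∀ τ, T (gaussian k τ) = 0 := fun τ => by
    rw [← theta_fourier] at hθ
    have := congrFun hθ τ
    rw [hT, sub_apply, sub_eq_zero]
    exact this
  have hTcont : Continuous (fun v => T (modGaussian k v)) := by
    simp only [hTapp]
    exact hcont.sub hcont'
  have hTint : ∀ ψ : 𝓢(Space k, ℂ), Integrable (fun v => ψ v * T (modGaussian k v)) := by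
    intro ψ
    simp only [hTapp, mul_sub]
    exact (hint ψ).sub (hint' ψ)
  have hTeq : ∀ ψ : 𝓢(Space k, ℂ), ∫ v, ψ v * T (modGaussian k v) =
      T (mulGaussian k (ptI n) (𝓕⁻ ψ)) := by
    intro ψ
    simp only [hTapp, mul_sub]
    rw [integral_sub (hint ψ) (hint' ψ), heq, heq']
  -- Each of the two terms of T is invariant separately; for 𝓕 μ the isometry is carried through the
  -- Fourier transform of the modulated Gaussian.
  have hTinv : ∀ v w : Space k, (∀ i, ‖v i‖ = ‖w i‖) →
      T (modGaussian k v) = T (modGaussian k w) := by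
    intro v w hvw
    obtain ⟨U, rfl⟩ := exists_blockIsometry hvw
    rw [hTapp, hTapp, apply_eq_of_comp_blockIsometry h U (fourier_modGaussian_blockIsometry k U v),
      apply_eq_of_comp_blockIsometry h' U (modGaussian_blockIsometry k U v)]
  -- The Gaussian weight makes the function integrable, and its product with a chirp is the Gaussian
  -- at i + t.
  have hzero : ∀ v, gaussian k (ptI n) v * T (modGaussian k v) = 0 := by
    refine eq_zero_of_integral_chirp_mul hk ((gaussian k (ptI n)).continuous.mul hTcont)
      (hTint _) (fun v w hvw => ?_) (fun t => ?_)
    · have hn : ‖v‖ ^ 2 = ‖w‖ ^ 2 := by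
        rw [PiLp.norm_sq_eq_of_L2, PiLp.norm_sq_eq_of_L2]
        simp only [hvw]
      rw [hTinv v w hvw, gaussian_ptI_apply, gaussian_ptI_apply, hn]
    · obtain ⟨ρ, hρ⟩ := exists_gaussian_eq_chirp_mul k t
      simp_rw [← mul_assoc, ← hρ]
      obtain ⟨σ, hσ⟩ := mulGaussian_gaussian k (ptI n) (negInv ρ)
      -- With a Gaussian as ψ, the test function is a multiple of a pure Gaussian, which T kills.
      rw [hTeq, fourierInv_gaussian, map_smul, map_smul, hσ, hTg, smul_zero]
  refine sub_eq_zero.mp (eq_zero_of_mulGaussian (τ := ptI n) fun φ => ?_)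
  have hφ : (𝓕⁻ (𝓕 φ : 𝓢(Space k, ℂ)) : 𝓢(Space k, ℂ)) = φ :=
    FourierTransform.fourierInv_fourier_eq φ
  -- Choosing ψ = 𝓕 φ reaches every product of φ with the Gaussian.
  rw [← hT, ← hφ, ← hTeq]
  refine integral_eq_zero_of_ae (Filter.Eventually.of_forall fun v => ?_)
  have hv := (mul_eq_zero.mp (hzero v)).resolve_left (gaussian_ne_zero _ _ _)
  simp only [hv, mul_zero, Pi.zero_apply]

/-! ### The isomorphism between spherical measures and Fourier series -/

lemma IsSphereExpansion.isFourierExpansion_theta {k : Fin n → ℕ} (hk : ∀ i, 0 < k i)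
    {l : ℕ → Fin n → ℝ≥0} {c : ℕ → ℂ} {μ : 𝓢'(Space k, ℂ)} (h : IsSphereExpansion k l c μ) :
    IsFourierExpansion l (fun m => c m * (polysphereVol k (l m) : ℂ)) (theta k μ) :=
  SphericalMeasures.isFourierExpansion_theta hk h.locallyFinite h.growth (h.hasSum_polyProb hk)

lemma theta_add (k : Fin n → ℕ) (μ ν : 𝓢'(Space k, ℂ)) :
    theta k (μ + ν) = theta k μ + theta k ν := rfl

lemma theta_smul (k : Fin n → ℕ) (a : ℂ) (μ : 𝓢'(Space k, ℂ)) :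
    theta k (a • μ) = a • theta k μ := rfl

lemma eq_zero_of_fourier_eq_zero {k : Fin n → ℕ} {μ : 𝓢'(Space k, ℂ)} (h : 𝓕 μ = 0) : μ = 0 := by
  have e : (𝓕⁻ (𝓕 μ : 𝓢'(Space k, ℂ)) : 𝓢'(Space k, ℂ)) = μ :=
    FourierTransform.fourierInv_fourier_eq μ
  rw [← e, h, FourierTransform.fourierInv_zero]

variable [NeZero n] {k : Fin n → ℕ}

lemma theta_mem_FS (hk : ∀ i, 0 < k i) {μ : 𝓢'(Space k, ℂ)} (hμ : μ ∈ Meas k) :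
    theta k μ ∈ FS k := by
  obtain ⟨⟨l, c, h⟩, l', c', h'⟩ := hμ
  refine ⟨(h.isFourierExpansion_theta hk).isHolo, ⟨l, _, h.isFourierExpansion_theta hk⟩,
    l', fun m => c' m * (polysphereVol k (l' m) : ℂ), ?_⟩
  rw [← theta_fourier]
  exact h'.isFourierExpansion_theta hk

/-- The map `μ ↦ θ_μ` from spherical measures to Fourier series. -/
def thetaMap (hk : ∀ i, 0 < k i) : Meas k →ₗ[ℂ] FS k where
  toFun μ := ⟨theta k μ, theta_mem_FS hk μ.2⟩
  map_add' μ ν := Subtype.ext (theta_add k μ ν)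
  map_smul' a μ := Subtype.ext (theta_smul k a μ)

lemma thetaMap_injective (hk : ∀ i, 0 < k i) : Function.Injective (thetaMap (k := k) hk) := by
  refine (injective_iff_map_eq_zero _).mpr fun μ hμ => ?_
  obtain ⟨⟨l, c, h⟩, -⟩ := μ.2
  have hθ : theta k μ = 0 := congrArg Subtype.val hμ
  -- The comparison is with μ' = 0, expanded along the same sequence with zero weights.
  refine Subtype.ext (eq_zero_of_fourier_eq_zero (fourier_eq_of_dualFun_theta_eq hk h.growth
    (l' := l) (c' := fun _ => 0) (μ' := 0) ⟨0, 0, fun R s _ => by simp⟩ (h.hasSum_polyProb hk)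
    (fun φ => by simp) ?_))
  funext τ
  rw [dualFun, hθ]
  simp [theta]

/-- The measures with the coefficients of f and of its dual are Fourier transforms of each other by
the comparison theorem. Starting from an arbitrary expansion of f gives the inverse formula for
every expansion. -/
lemma exists_meas_of_isFourierExpansion (hk : ∀ i, 0 < k i) {f : (Fin n → ℍ) → ℂ} (hf : f ∈ FS k)
    {l : ℕ → Fin n → ℝ≥0} {c : ℕ → ℂ} (h : IsFourierExpansion l c f) :
    ∃ μ ∈ Meas k, theta k μ = f ∧
      IsSphereExpansion k l (fun m => c m / (polysphereVol k (l m) : ℂ)) μ := by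
  obtain ⟨-, -, l', c', h'⟩ := hf
  obtain ⟨μ, hμ⟩ := exists_sphereDist hk h.growth
  obtain ⟨μ', hμ'⟩ := exists_sphereDist hk h'.growth
  have hθ : theta k μ = f := funext fun τ =>
    ((isFourierExpansion_theta hk h.locallyFinite h.growth hμ).hasSum τ).unique (h.hasSum τ)
  have hθ' : theta k μ' = dualFun k f := funext fun τ =>
    ((isFourierExpansion_theta hk h'.locallyFinite h'.growth hμ').hasSum τ).unique (h'.hasSum τ)
  have hexp := isSphereExpansion_of_hasSum_polyProb hk h.locallyFinite h.growth hμ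
  have hF : 𝓕 μ = μ' :=
    fourier_eq_of_dualFun_theta_eq hk h.growth h'.growth hμ hμ' (by rw [hθ, hθ'])
  refine ⟨μ, ⟨⟨l, _, hexp⟩, l', fun m => c' m / (polysphereVol k (l' m) : ℂ), ?_⟩,
    hθ, hexp⟩
  rw [hF]
  exact isSphereExpansion_of_hasSum_polyProb hk h'.locallyFinite h'.growth hμ'

lemma thetaMap_surjective (hk : ∀ i, 0 < k i) : Function.Surjective (thetaMap (k := k) hk) := by
  rintro ⟨f, hf⟩
  obtain ⟨l, c, h⟩ := hf.2.1
  obtain ⟨μ, hμ, hθ, -⟩ := exists_meas_of_isFourierExpansion hk hf h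
  exact ⟨⟨μ, hμ⟩, Subtype.ext hθ⟩

lemma fourier_eq_self_iff (hk : ∀ i, 0 < k i) {μ : 𝓢'(Space k, ℂ)} (hμ : μ ∈ Meas k) :
    𝓕 μ = μ ↔ ∀ τ, theta k μ (negInv τ) = autFactor k τ * theta k μ τ := by
  refine ⟨fun h τ => ?_, fun h => ?_⟩
  · have e := congrFun (theta_fourier k μ) τ
    rw [h] at e
    rw [e, dualFun, mul_inv_cancel_left₀ (autFactor_ne_zero k τ)]
  · obtain ⟨⟨l, c, he⟩, -⟩ := hμ
    -- The comparison theorem with μ' = μ: the functional equation says that θ_μ equals its dual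
    -- function.
    refine fourier_eq_of_dualFun_theta_eq hk he.growth he.growth (he.hasSum_polyProb hk)
      (he.hasSum_polyProb hk) (funext fun τ => ?_)
    rw [dualFun, h, inv_mul_cancel_left₀ (autFactor_ne_zero k τ)]

end SphericalMeasures

end

/-! ### The main theorem. -/

open SphericalMeasures in
theorem mainTheorem2 {n : ℕ} [NeZero n] (k : Fin n → ℕ) (hk : ∀ i, 0 < k i) :
    -- `ω` is the Weil representation: values on the generators and compatibility with products
    ((∀ (b : Fin n → ℝ) (φ : 𝓢(Space k, ℂ)) (x : Space k),
        weilOp k (fun i => Mp2.t (b i)) φ x =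
          Complex.exp (-(Real.pi * Complex.I * ∑ i, (b i : ℂ) * ((‖x i‖ ^ 2 : ℝ) : ℂ))) * φ x) ∧
      (∀ (a : Fin n → ℝ) (ha : ∀ i, 0 < a i) (φ : 𝓢(Space k, ℂ)) (x : Space k),
        weilOp k (fun i => Mp2.rot (a i) (ha i)) φ x =
          ((∏ i, (Real.sqrt (a i))⁻¹ ^ k i : ℝ) : ℂ) *
            φ (WithLp.toLp 2 (fun i => (a i)⁻¹ • x i))) ∧
      (∀ (φ : 𝓢(Space k, ℂ)) (x : Space k),
        weilOp k (fun _ => Mp2.S) φ x =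
          (∏ i, (Complex.I ^ (1 / 2 : ℂ)) ^ k i) * (𝓕 φ) (-x)) ∧
      (∀ (M N : Fin n → Mp2) (φ : 𝓢(Space k, ℂ)),
        weilOp k (M * N) φ = weilOp k N (weilOp k M φ))) ∧
    -- equivariance
    (∀ (μ : 𝓢'(Space k, ℂ)) (M : Fin n → Mp2),
      theta k (slashDist k μ M) = slashFun k (theta k μ) M) ∧
    ∃ Θ : Meas k ≃ₗ[ℂ] FS k,
      -- the isomorphism is `μ ↦ θ_μ`
      (∀ μ : Meas k, (Θ μ : (Fin n → ℍ) → ℂ) = theta k (μ : 𝓢'(Space k, ℂ))) ∧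
      -- the inverse
      (∀ (f : FS k) (l : ℕ → Fin n → ℝ≥0) (c : ℕ → ℂ),
        IsFourierExpansion l c (f : (Fin n → ℍ) → ℂ) →
          IsSphereExpansion k l (fun m => c m / (polysphereVol k (l m) : ℂ))
            (Θ.symm f : 𝓢'(Space k, ℂ))) ∧
      -- self-dual measures
      (∀ μ : Meas k, 𝓕 (μ : 𝓢'(Space k, ℂ)) = (μ : 𝓢'(Space k, ℂ)) ↔
        ∀ τ : Fin n → ℍ, (Θ μ : (Fin n → ℍ) → ℂ) (negInv τ) =
          autFactor k τ * (Θ μ : (Fin n → ℍ) → ℂ) τ) := by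
  refine ⟨⟨weilOp_t k, weilOp_rot k, weilOp_S k, weilOp_mul k⟩, theta_slashDist k,
    LinearEquiv.ofBijective (thetaMap hk) ⟨thetaMap_injective hk, thetaMap_surjective hk⟩,
    fun μ => rfl, fun f l c h => ?_, fun μ => fourier_eq_self_iff hk μ.2⟩
  obtain ⟨μ, hμ, hθ, hexp⟩ := exists_meas_of_isFourierExpansion hk f.2 h
  -- The preimage of f is unique, so it is the measure built from the given expansion, whichever
  -- that is.
  have e : (LinearEquiv.ofBijective (thetaMap hk)
      ⟨thetaMap_injective hk, thetaMap_surjective hk⟩).symm f = ⟨μ, hμ⟩ := by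
    rw [LinearEquiv.symm_apply_eq]
    exact Subtype.ext hθ.symm
  rw [e]
  exact hexp
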